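/- Let $\mathsf P=\{p_0,\dots,p_{k-1}\}$ be a finite set of proposition letters and let $C=\wp(\mathsf P)$. A transition system $\mathbb T=\langle T,R,\sigma,s_I\rangle$ has a relation $R\subseteq T\times T$ with $R[s]\neq\emptyset$ for all $s\in T$, a labelling $\sigma$ of the nodes with sets of proposition letters, and a distinguished node $s_I$. *Automata.* For a set $A$, let $\mathrm{FO}_1^+(A)$ be the set of first-order sentences without equality over unary predicates $a\in A$ in which each predicate occurs only positively (under an even number of negations). They are interpreted in one-step models $(D,V)$, where $D\ne\emptyset$ and $V:A\to\wp(D)$. An automaton $\mathbb A=\langle A,\Delta,\Omega,a_I\rangle\in\mathit{Aut}(\mathrm{FO}_1)$ consists of a finite set $A$ of states, $a_I\in A$, $\Delta:A\times C\to\mathrm{FO}_1^+(A)$ and $\Omega:A\to\mathbb N$. It accepts $\mathbb T$ if $\exists$ has a winning strategy from $(a_I,s_I)$ in the following parity game. At $(a,s)\in A\times T$, of priority $\Omega(a)$, $\exists$ chooses $V:A\to\wp(R[s])$ with $(R[s],V)\models\Delta(a,\sigma(s)\cap\mathsf P)$; at $V$, of priority $\max\Omega[A]$, $\forall$ chooses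 $(b,t)$ with $t\in V(b)$. A player who cannot move loses, and an infinite match is won by $\exists$ iff the least priority occurring infinitely often is even. A sentence $\varphi$ that is monotone in $a$ is *continuous* in $a$ if $(D,V)\models\varphi$ implies $(D,V[a\mapsto U])\models\varphi$ for some finite $U\subseteq V(a)$; it is *co-continuous* in $a$ if $(D,V)\not\models\varphi$ implies $(D,V[a\mapsto D\setminus U])\not\models\varphi$ for some finite $U\subseteq D\setminus V(a)$ (for all $(D,V)$ in both cases). Let $\preceq$ be the reflexive-transitive closure of the relation "$b$ occurs in $\Delta(a,c)$ for some $c\in C$" between states $a$ and $b$. Then $\mathbb A\in\mathit{Aut}_{cw}(\mathrm{FO}_1)$ if for all states $a,b$ with $a\preceq b\preceq a$: $\Omega(a)=\Omega(b)$; if $\Omega(a)$ is odd, then every $\Delta(a,c)$ is continuous in $b$; if $\Omega(a)$ is even, then every $\Delta(a,c)$ is co-continuous in $b$. *Formulas.* The formulas of the modal $\mu$-calculus $\mu\mathrm{ML}$ are given by $\varphi::=q\mid\neg q\mid\varphi\wedge\varphi\mid\varphi\vee\varphi\mid\Diamond\varphi\mid\Box\varphi\mid\mu p.\varphi\mid\nu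 p.\varphi$, where $q,p$ range over an infinite set of letters containing $\mathsf P$ and $p$ is positive in the formula that $\mu p$ or $\nu p$ is applied to; the semantics is the standard one, and $\neg\varphi$ denotes the negation normal form of the negation of $\varphi$. For a set $\mathsf Q$ of letters, $\mathrm{Cont}_{\mathsf Q}$ is given by $$\varphi::=q\mid\psi\mid\varphi\vee\varphi\mid\varphi\wedge\varphi\mid\Diamond\varphi\mid\mu p.\alpha,$$ where $q\in\mathsf Q$, $\psi$ is a $\mu\mathrm{ML}$-formula in which no letter of $\mathsf Q$ is free, $p\notin\mathsf Q$ and $\alpha\in\mathrm{Cont}_{\mathsf Q\cup\{p\}}$. The fragment $\mu_c\mathrm{ML}$ is given by $$\varphi::=q\mid\neg\varphi\mid\varphi\vee\varphi\mid\Diamond\varphi\mid\mu p.\alpha,\qquad \alpha\in\mu_c\mathrm{ML}\cap\mathrm{Cont}_{\{p\}}.$$ **Theorem.** There is an effective procedure (a computable function on finite codes of $\mathsf P$ and $\mathbb A$) that, given $\mathsf P$ and an automaton $\mathbb A\in\mathit{Aut}_{cw}(\mathrm{FO}_1)$, returns a formula $\xi_{\mathbb A}\in\mu_c\mathrm{ML}$,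 with free letters in $\mathsf P$, that is equivalent to $\mathbb A$: for every transition system $\mathbb T$, $\mathbb A$ accepts $\mathbb T$ if and only if $\mathbb T\Vdash\xi_{\mathbb A}$. -/

import Mathlib

namespace ModalMu

/-! ### One-step first-order logic (without equality) -/

/-- One-step first-order formulas without equality over a set `A` of monadic predicates;
individual variables are natural numbers. -/
inductive FO1 (A : Type) : Type
  | atom (a : A) (x : ℕ) : FO1 A
  | top : FO1 A
  | bot : FO1 A
  | neg (φ : FO1 A) : FO1 A
  | and (φ ψ : FO1 A) : FO1 A
  | or (φ ψ : FO1 A) : FO1 A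
  | ex (x : ℕ) (φ : FO1 A) : FO1 A
  | all (x : ℕ) (φ : FO1 A) : FO1 A

namespace FO1

variable {A : Type}

/-- Truth of a one-step formula in the one-step model `(D, V)` under the assignment `g`. -/
def Sat {D : Type*} (V : A → Set D) : (ℕ → D) → FO1 A → Prop
  | g, atom a x => g x ∈ V a
  | _, top => True
  | _, bot => False
  | g, neg φ => ¬ Sat V g φ
  | g, and φ ψ => Sat V g φ ∧ Sat V g ψ
  | g, or φ ψ => Sat V g φ ∨ Sat V g ψ
  | g, ex x φ => ∃ d : D, Sat V (Function.update g x d) φ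
  | g, all x φ => ∀ d : D, Sat V (Function.update g x d) φ

/-- Truth of a sentence in a one-step model (whose domain is nonempty wherever this is used,
so that the truth value of a sentence is the same for all assignments). -/
def Models {D : Type*} (V : A → Set D) (φ : FO1 A) : Prop :=
  ∀ g : ℕ → D, Sat V g φ

/-- The free individual variables. -/
def free : FO1 A → Set ℕ
  | atom _ x => {x}
  | top => ∅
  | bot => ∅
  | neg φ => free φ
  | and φ ψ => free φ ∪ free ψ
  | or φ ψ => free φ ∪ free ψ
  | ex x φ => free φ \ {x}
  | all x φ => free φ \ {x}

def IsSentence (φ : FO1 A) : Prop := φ.free = ∅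

/-- `HasPolarity b φ`: every occurrence of a predicate in `φ` is under an even (`b = true`),
respectively odd (`b = false`), number of negations. -/
def HasPolarity : Bool → FO1 A → Prop
  | b, atom _ _ => b = true
  | _, top => True
  | _, bot => True
  | b, neg φ => HasPolarity (!b) φ
  | b, and φ ψ => HasPolarity b φ ∧ HasPolarity b ψ
  | b, or φ ψ => HasPolarity b φ ∧ HasPolarity b ψ
  | b, ex _ φ => HasPolarity b φ
  | b, all _ φ => HasPolarity b φ

/-- All predicates occur only positively. -/
def IsPositive (φ : FO1 A) : Prop := HasPolarity true φ

/-- The predicate `a` occurs in the formula. -/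
def Occurs (a : A) : FO1 A → Prop
  | atom b _ => b = a
  | top => False
  | bot => False
  | neg φ => Occurs a φ
  | and φ ψ => Occurs a φ ∨ Occurs a ψ
  | or φ ψ => Occurs a φ ∨ Occurs a ψ
  | ex _ φ => Occurs a φ
  | all _ φ => Occurs a φ

def MonotoneIn [DecidableEq A] (a : A) (φ : FO1 A) : Prop :=
  ∀ (D : Type) (V : A → Set D) (g : ℕ → D) (E : Set D),
    Sat V g φ → V a ⊆ E → Sat (Function.update V a E) g φ

/-- Continuity: truth is preserved when the predicate `a` is shrunk to a suitable finite subset. -/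
def ContinuousIn [DecidableEq A] (a : A) (φ : FO1 A) : Prop :=
  MonotoneIn a φ ∧
  ∀ (D : Type) (V : A → Set D) (g : ℕ → D), Sat V g φ →
    ∃ U : Set D, U.Finite ∧ U ⊆ V a ∧ Sat (Function.update V a U) g φ

/-- Co-continuity, the Boolean dual of continuity: falsity is preserved when the complement of
the predicate `a` is shrunk to a suitable finite subset. -/
def CocontinuousIn [DecidableEq A] (a : A) (φ : FO1 A) : Prop :=
  MonotoneIn a φ ∧
  ∀ (D : Type) (V : A → Set D) (g : ℕ → D), ¬ Sat V g φ →
    ∃ U : Set D, U.Finite ∧ U ⊆ (V a)ᶜ ∧ ¬ Sat (Function.update V a Uᶜ) g φ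

/-- Gödel number of a one-step formula over the predicates `0, …, n - 1`. -/
def code {n : ℕ} : FO1 (Fin n) → ℕ
  | atom a x => Nat.pair 0 (Nat.pair a x) + 1
  | top => Nat.pair 1 0 + 1
  | bot => Nat.pair 2 0 + 1
  | neg φ => Nat.pair 3 (code φ) + 1
  | and φ ψ => Nat.pair 4 (Nat.pair (code φ) (code ψ)) + 1
  | or φ ψ => Nat.pair 5 (Nat.pair (code φ) (code ψ)) + 1
  | ex x φ => Nat.pair 6 (Nat.pair x (code φ)) + 1
  | all x φ => Nat.pair 7 (Nat.pair x (code φ)) + 1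

theorem code_injective {n : ℕ} : Function.Injective (code (n := n)) := by
  intro φ
  induction φ with
  | atom a x => intro ψ h; cases ψ <;> simp_all [code, Nat.pair_eq_pair, Fin.ext_iff]
  | top => intro ψ h; cases ψ <;> simp_all [code, Nat.pair_eq_pair]
  | bot => intro ψ h; cases ψ <;> simp_all [code, Nat.pair_eq_pair]
  | neg φ ih =>
    intro ψ h
    cases ψ <;> simp [code, Nat.pair_eq_pair] at h ⊢
    exact ih h
  | and φ₁ φ₂ ih₁ ih₂ =>
    intro ψ h
    cases ψ <;> simp [code, Nat.pair_eq_pair] at h ⊢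
    exact ⟨ih₁ h.1, ih₂ h.2⟩
  | or φ₁ φ₂ ih₁ ih₂ =>
    intro ψ h
    cases ψ <;> simp [code, Nat.pair_eq_pair] at h ⊢
    exact ⟨ih₁ h.1, ih₂ h.2⟩
  | ex x φ ih =>
    intro ψ h
    cases ψ <;> simp [code, Nat.pair_eq_pair] at h ⊢
    exact ⟨h.1, ih h.2⟩
  | all x φ ih =>
    intro ψ h
    cases ψ <;> simp [code, Nat.pair_eq_pair] at h ⊢
    exact ⟨h.1, ih h.2⟩

end FO1

/-! ### Transition systems -/

/-- A labelled transition system with domain `T` in which every node has a successor.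
Proposition letters are natural numbers; the systems labelled over the letters
`0, …, k - 1` are those with `σ s ⊆ {p | p < k}` for all `s`. -/
structure LTS (T : Type*) where
  R : T → T → Prop
  σ : T → Set ℕ
  init : T
  serial : ∀ s, ∃ t, R s t

/-- The colour of a node, restricted to the proposition letters `0, …, k - 1`. -/
def LTS.color {T : Type*} (S : LTS T) (k : ℕ) (s : T) : Set (Fin k) :=
  {p | (p : ℕ) ∈ S.σ s}

/-! ### Parity games -/

/-- A parity game on the board `G`; positions outside `eloise` belong to Abelard. -/
structure ParityGame (G : Type*) where
  eloise : Set G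
  E : G → G → Prop
  Ω : G → ℕ

namespace ParityGame

variable {G : Type*} (𝒢 : ParityGame G)

/-- `π` is a finite match starting at `u` and guided by the strategy `f` of Eloise, which sends
the list of all positions visited so far to the next position. -/
def GuidedFinite (f : List G → G) (u : G) (π : List G) : Prop :=
  π.head? = some u ∧ π.IsChain 𝒢.E ∧
    ∀ (i : ℕ) (hi : i + 1 < π.length), π[i] ∈ 𝒢.eloise → π[i + 1] = f (π.take (i + 1))

/-- `π` is an infinite match starting at `u` and guided by the strategy `f` of Eloise. -/
def GuidedInfinite (f : List G → G) (u : G) (π : ℕ → G) : Prop :=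
  π 0 = u ∧ (∀ i, 𝒢.E (π i) (π (i + 1))) ∧
    ∀ i, π i ∈ 𝒢.eloise → π (i + 1) = f ((List.range (i + 1)).map π)

/-- An infinite match is won by Eloise if the least priority that occurs infinitely often is
even. -/
def InfWin (π : ℕ → G) : Prop :=
  ∃ m, Even m ∧ (∃ᶠ i in Filter.atTop, 𝒢.Ω (π i) = m) ∧
    ∀ᶠ i in Filter.atTop, m ≤ 𝒢.Ω (π i)

/-- `f` is a winning strategy for Eloise at `u`: it gives a legitimate move in every guided finite
match that ends in a position of hers (so that she never gets stuck), and she wins every infinite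
guided match. -/
def IsWinning (f : List G → G) (u : G) : Prop :=
  (∀ (π : List G) (v : G), 𝒢.GuidedFinite f u π → π.getLast? = some v → v ∈ 𝒢.eloise →
    𝒢.E v (f π)) ∧
  ∀ π : ℕ → G, 𝒢.GuidedInfinite f u π → 𝒢.InfWin π

def EloiseWins (u : G) : Prop := ∃ f : List G → G, 𝒢.IsWinning f u

end ParityGame

/-! ### Automata -/

/-- Parity automata with state set `A`, one-step language `FO1`, and alphabet the powerset of the
set `{0, …, k - 1}` of proposition letters. -/
structure Automaton (k : ℕ) (A : Type) where
  Δ : A → Set (Fin k) → FO1 A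
  Ω : A → ℕ
  init : A
  sentence : ∀ a c, (Δ a c).IsSentence
  positive : ∀ a c, (Δ a c).IsPositive

namespace Automaton

variable {k : ℕ} {A : Type}

/-- The acceptance game. From `(a, s)` Eloise picks a valuation `V` of the states in the set of
successors of `s` that makes `Δ (a, σ s)` true there; from `V` Abelard picks `(b, t)` with
`t ∈ V b`. -/
def game [Fintype A] (𝔸 : Automaton k A) {T : Type*} (S : LTS T) :
    ParityGame ((A × T) ⊕ (A → Set T)) where
  eloise := {u | ∃ q, u = Sum.inl q}
  E u v :=
    match u, v with
    | Sum.inl (a, s), Sum.inr V =>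
        (∀ b, V b ⊆ {t | S.R s t}) ∧
          FO1.Models (D := {t // S.R s t}) (fun b => {t | (t : T) ∈ V b}) (𝔸.Δ a (S.color k s))
    | Sum.inr V, Sum.inl (b, t) => t ∈ V b
    | _, _ => False
  Ω u :=
    match u with
    | Sum.inl (a, _) => 𝔸.Ω a
    | Sum.inr _ => Finset.univ.sup 𝔸.Ω

def Accepts [Fintype A] (𝔸 : Automaton k A) {T : Type*} (S : LTS T) : Prop :=
  (𝔸.game S).EloiseWins (Sum.inl (𝔸.init, S.init))

/-- There is a transition from `a` to `b`. -/
def Leads (𝔸 : Automaton k A) (a b : A) : Prop := ∃ c, (𝔸.Δ a c).Occurs b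

def Reach (𝔸 : Automaton k A) : A → A → Prop := Relation.ReflTransGen 𝔸.Leads

/-- Continuous-weak automata. -/
def IsContinuousWeak [DecidableEq A] (𝔸 : Automaton k A) : Prop :=
  ∀ a b, 𝔸.Reach a b → 𝔸.Reach b a →
    𝔸.Ω a = 𝔸.Ω b ∧
    (Odd (𝔸.Ω a) → ∀ c, (𝔸.Δ a c).ContinuousIn b) ∧
    (Even (𝔸.Ω a) → ∀ c, (𝔸.Δ a c).CocontinuousIn b)

/-- The finite data by which an automaton with states `0, …, n - 1` is presented to an algorithm:
the number of letters, the number of states, the initial state, the list of priorities, and the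
transition table. The table has one row for each state; the entry number `j` of a row is the Gödel
number of the formula for the colour whose letters are the positions of the ones in the binary
expansion of `j`. -/
def data {n : ℕ} (𝔸 : Automaton k (Fin n)) : ℕ × ℕ × ℕ × List ℕ × List (List ℕ) :=
  (k, n, (𝔸.init : ℕ), List.ofFn 𝔸.Ω,
    List.ofFn fun a : Fin n => List.ofFn fun j : Fin (2 ^ k) =>
      (𝔸.Δ a {p | (j : ℕ).testBit (p : ℕ) = true}).code)

end Automaton

/-! ### The modal μ-calculus and its fragment -/

/-- Raw formulas of the modal μ-calculus in negation normal form; proposition letters and fixpoint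
variables are natural numbers. Proper formulas are those satisfying `MuML.WF`. -/
inductive MuML : Type
  | var (q : ℕ) : MuML
  | nvar (q : ℕ) : MuML
  | and (φ ψ : MuML) : MuML
  | or (φ ψ : MuML) : MuML
  | dia (φ : MuML) : MuML
  | box (φ : MuML) : MuML
  | mu (p : ℕ) (φ : MuML) : MuML
  | nu (p : ℕ) (φ : MuML) : MuML

namespace MuML

/-- The letters with a free occurrence. -/
def free : MuML → Set ℕ
  | var q => {q}
  | nvar q => {q}
  | and φ ψ => free φ ∪ free ψ
  | or φ ψ => free φ ∪ free ψ
  | dia φ => free φ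
  | box φ => free φ
  | mu p φ => free φ \ {p}
  | nu p φ => free φ \ {p}

/-- No free occurrence of `p` is negated. -/
def PosIn (p : ℕ) : MuML → Prop
  | var _ => True
  | nvar q => q ≠ p
  | and φ ψ => PosIn p φ ∧ PosIn p ψ
  | or φ ψ => PosIn p φ ∧ PosIn p ψ
  | dia φ => PosIn p φ
  | box φ => PosIn p φ
  | mu q φ => q = p ∨ PosIn p φ
  | nu q φ => q = p ∨ PosIn p φ

/-- Each fixpoint operator binds a variable that is positive in its body. -/
def WF : MuML → Prop
  | var _ => True
  | nvar _ => True
  | and φ ψ => WF φ ∧ WF ψ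
  | or φ ψ => WF φ ∧ WF ψ
  | dia φ => WF φ
  | box φ => WF φ
  | mu p φ => PosIn p φ ∧ WF φ
  | nu p φ => PosIn p φ ∧ WF φ

/-- The meaning of a formula in the frame `(T, R)` with valuation `V`. -/
def sem {T : Type*} (R : T → T → Prop) : (ℕ → Set T) → MuML → Set T
  | V, var q => V q
  | V, nvar q => (V q)ᶜ
  | V, and φ ψ => sem R V φ ∩ sem R V ψ
  | V, or φ ψ => sem R V φ ∪ sem R V ψ
  | V, dia φ => {s | ∃ t, R s t ∧ t ∈ sem R V φ}
  | V, box φ => {s | ∀ t, R s t → t ∈ sem R V φ}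
  | V, mu p φ => ⋂₀ {S | sem R (Function.update V p S) φ ⊆ S}
  | V, nu p φ => ⋃₀ {S | S ⊆ sem R (Function.update V p S) φ}

/-- Truth at the distinguished node of a transition system. -/
def Holds {T : Type*} (S : LTS T) (φ : MuML) : Prop :=
  S.init ∈ sem S.R (fun p => {s | p ∈ S.σ s}) φ

/-- Negation, pushed down to the letters; the variables in `B` (those bound further up) are kept,
as in `¬ μ p. φ(p) = ν p. ¬ φ(¬ p)`. -/
def complAux : Finset ℕ → MuML → MuML
  | B, var q => if q ∈ B then var q else nvar q
  | B, nvar q => if q ∈ B then nvar q else var q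
  | B, and φ ψ => or (complAux B φ) (complAux B ψ)
  | B, or φ ψ => and (complAux B φ) (complAux B ψ)
  | B, dia φ => box (complAux B φ)
  | B, box φ => dia (complAux B φ)
  | B, mu p φ => nu p (complAux (insert p B) φ)
  | B, nu p φ => mu p (complAux (insert p B) φ)

/-- The negation `¬ φ` of a formula. -/
def compl (φ : MuML) : MuML := complAux ∅ φ

/-- The fragment that is (syntactically) continuous in the set `Q` of letters. -/
inductive Cont : Set ℕ → MuML → Prop
  | var {Q : Set ℕ} {q : ℕ} : q ∈ Q → Cont Q (var q)
  | free {Q : Set ℕ} {ψ : MuML} : ψ.WF → Disjoint Q ψ.free → Cont Q ψ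
  | or {Q : Set ℕ} {φ ψ : MuML} : Cont Q φ → Cont Q ψ → Cont Q (or φ ψ)
  | and {Q : Set ℕ} {φ ψ : MuML} : Cont Q φ → Cont Q ψ → Cont Q (and φ ψ)
  | dia {Q : Set ℕ} {φ : MuML} : Cont Q φ → Cont Q (dia φ)
  | mu {Q : Set ℕ} {p : ℕ} {α : MuML} : p ∉ Q → Cont (insert p Q) α → Cont Q (mu p α)

/-- The fragment `μ_c ML`: the least fixpoint operator `μ p` is applied only to formulas of the
fragment that are continuous in `p`. -/
inductive MuC : MuML → Prop
  | var (q : ℕ) : MuC (var q)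
  | neg {φ : MuML} : MuC φ → MuC φ.compl
  | or {φ ψ : MuML} : MuC φ → MuC ψ → MuC (or φ ψ)
  | dia {φ : MuML} : MuC φ → MuC (dia φ)
  | mu {p : ℕ} {α : MuML} : MuC α → Cont {p} α → MuC (mu p α)

/-- Gödel number of a formula. -/
def code : MuML → ℕ
  | var q => Nat.pair 0 q + 1
  | nvar q => Nat.pair 1 q + 1
  | and φ ψ => Nat.pair 2 (Nat.pair (code φ) (code ψ)) + 1
  | or φ ψ => Nat.pair 3 (Nat.pair (code φ) (code ψ)) + 1
  | dia φ => Nat.pair 4 (code φ) + 1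
  | box φ => Nat.pair 5 (code φ) + 1
  | mu p φ => Nat.pair 6 (Nat.pair p (code φ)) + 1
  | nu p φ => Nat.pair 7 (Nat.pair p (code φ)) + 1

theorem code_injective : Function.Injective code := by
  intro φ
  induction φ with
  | var q => intro ψ h; cases ψ <;> simp_all [code, Nat.pair_eq_pair]
  | nvar q => intro ψ h; cases ψ <;> simp_all [code, Nat.pair_eq_pair]
  | and φ₁ φ₂ ih₁ ih₂ =>
    intro ψ h
    cases ψ <;> simp [code, Nat.pair_eq_pair] at h ⊢
    exact ⟨ih₁ h.1, ih₂ h.2⟩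
  | or φ₁ φ₂ ih₁ ih₂ =>
    intro ψ h
    cases ψ <;> simp [code, Nat.pair_eq_pair] at h ⊢
    exact ⟨ih₁ h.1, ih₂ h.2⟩
  | dia φ ih =>
    intro ψ h
    cases ψ <;> simp [code, Nat.pair_eq_pair] at h ⊢
    exact ih h
  | box φ ih =>
    intro ψ h
    cases ψ <;> simp [code, Nat.pair_eq_pair] at h ⊢
    exact ih h
  | mu p φ ih =>
    intro ψ h
    cases ψ <;> simp [code, Nat.pair_eq_pair] at h ⊢
    exact ⟨h.1, ih h.2⟩
  | nu p φ ih =>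
    intro ψ h
    cases ψ <;> simp [code, Nat.pair_eq_pair] at h ⊢
    exact ⟨h.1, ih h.2⟩

end MuML

end ModalMu

/-!
The acceptance game of a continuous-weak automaton is solved cluster by cluster, where a cluster is
a class of states `a ⪯ b ⪯ a`. Let `W` be the family of winning regions of Eloise, indexed by the
states, and let `Φ` (`Automaton.step`) be the monotone operator of one round of the game. Then
`Φ W = W` (`winRegion_le_step`, `step_winRegion_le`), and on a cluster of odd (even) priority `W` is
the least (greatest) fixpoint of `Φ`, with the other clusters fixed to `W` (`lfpOn_cluster`,
`gfpOn_cluster`). Neither part needs determinacy.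
For a prefixpoint `X` on an odd cluster, a winning position outside `X` would allow Abelard to keep a
match in the cluster forever against a winning strategy; for a postfixpoint `X` on an even cluster,
Eloise wins by staying in `X` until the cluster is left for a winning position.

Such a simultaneous fixpoint is unravelled into formulas by Bekič's principle (`lfpOn_eq_sInf`): the
state `a` becomes `μ x_a. ψ_a` or `ν x_a. ψ_a`, where `ψ_a` describes the transition conditions of `a`
and its successor states are translated with `a` bound, until a bound state is met, which becomes a
variable (`trans`, `sem_formula`). The variable of a bound state is free only in the formulas for
states of its cluster (`BoundReach.mem_cluster`), so that states of other clusters denote their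
winning regions.

The transition conditions become modal through a normal form. Without equality, a positive sentence
is equivalent to a disjunction of conjunctions of sentences `∃ x, ⋀ a ∈ S, a(x)` and
`∀ x, ⋁ a ∈ S, a(x)`, which quantifier elimination computes (`FO1.sat_normalForm`) and which are
diamonds and boxes. If the sentence is continuous in a predicate, then this predicate may be dropped
from the universal sentences (`FO1.sat_prune_of_continuousIn`): in a model in which each element has
infinitely many copies, the predicate can be shrunk to a finite set, which misses a copy of each
element. Dually, predicates in which the sentence is co-continuous may be dropped from the
existential sentences. Hence no variable of a `μ`-cluster occurs under a box, and no variable of a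
`ν`-cluster under a diamond, which gives membership in `μ_c ML` (`isNormal_formula`,
`IsNormal.muC`).

For computability the translation is carried out over an arbitrary carrier of formulas. On Gödel
numbers both the normal forms and the translation are course-of-values recursions, the latter on the
set of unbound states coded by a binary expansion, and hence primitive recursive
(`AutData.primrec_translate`).
-/

/-! ### Disjunctive normal forms of one-step sentences -/

namespace ModalMu

/-- The literals of the normal form of one-step formulas: `inl (a, x)` stands for `a(x)`,
`inr (true, S)` for `∃ x, ⋀ a ∈ S, a(x)`, and `inr (false, S)` for `∀ x, ⋁ a ∈ S, a(x)`. -/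
abbrev Lit : Type := (ℕ × ℕ) ⊕ (Bool × List ℕ)

/-- A disjunctive normal form: a disjunction of conjunctions of literals. -/
abbrev DNF : Type := List (List Lit)

/-- All ways to choose one element from each list; this turns a conjunction of disjunctions into a
disjunction of conjunctions, and conversely. -/
def choices {α : Type*} (L : List (List α)) : List (List α) :=
  L.foldr (fun c acc => c.flatMap fun x => acc.map (x :: ·)) [[]]

theorem exists_choices_forall {α : Type*} (P : α → Prop) (L : List (List α)) :
    (∃ r ∈ choices L, ∀ x ∈ r, P x) ↔ ∀ c ∈ L, ∃ x ∈ c, P x := by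
  induction L with
  | nil => simp [choices]
  | cons c L ih =>
    rw [List.forall_mem_cons, ← ih]
    have : choices (c :: L) = c.flatMap fun x => (choices L).map (x :: ·) := rfl
    rw [this]
    constructor
    · rintro ⟨r, hr, h⟩
      simp only [List.mem_flatMap, List.mem_map] at hr
      obtain ⟨x, hx, r', hr', rfl⟩ := hr
      exact ⟨⟨x, hx, h x (by simp)⟩, r', hr', fun y hy => h y (by simp [hy])⟩
    · rintro ⟨⟨x, hx, hPx⟩, r', hr', h⟩
      exact ⟨x :: r', List.mem_flatMap.2 ⟨x, hx, List.mem_map.2 ⟨r', hr', rfl⟩⟩, by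
        simpa [hPx] using h⟩

theorem forall_choices_exists {α : Type*} (P : α → Prop) (L : List (List α)) :
    (∀ r ∈ choices L, ∃ x ∈ r, P x) ↔ ∃ c ∈ L, ∀ x ∈ c, P x := by
  have := exists_choices_forall (fun x => ¬ P x) L
  rw [← not_iff_not]
  push Not
  exact this

theorem exists_mem_of_mem_choices {α : Type*} {L : List (List α)} {r : List α} {x : α}
    (hr : r ∈ choices L) (hx : x ∈ r) : ∃ c ∈ L, x ∈ c := by
  induction L generalizing r with
  | nil => simp_all [choices]
  | cons c L ih =>
    have : choices (c :: L) = c.flatMap fun x => (choices L).map (x :: ·) := rfl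
    rw [this] at hr
    simp only [List.mem_flatMap, List.mem_map] at hr
    obtain ⟨y, hy, r', hr', rfl⟩ := hr
    rcases List.mem_cons.1 hx with rfl | hx
    · exact ⟨c, by simp, hy⟩
    · obtain ⟨c', hc', h⟩ := ih hr' hx
      exact ⟨c', by simp [hc'], h⟩

/-- Truth of a literal. -/
def Lit.Sat {D : Type*} (V : ℕ → Set D) (g : ℕ → D) : Lit → Prop
  | .inl (a, x) => g x ∈ V a
  | .inr (true, S) => ∃ d, ∀ a ∈ S, d ∈ V a
  | .inr (false, S) => ∀ d, ∃ a ∈ S, d ∈ V a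

/-- Truth of a disjunctive normal form. -/
def DNF.Sat {D : Type*} (V : ℕ → Set D) (g : ℕ → D) (d : DNF) : Prop :=
  ∃ c ∈ d, ∀ l ∈ c, Lit.Sat V g l

/-- The predicates `a` for which the literal `a(x)` occurs in the list. -/
def atomsAt (x : ℕ) (c : List Lit) : List ℕ :=
  c.flatMap fun l => match l with
    | .inl (a, y) => if y = x then [a] else []
    | .inr _ => []

/-- The literals of the list in which the individual variable `x` does not occur. -/
def litsOff (x : ℕ) (c : List Lit) : List Lit :=
  c.flatMap fun l => match l with
    | .inl (a, y) => if y = x then [] else [.inl (a, y)]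
    | .inr p => [.inr p]

theorem mem_atomsAt {x a : ℕ} {c : List Lit} : a ∈ atomsAt x c ↔ .inl (a, x) ∈ c := by
  simp only [atomsAt, List.mem_flatMap]
  constructor
  · rintro ⟨(⟨b, y⟩ | p), hl, h⟩
    · by_cases hy : y = x
      · simp_all
      · simp [hy] at h
    · simp at h
  · intro h
    exact ⟨_, h, by simp⟩

theorem inl_mem_litsOff {x a y : ℕ} {c : List Lit} :
    .inl (a, y) ∈ litsOff x c ↔ .inl (a, y) ∈ c ∧ y ≠ x := by
  simp only [litsOff, List.mem_flatMap]
  constructor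
  · rintro ⟨(⟨b, z⟩ | p), hl, h⟩
    · by_cases hz : z = x
      · simp [hz] at h
      · simp only [hz, if_false, List.mem_singleton, Sum.inl.injEq, Prod.mk.injEq] at h
        obtain ⟨rfl, rfl⟩ := h
        exact ⟨hl, hz⟩
    · simp at h
  · rintro ⟨h, hy⟩
    exact ⟨_, h, by simp [hy]⟩

theorem inr_mem_litsOff {x : ℕ} {p : Bool × List ℕ} {c : List Lit} :
    .inr p ∈ litsOff x c ↔ .inr p ∈ c := by
  simp only [litsOff, List.mem_flatMap]
  constructor
  · rintro ⟨(⟨b, z⟩ | q), hl, h⟩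
    · by_cases hz : z = x <;> simp [hz] at h
    · simp_all
  · intro h
    exact ⟨_, h, by simp⟩

/-- Collects the literals in which `x` occurs into a single quantified literal. Applied to a
conjunction (with `b = true`) this is the quantifier `∃ x`, to a disjunction (with `b = false`) it
is `∀ x`. -/
def quantify (b : Bool) (x : ℕ) (c : List Lit) : List Lit :=
  .inr (b, atomsAt x c) :: litsOff x c

section

variable {D : Type*} (V : ℕ → Set D) (g : ℕ → D)

theorem Lit.sat_update_of_mem_litsOff {x : ℕ} {c : List Lit} {l : Lit} (d : D)
    (hl : l ∈ litsOff x c) : Lit.Sat V (Function.update g x d) l ↔ Lit.Sat V g l := by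
  rcases l with ⟨a, y⟩ | ⟨b, S⟩
  · have := (inl_mem_litsOff.1 hl).2
    simp [Lit.Sat, Function.update_of_ne this]
  · cases b <;> rfl

theorem forall_mem_iff_atomsAt {x : ℕ} {c : List Lit} (P : Lit → Prop) :
    (∀ l ∈ c, P l) ↔ (∀ a ∈ atomsAt x c, P (.inl (a, x))) ∧ ∀ l ∈ litsOff x c, P l := by
  constructor
  · intro h
    refine ⟨fun a ha => h _ (mem_atomsAt.1 ha), ?_⟩
    rintro (⟨a, y⟩ | p) hl
    · exact h _ (inl_mem_litsOff.1 hl).1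
    · exact h _ (inr_mem_litsOff.1 hl)
  · rintro ⟨h₁, h₂⟩ (⟨a, y⟩ | p) hl
    · by_cases hy : y = x
      · subst hy; exact h₁ a (mem_atomsAt.2 hl)
      · exact h₂ _ (inl_mem_litsOff.2 ⟨hl, hy⟩)
    · exact h₂ _ (inr_mem_litsOff.2 hl)

theorem forall_quantify_true {x : ℕ} {c : List Lit} :
    (∀ l ∈ quantify true x c, Lit.Sat V g l) ↔
      ∃ d, ∀ l ∈ c, Lit.Sat V (Function.update g x d) l := by
  simp only [quantify, List.forall_mem_cons, forall_mem_iff_atomsAt (x := x) (c := c)]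
  constructor
  · rintro ⟨⟨d, hd⟩, h⟩
    refine ⟨d, fun a ha => ?_, fun l hl => (Lit.sat_update_of_mem_litsOff V g d hl).2 (h l hl)⟩
    simpa [Lit.Sat] using hd a ha
  · rintro ⟨d, hd, h⟩
    refine ⟨⟨d, fun a ha => ?_⟩, fun l hl => (Lit.sat_update_of_mem_litsOff V g d hl).1 (h l hl)⟩
    simpa [Lit.Sat] using hd a ha

theorem exists_quantify_false {x : ℕ} {c : List Lit} :
    (∃ l ∈ quantify false x c, Lit.Sat V g l) ↔
      ∀ d, ∃ l ∈ c, Lit.Sat V (Function.update g x d) l := by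
  rw [← not_iff_not]
  push Not
  simp only [quantify, List.forall_mem_cons, forall_mem_iff_atomsAt (x := x) (c := c)]
  constructor
  · rintro ⟨hd, h⟩
    simp only [Lit.Sat] at hd
    push Not at hd
    obtain ⟨d, hd⟩ := hd
    refine ⟨d, fun a ha => ?_, fun l hl => mt (Lit.sat_update_of_mem_litsOff V g d hl).1 (h l hl)⟩
    simpa [Lit.Sat] using hd a ha
  · rintro ⟨d, hd, h⟩
    refine ⟨?_, fun l hl => mt (Lit.sat_update_of_mem_litsOff V g d hl).2 (h l hl)⟩
    simp only [Lit.Sat]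
    push Not
    exact ⟨d, fun a ha => by simpa [Lit.Sat] using hd a ha⟩

end

namespace DNF

/-- Conjunction, by distributivity. -/
protected def and (d e : DNF) : DNF := d.flatMap fun c => e.map (c ++ ·)

/-- Existential quantification distributes over the disjuncts. -/
protected def ex (x : ℕ) (d : DNF) : DNF := d.map (quantify true x)

/-- Universal quantification distributes over the conjuncts of a conjunctive normal form. -/
protected def all (x : ℕ) (d : DNF) : DNF := choices ((choices d).map (quantify false x))

section

variable {D : Type*} (V : ℕ → Set D) (g : ℕ → D)

theorem sat_and (d e : DNF) : Sat V g (d.and e) ↔ Sat V g d ∧ Sat V g e := by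
  simp only [Sat, DNF.and, List.mem_flatMap, List.mem_map]
  constructor
  · rintro ⟨_, ⟨c, hc, c', hc', rfl⟩, h⟩
    exact ⟨⟨c, hc, fun l hl => h l (by simp [hl])⟩, c', hc', fun l hl => h l (by simp [hl])⟩
  · rintro ⟨⟨c, hc, h⟩, c', hc', h'⟩
    exact ⟨_, ⟨c, hc, c', hc', rfl⟩, fun l hl => (List.mem_append.1 hl).elim (h l) (h' l)⟩

theorem sat_append (d e : DNF) : Sat V g (d ++ e) ↔ Sat V g d ∨ Sat V g e := by
  simp only [Sat, List.mem_append, or_and_right, exists_or]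

theorem sat_ex (x : ℕ) (d : DNF) :
    Sat V g (d.ex x) ↔ ∃ a, Sat V (Function.update g x a) d := by
  simp only [Sat, DNF.ex, List.mem_map, exists_exists_and_eq_and, forall_quantify_true]
  exact ⟨fun ⟨c, hc, a, h⟩ => ⟨a, c, hc, h⟩, fun ⟨a, c, hc, h⟩ => ⟨c, hc, a, h⟩⟩

theorem sat_all (x : ℕ) (d : DNF) :
    Sat V g (d.all x) ↔ ∀ a, Sat V (Function.update g x a) d := by
  simp only [Sat, DNF.all, exists_choices_forall, List.forall_mem_map, exists_quantify_false]
  simp only [← forall_choices_exists]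
  exact ⟨fun h a r hr => h r hr a, fun h r hr a => h a r hr⟩

end

/-- The predicate `a` occurs in the normal form. -/
def Mentions (a : ℕ) (d : DNF) : Prop :=
  ∃ c ∈ d, ∃ l ∈ c, (∃ x, l = .inl (a, x)) ∨ ∃ b S, l = .inr (b, S) ∧ a ∈ S

/-- The individual variable `x` occurs free in the normal form. -/
def HasFree (x : ℕ) (d : DNF) : Prop := ∃ c ∈ d, ∃ a, Sum.inl (a, x) ∈ c

end DNF

theorem mentions_quantify {a x : ℕ} {b : Bool} {c : List Lit}
    (h : ∃ l ∈ quantify b x c, (∃ y, l = .inl (a, y)) ∨ ∃ b S, l = .inr (b, S) ∧ a ∈ S) :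
    ∃ l ∈ c, (∃ y, l = .inl (a, y)) ∨ ∃ b S, l = .inr (b, S) ∧ a ∈ S := by
  obtain ⟨l, hl, h⟩ := h
  rcases List.mem_cons.1 hl with rfl | hl
  · rcases h with ⟨y, h⟩ | ⟨b', S, h, ha⟩
    · simp at h
    · simp only [Sum.inr.injEq, Prod.mk.injEq] at h
      obtain ⟨rfl, rfl⟩ := h
      exact ⟨_, mem_atomsAt.1 ha, .inl ⟨_, rfl⟩⟩
  · refine ⟨l, ?_, h⟩
    rcases l with ⟨a, y⟩ | p
    · exact (inl_mem_litsOff.1 hl).1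
    · exact inr_mem_litsOff.1 hl

theorem inl_mem_quantify {a x y : ℕ} {b : Bool} {c : List Lit} :
    Sum.inl (a, y) ∈ quantify b x c ↔ Sum.inl (a, y) ∈ c ∧ y ≠ x := by
  simp [quantify, inl_mem_litsOff]

namespace DNF

theorem mentions_and {a : ℕ} {d e : DNF} (h : Mentions a (d.and e)) :
    Mentions a d ∨ Mentions a e := by
  obtain ⟨c, hc, l, hl, h⟩ := h
  simp only [DNF.and, List.mem_flatMap, List.mem_map] at hc
  obtain ⟨c, hc, c', hc', rfl⟩ := hc
  rcases List.mem_append.1 hl with hl | hl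
  · exact .inl ⟨c, hc, l, hl, h⟩
  · exact .inr ⟨c', hc', l, hl, h⟩

theorem mentions_append {a : ℕ} {d e : DNF} (h : Mentions a (d ++ e)) :
    Mentions a d ∨ Mentions a e := by
  obtain ⟨c, hc, l, hl, h⟩ := h
  rcases List.mem_append.1 hc with hc | hc
  · exact .inl ⟨c, hc, l, hl, h⟩
  · exact .inr ⟨c, hc, l, hl, h⟩

theorem mentions_ex {a x : ℕ} {d : DNF} (h : Mentions a (d.ex x)) : Mentions a d := by
  obtain ⟨c, hc, h⟩ := h
  obtain ⟨c', hc', rfl⟩ := List.mem_map.1 hc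
  exact ⟨c', hc', mentions_quantify h⟩

theorem mentions_all {a x : ℕ} {d : DNF} (h : Mentions a (d.all x)) : Mentions a d := by
  obtain ⟨c, hc, l, hl, h⟩ := h
  obtain ⟨c', hc', hl'⟩ := exists_mem_of_mem_choices hc hl
  obtain ⟨r, hr, rfl⟩ := List.mem_map.1 hc'
  obtain ⟨m, hm, h'⟩ := mentions_quantify ⟨l, hl', h⟩
  obtain ⟨e, he, hme⟩ := exists_mem_of_mem_choices hr hm
  exact ⟨e, he, m, hme, h'⟩

theorem hasFree_and {x : ℕ} {d e : DNF} (h : HasFree x (d.and e)) : HasFree x d ∨ HasFree x e := by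
  obtain ⟨c, hc, a, h⟩ := h
  simp only [DNF.and, List.mem_flatMap, List.mem_map] at hc
  obtain ⟨c, hc, c', hc', rfl⟩ := hc
  rcases List.mem_append.1 h with h | h
  · exact .inl ⟨c, hc, a, h⟩
  · exact .inr ⟨c', hc', a, h⟩

theorem hasFree_append {x : ℕ} {d e : DNF} (h : HasFree x (d ++ e)) :
    HasFree x d ∨ HasFree x e := by
  obtain ⟨c, hc, h⟩ := h
  rcases List.mem_append.1 hc with hc | hc
  · exact .inl ⟨c, hc, h⟩
  · exact .inr ⟨c, hc, h⟩

theorem hasFree_ex {x y : ℕ} {d : DNF} (h : HasFree y (d.ex x)) : HasFree y d ∧ y ≠ x := by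
  obtain ⟨c, hc, a, h⟩ := h
  obtain ⟨c', hc', rfl⟩ := List.mem_map.1 hc
  rw [inl_mem_quantify] at h
  exact ⟨⟨c', hc', a, h.1⟩, h.2⟩

theorem hasFree_all {x y : ℕ} {d : DNF} (h : HasFree y (d.all x)) : HasFree y d ∧ y ≠ x := by
  obtain ⟨c, hc, a, hl⟩ := h
  obtain ⟨c', hc', hl'⟩ := exists_mem_of_mem_choices hc hl
  obtain ⟨r, hr, rfl⟩ := List.mem_map.1 hc'
  rw [inl_mem_quantify] at hl'
  obtain ⟨e, he, hme⟩ := exists_mem_of_mem_choices hr hl'.1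
  exact ⟨⟨e, he, a, hme⟩, hl'.2⟩

end DNF

namespace FO1

variable {n : ℕ}

/-- Normal forms of `φ` and of `¬ φ`; the first is correct if `φ` has positive polarity, the second
if `φ` has negative polarity. -/
def normalForm : FO1 (Fin n) → DNF × DNF
  | atom a x => ([[.inl (a, x)]], [])
  | top => ([[]], [])
  | bot => ([], [[]])
  | neg φ => ((normalForm φ).2, (normalForm φ).1)
  | and φ ψ => ((normalForm φ).1.and (normalForm ψ).1, (normalForm φ).2 ++ (normalForm ψ).2)
  | or φ ψ => ((normalForm φ).1 ++ (normalForm ψ).1, (normalForm φ).2.and (normalForm ψ).2)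
  | ex x φ => ((normalForm φ).1.ex x, (normalForm φ).2.all x)
  | all x φ => ((normalForm φ).1.all x, (normalForm φ).2.ex x)

theorem sat_normalForm_aux {D : Type*} (V : ℕ → Set D) (φ : FO1 (Fin n)) (g : ℕ → D) :
    (HasPolarity true φ → (DNF.Sat V g φ.normalForm.1 ↔ Sat (fun a : Fin n => V a) g φ)) ∧
    (HasPolarity false φ → (DNF.Sat V g φ.normalForm.2 ↔ ¬ Sat (fun a : Fin n => V a) g φ)) := by
  induction φ generalizing g with
  | atom a x => simp [normalForm, DNF.Sat, Lit.Sat, Sat, HasPolarity]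
  | top => simp [normalForm, DNF.Sat, Sat]
  | bot => simp [normalForm, DNF.Sat, Sat]
  | neg φ ih =>
    refine ⟨fun h => (ih g).2 h, fun h => ?_⟩
    simpa [normalForm, Sat] using (ih g).1 h
  | and φ ψ ih₁ ih₂ =>
    refine ⟨fun h => ?_, fun h => ?_⟩
    · simp [normalForm, Sat, DNF.sat_and, (ih₁ g).1 h.1, (ih₂ g).1 h.2]
    · simp only [normalForm, Sat, DNF.sat_append, (ih₁ g).2 h.1, (ih₂ g).2 h.2]
      tauto
  | or φ ψ ih₁ ih₂ =>
    refine ⟨fun h => ?_, fun h => ?_⟩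
    · simp [normalForm, Sat, DNF.sat_append, (ih₁ g).1 h.1, (ih₂ g).1 h.2]
    · simp [normalForm, Sat, DNF.sat_and, (ih₁ g).2 h.1, (ih₂ g).2 h.2]
  | ex x φ ih =>
    refine ⟨fun h => ?_, fun h => ?_⟩
    · simp only [normalForm, Sat, DNF.sat_ex, (ih _).1 h]
    · simp only [normalForm, Sat, DNF.sat_all, (ih _).2 h, not_exists]
  | all x φ ih =>
    refine ⟨fun h => ?_, fun h => ?_⟩
    · simp only [normalForm, Sat, DNF.sat_all, (ih _).1 h]
    · simp only [normalForm, Sat, DNF.sat_ex, (ih _).2 h, not_forall]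

theorem sat_normalForm {D : Type*} (V : ℕ → Set D) (g : ℕ → D) {φ : FO1 (Fin n)}
    (hφ : φ.IsPositive) :
    DNF.Sat V g φ.normalForm.1 ↔ Sat (fun a : Fin n => V a) g φ :=
  (sat_normalForm_aux V φ g).1 hφ

theorem occurs_of_mentions_aux (φ : FO1 (Fin n)) (b : ℕ) :
    (φ.normalForm.1.Mentions b ∨ φ.normalForm.2.Mentions b) →
      ∃ a : Fin n, (a : ℕ) = b ∧ φ.Occurs a := by
  induction φ with
  | atom a x =>
    intro h
    refine ⟨a, ?_, rfl⟩
    simpa [normalForm, DNF.Mentions, eq_comm] using h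
  | top => simp [normalForm, DNF.Mentions]
  | bot => simp [normalForm, DNF.Mentions]
  | neg φ ih => exact fun h => ih h.symm
  | and φ ψ ih₁ ih₂ =>
    intro h
    have h' : (φ.normalForm.1.Mentions b ∨ φ.normalForm.2.Mentions b) ∨
        (ψ.normalForm.1.Mentions b ∨ ψ.normalForm.2.Mentions b) := by
      rcases h with h | h
      · exact (DNF.mentions_and h).imp .inl .inl
      · exact (DNF.mentions_append h).imp .inr .inr
    rcases h' with h | h
    · exact (ih₁ h).imp fun a h => ⟨h.1, .inl h.2⟩
    · exact (ih₂ h).imp fun a h => ⟨h.1, .inr h.2⟩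
  | or φ ψ ih₁ ih₂ =>
    intro h
    have h' : (φ.normalForm.1.Mentions b ∨ φ.normalForm.2.Mentions b) ∨
        (ψ.normalForm.1.Mentions b ∨ ψ.normalForm.2.Mentions b) := by
      rcases h with h | h
      · exact (DNF.mentions_append h).imp .inl .inl
      · exact (DNF.mentions_and h).imp .inr .inr
    rcases h' with h | h
    · exact (ih₁ h).imp fun a h => ⟨h.1, .inl h.2⟩
    · exact (ih₂ h).imp fun a h => ⟨h.1, .inr h.2⟩
  | ex x φ ih => exact fun h => ih (h.imp DNF.mentions_ex DNF.mentions_all)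
  | all x φ ih => exact fun h => ih (h.imp DNF.mentions_all DNF.mentions_ex)

theorem occurs_of_mentions {φ : FO1 (Fin n)} {b : ℕ} (h : φ.normalForm.1.Mentions b) :
    ∃ a : Fin n, (a : ℕ) = b ∧ φ.Occurs a :=
  occurs_of_mentions_aux φ b (.inl h)

theorem mem_free_of_hasFree (φ : FO1 (Fin n)) (x : ℕ) :
    (φ.normalForm.1.HasFree x ∨ φ.normalForm.2.HasFree x) → x ∈ φ.free := by
  induction φ with
  | atom a x => simp [normalForm, DNF.HasFree, free]
  | top => simp [normalForm, DNF.HasFree]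
  | bot => simp [normalForm, DNF.HasFree]
  | neg φ ih => exact fun h => ih h.symm
  | and φ ψ ih₁ ih₂ =>
    rintro (h | h)
    · exact (DNF.hasFree_and h).imp (fun h => ih₁ (.inl h)) fun h => ih₂ (.inl h)
    · exact (DNF.hasFree_append h).imp (fun h => ih₁ (.inr h)) fun h => ih₂ (.inr h)
  | or φ ψ ih₁ ih₂ =>
    rintro (h | h)
    · exact (DNF.hasFree_append h).imp (fun h => ih₁ (.inl h)) fun h => ih₂ (.inl h)
    · exact (DNF.hasFree_and h).imp (fun h => ih₁ (.inr h)) fun h => ih₂ (.inr h)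
  | ex y φ ih =>
    rintro (h | h)
    · exact ⟨ih (.inl (DNF.hasFree_ex h).1), (DNF.hasFree_ex h).2⟩
    · exact ⟨ih (.inr (DNF.hasFree_all h).1), (DNF.hasFree_all h).2⟩
  | all y φ ih =>
    rintro (h | h)
    · exact ⟨ih (.inl (DNF.hasFree_all h).1), (DNF.hasFree_all h).2⟩
    · exact ⟨ih (.inr (DNF.hasFree_ex h).1), (DNF.hasFree_ex h).2⟩

theorem inl_notMem_normalForm {φ : FO1 (Fin n)} (hφ : φ.IsSentence) {c : List Lit}
    (hc : c ∈ φ.normalForm.1) (p : ℕ × ℕ) : Sum.inl p ∉ c := by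
  intro h
  have : p.2 ∈ φ.free := mem_free_of_hasFree φ p.2 (.inl ⟨c, hc, p.1, h⟩)
  rw [hφ] at this
  exact this

/-- The normal form of a sentence does not depend on the assignment. -/
theorem sat_normalForm_congr {D : Type*} (V : ℕ → Set D) (g g' : ℕ → D) {φ : FO1 (Fin n)}
    (hφ : φ.IsSentence) (h : DNF.Sat V g φ.normalForm.1) : DNF.Sat V g' φ.normalForm.1 := by
  obtain ⟨c, hc, h⟩ := h
  refine ⟨c, hc, ?_⟩
  rintro (p | ⟨b, S⟩) hl
  · exact absurd hl (inl_notMem_normalForm hφ hc p)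
  · have := h _ hl
    cases b <;> exact this

theorem models_iff {D : Type*} (V : ℕ → Set D) (g : ℕ → D) {φ : FO1 (Fin n)}
    (hφ : φ.IsSentence) (hp : φ.IsPositive) :
    Models (fun a : Fin n => V a) φ ↔ DNF.Sat V g φ.normalForm.1 :=
  ⟨fun h => (sat_normalForm V g hp).2 (h g),
    fun h g' => (sat_normalForm V g' hp).1 (sat_normalForm_congr V g g' hφ h)⟩

theorem Sat.congr {A : Type} {D : Type*} {V V' : A → Set D} (φ : FO1 A)
    (h : ∀ a, φ.Occurs a → V a = V' a) (g : ℕ → D) : Sat V g φ ↔ Sat V' g φ := by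
  induction φ generalizing g with
  | atom a x => simp [Sat, h a rfl]
  | top => rfl
  | bot => rfl
  | neg φ ih => exact not_congr (ih h g)
  | and φ ψ ih₁ ih₂ =>
    exact and_congr (ih₁ (fun a ha => h a (.inl ha)) g) (ih₂ (fun a ha => h a (.inr ha)) g)
  | or φ ψ ih₁ ih₂ =>
    exact or_congr (ih₁ (fun a ha => h a (.inl ha)) g) (ih₂ (fun a ha => h a (.inr ha)) g)
  | ex x φ ih => exact exists_congr fun d => ih h _
  | all x φ ih => exact forall_congr' fun d => ih h _

theorem Sat.mono_aux {A : Type} {D : Type*} {V V' : A → Set D} (h : ∀ a, V a ⊆ V' a) (φ : FO1 A)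
    (g : ℕ → D) :
    (HasPolarity true φ → Sat V g φ → Sat V' g φ) ∧
      (HasPolarity false φ → Sat V' g φ → Sat V g φ) := by
  induction φ generalizing g with
  | atom a x => exact ⟨fun _ => @h a (g x), by simp [HasPolarity]⟩
  | top => exact ⟨fun _ => id, fun _ => id⟩
  | bot => exact ⟨fun _ => id, fun _ => id⟩
  | neg φ ih => exact ⟨fun hp => mt ((ih g).2 hp), fun hp => mt ((ih g).1 hp)⟩
  | and φ ψ ih₁ ih₂ =>
    exact ⟨fun hp => And.imp ((ih₁ g).1 hp.1) ((ih₂ g).1 hp.2),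
      fun hp => And.imp ((ih₁ g).2 hp.1) ((ih₂ g).2 hp.2)⟩
  | or φ ψ ih₁ ih₂ =>
    exact ⟨fun hp => Or.imp ((ih₁ g).1 hp.1) ((ih₂ g).1 hp.2),
      fun hp => Or.imp ((ih₁ g).2 hp.1) ((ih₂ g).2 hp.2)⟩
  | ex x φ ih =>
    exact ⟨fun hp => Exists.imp fun d => (ih _).1 hp, fun hp => Exists.imp fun d => (ih _).2 hp⟩
  | all x φ ih => exact ⟨fun hp H d => (ih _).1 hp (H d), fun hp H d => (ih _).2 hp (H d)⟩

theorem Sat.mono {A : Type} {D : Type*} {V V' : A → Set D} (h : ∀ a, V a ⊆ V' a) {φ : FO1 A}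
    (hφ : φ.IsPositive) {g : ℕ → D} : Sat V g φ → Sat V' g φ :=
  (Sat.mono_aux h φ g).1 hφ

end FO1

end ModalMu

/-! ### Pruning normal forms by continuity -/

namespace ModalMu

/-- In literals of kind `e`, keep only the predicates that satisfy `p`. -/
def Lit.prune (e : Bool) (p : ℕ → Bool) : Lit → Lit
  | .inl q => .inl q
  | .inr (b, S) => .inr (b, if b = e then S.filter p else S)

/-- In all literals of kind `e`, keep only the predicates that satisfy `p`. -/
def DNF.prune (e : Bool) (p : ℕ → Bool) (d : DNF) : DNF := d.map (List.map (Lit.prune e p))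

theorem DNF.sat_prune {D : Type*} (V : ℕ → Set D) (g : ℕ → D) (e : Bool) (p : ℕ → Bool) (d : DNF) :
    (d.prune e p).Sat V g ↔ ∃ c ∈ d, ∀ l ∈ c, Lit.Sat V g (l.prune e p) := by
  simp only [DNF.Sat, DNF.prune, List.mem_map, exists_exists_and_eq_and, forall_exists_index, and_imp,
    forall_apply_eq_imp_iff₂]

/-- The set of predicates that hold at an element. -/
def predType {D : Type*} (V : ℕ → Set D) (d : D) : Set ℕ := {a | d ∈ V a}

/-- A copy of the one-step model `(D, V)` in the lowest universe: each realised predicate type is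
repeated infinitely often. Without equality the two models cannot be told apart. -/
abbrev TypeModel {D : Type*} (V : ℕ → Set D) : Type := {s : Set ℕ // ∃ d, predType V d = s} × ℕ

/-- The predicates of the copy. -/
def typeVal {D : Type*} (V : ℕ → Set D) (a : ℕ) : Set (TypeModel V) := {q | a ∈ q.1.1}

theorem Lit.sat_typeVal {D : Type*} (V : ℕ → Set D) (g : ℕ → D) (g' : ℕ → TypeModel V)
    (q : Bool × List ℕ) : Lit.Sat (typeVal V) g' (.inr q) ↔ Lit.Sat V g (.inr q) := by
  obtain ⟨b, S⟩ := q
  cases b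
  · constructor
    · intro h d
      exact h (⟨_, d, rfl⟩, 0)
    · rintro h ⟨⟨_, d, rfl⟩, i⟩
      exact h d
  · constructor
    · rintro ⟨⟨⟨_, d, rfl⟩, i⟩, h⟩
      exact ⟨d, h⟩
    · rintro ⟨d, h⟩
      exact ⟨(⟨_, d, rfl⟩, 0), h⟩

/-- A finite set of elements misses some copy of each predicate type. -/
theorem TypeModel.exists_notMem {D : Type*} {V : ℕ → Set D} {F : Set (TypeModel V)} (hF : F.Finite)
    (q : TypeModel V) : ∃ i, (q.1, i) ∉ F := by
  by_contra! h
  have hinj : Function.Injective fun i : ℕ => (q.1, i) := fun i j hij => (Prod.mk.inj hij).2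
  exact Set.infinite_of_injective_forall_mem hinj h hF

namespace FO1

variable {n : ℕ} {φ : FO1 (Fin n)}

theorem exists_finite_of_continuousIn {B : Finset (Fin n)}
    (hB : ∀ b ∈ B, φ.ContinuousIn b) {D : Type} {V : Fin n → Set D} {g : ℕ → D}
    (h : Sat V g φ) :
    ∃ V' : Fin n → Set D, (∀ b, V' b ⊆ V b) ∧ (∀ b ∈ B, (V' b).Finite) ∧ Sat V' g φ := by
  induction B using Finset.induction_on with
  | empty => exact ⟨V, fun _ => subset_rfl, by simp, h⟩
  | insert b B _ ih =>
    obtain ⟨V', h₁, h₂, h₃⟩ := ih fun c hc => hB c (Finset.mem_insert_of_mem hc)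
    obtain ⟨U, hU, hUV, hs⟩ := (hB b (Finset.mem_insert_self b B)).2 D V' g h₃
    refine ⟨_, fun c => ?_, fun c hc => ?_, hs⟩
    · by_cases hcb : c = b
      · subst hcb; simpa using hUV.trans (h₁ c)
      · simpa [hcb] using h₁ c
    · by_cases hcb : c = b
      · subst hcb; simpa using hU
      · simpa [hcb] using h₂ c (Finset.mem_of_mem_insert_of_ne hc hcb)

theorem exists_cofinite_of_cocontinuousIn {B : Finset (Fin n)}
    (hB : ∀ b ∈ B, φ.CocontinuousIn b) {D : Type} {V : Fin n → Set D} {g : ℕ → D}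
    (h : ¬ Sat V g φ) :
    ∃ V' : Fin n → Set D, (∀ b, V b ⊆ V' b) ∧ (∀ b ∈ B, (V' b)ᶜ.Finite) ∧ ¬ Sat V' g φ := by
  induction B using Finset.induction_on with
  | empty => exact ⟨V, fun _ => subset_rfl, by simp, h⟩
  | insert b B _ ih =>
    obtain ⟨V', h₁, h₂, h₃⟩ := ih fun c hc => hB c (Finset.mem_insert_of_mem hc)
    obtain ⟨U, hU, hUV, hs⟩ := (hB b (Finset.mem_insert_self b B)).2 D V' g h₃
    refine ⟨_, fun c => ?_, fun c hc => ?_, hs⟩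
    · by_cases hcb : c = b
      · subst hcb; simpa using (h₁ c).trans (Set.subset_compl_comm.1 hUV)
      · simpa [hcb] using h₁ c
    · by_cases hcb : c = b
      · subst hcb; simpa using hU
      · simpa [hcb] using h₂ c (Finset.mem_of_mem_insert_of_ne hc hcb)

theorem mentions_of_mem {d : DNF} {c : List Lit} {b : Bool} {S : List ℕ} {a : ℕ} (hc : c ∈ d)
    (hl : .inr (b, S) ∈ c) (ha : a ∈ S) : d.Mentions a :=
  ⟨c, hc, _, hl, .inr ⟨b, S, rfl, ha⟩⟩

/-- A predicate in which a sentence is continuous may be dropped from the universal literals of its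
normal form: it can be shrunk to a finite set, which misses a copy of each predicate type. -/
theorem sat_prune_of_continuousIn (hs : φ.IsSentence) (hp : φ.IsPositive) (p : ℕ → Bool)
    (hcont : ∀ b : Fin n, φ.normalForm.1.Mentions b → p b = false → φ.ContinuousIn b)
    {D : Type*} (V : ℕ → Set D) (g : ℕ → D) :
    DNF.Sat V g (φ.normalForm.1.prune false p) ↔ DNF.Sat V g φ.normalForm.1 := by
  classical
  rw [DNF.sat_prune]
  constructor
  · rintro ⟨c, hc, h⟩
    refine ⟨c, hc, ?_⟩
    rintro (q | ⟨b, S⟩) hl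
    · exact h _ hl
    · cases b
      · intro d
        obtain ⟨a, ha, had⟩ := h _ hl d
        exact ⟨a, List.mem_of_mem_filter ha, had⟩
      · exact h _ hl
  · intro h
    let g' : ℕ → TypeModel V := fun i => (⟨_, g i, rfl⟩, 0)
    have h₁ : DNF.Sat (typeVal V) g' φ.normalForm.1 := by
      obtain ⟨c, hc, h⟩ := h
      refine ⟨c, hc, ?_⟩
      rintro (q | q) hl
      · exact absurd hl (inl_notMem_normalForm hs hc q)
      · exact (Lit.sat_typeVal V g g' q).2 (h _ hl)
    obtain ⟨V', hV', hfin, h₂⟩ := exists_finite_of_continuousIn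
      (B := Finset.univ.filter fun b : Fin n => φ.normalForm.1.Mentions b ∧ p b = false)
      (fun b hb => by
        simp only [Finset.mem_filter, Finset.mem_univ, true_and] at hb
        exact hcont b hb.1 hb.2)
      ((sat_normalForm _ g' hp).1 h₁)
    -- the shrunken valuation, as a function of the number of the predicate
    let W : ℕ → Set (TypeModel V) := fun a => if h : a < n then V' ⟨a, h⟩ else ∅
    have hW : (fun a : Fin n => W a) = V' := by ext a; simp [W]
    have hWV : ∀ a, W a ⊆ typeVal V a := by
      intro a
      by_cases ha : a < n
      · simpa [W, ha] using hV' ⟨a, ha⟩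
      · simp [W, ha]
    rw [← hW, ← sat_normalForm W g' hp] at h₂
    obtain ⟨c, hc, h₂⟩ := h₂
    refine ⟨c, hc, ?_⟩
    rintro (q | ⟨b, S⟩) hl
    · exact absurd hl (inl_notMem_normalForm hs hc q)
    · refine (Lit.sat_typeVal V g g' _).1 ?_
      cases b
      · intro d
        have hF : (⋃ a : Fin n, if φ.normalForm.1.Mentions a ∧ p a = false then W a else ∅).Finite := by
          refine Set.finite_iUnion fun a => ?_
          split_ifs with ha
          · have := hfin a (by simpa using ha)
            rwa [← hW] at this
          · exact Set.finite_empty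
        obtain ⟨i, hi⟩ := TypeModel.exists_notMem hF d
        obtain ⟨a, ha, had⟩ := h₂ _ hl (d.1, i)
        refine ⟨a, ?_, (hWV a had : (d.1, i) ∈ typeVal V a)⟩
        rw [if_pos rfl, List.mem_filter]
        refine ⟨ha, ?_⟩
        by_contra hpa
        refine hi (Set.mem_iUnion.2 ?_)
        have hm := mentions_of_mem hc hl ha
        obtain ⟨a, rfl, -⟩ := occurs_of_mentions hm
        exact ⟨a, by rw [if_pos ⟨hm, by simpa using hpa⟩]; exact had⟩
      · obtain ⟨d, hd⟩ := h₂ _ hl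
        exact ⟨d, fun a ha => hWV a (hd a ha)⟩

/-- A predicate in which a sentence is co-continuous may be dropped from the existential literals of
its normal form. -/
theorem sat_prune_of_cocontinuousIn (hs : φ.IsSentence) (hp : φ.IsPositive) (p : ℕ → Bool)
    (hcont : ∀ b : Fin n, φ.normalForm.1.Mentions b → p b = false → φ.CocontinuousIn b)
    {D : Type*} (V : ℕ → Set D) (g : ℕ → D) :
    DNF.Sat V g (φ.normalForm.1.prune true p) ↔ DNF.Sat V g φ.normalForm.1 := by
  classical
  rw [DNF.sat_prune]
  constructor
  · rintro ⟨c, hc, h⟩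
    let g' : ℕ → TypeModel V := fun i => (⟨_, g i, rfl⟩, 0)
    by_contra hn
    have h₁ : ¬ DNF.Sat (typeVal V) g' φ.normalForm.1 := by
      rintro ⟨c, hc, h⟩
      refine hn ⟨c, hc, ?_⟩
      rintro (q | q) hl
      · exact absurd hl (inl_notMem_normalForm hs hc q)
      · exact (Lit.sat_typeVal V g g' q).1 (h _ hl)
    obtain ⟨V', hV', hfin, h₂⟩ := exists_cofinite_of_cocontinuousIn
      (B := Finset.univ.filter fun b : Fin n => φ.normalForm.1.Mentions b ∧ p b = false)
      (fun b hb => by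
        simp only [Finset.mem_filter, Finset.mem_univ, true_and] at hb
        exact hcont b hb.1 hb.2)
      (mt (sat_normalForm _ g' hp).2 h₁)
    -- the enlarged valuation, as a function of the number of the predicate
    let W : ℕ → Set (TypeModel V) := fun a => if h : a < n then V' ⟨a, h⟩ else Set.univ
    have hW : (fun a : Fin n => W a) = V' := by ext a; simp [W]
    have hWV : ∀ a, typeVal V a ⊆ W a := by
      intro a
      by_cases ha : a < n
      · simpa [W, ha] using hV' ⟨a, ha⟩
      · simp [W, ha]
    rw [← hW, ← sat_normalForm W g' hp] at h₂
    refine h₂ ⟨c, hc, ?_⟩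
    rintro (q | ⟨b, S⟩) hl
    · exact absurd hl (inl_notMem_normalForm hs hc q)
    · have h₃ := (Lit.sat_typeVal V g g' _).2 (h _ hl)
      cases b
      · intro d
        obtain ⟨a, ha, had⟩ := h₃ d
        exact ⟨a, ha, hWV a had⟩
      · obtain ⟨d, hd⟩ := h₃
        rw [if_pos rfl] at hd
        have hF : (⋃ a : Fin n,
            if φ.normalForm.1.Mentions a ∧ p a = false then (W a)ᶜ else ∅).Finite := by
          refine Set.finite_iUnion fun a => ?_
          split_ifs with ha
          · have := hfin a (by simpa using ha)
            rwa [← hW] at this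
          · exact Set.finite_empty
        obtain ⟨i, hi⟩ := TypeModel.exists_notMem hF d
        refine ⟨(d.1, i), fun a ha => ?_⟩
        by_cases hpa : p a = true
        · exact hWV a (hd a (List.mem_filter.2 ⟨ha, hpa⟩))
        · by_contra had
          refine hi (Set.mem_iUnion.2 ?_)
          have hm := mentions_of_mem hc hl ha
          obtain ⟨a, rfl, -⟩ := occurs_of_mentions hm
          exact ⟨a, by rw [if_pos ⟨hm, by simpa using hpa⟩]; exact had⟩
  · rintro ⟨c, hc, h⟩
    refine ⟨c, hc, ?_⟩
    rintro (q | ⟨b, S⟩) hl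
    · exact h _ hl
    · cases b
      · exact h _ hl
      · obtain ⟨d, hd⟩ := h _ hl
        exact ⟨d, fun a ha => hd a (List.mem_of_mem_filter ha)⟩

end FO1

end ModalMu

/-! ### Winning regions of parity games -/

namespace ModalMu

namespace ParityGame

variable {G : Type*} {𝒢 : ParityGame G}

theorem infWin_succ {π : ℕ → G} : 𝒢.InfWin (fun i => π (i + 1)) ↔ 𝒢.InfWin π := by
  unfold InfWin
  refine exists_congr fun m => and_congr_right fun _ => and_congr ?_ ?_
  · conv_rhs => rw [← Filter.map_add_atTop_eq_nat 1, Filter.frequently_map]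
  · conv_rhs => rw [← Filter.map_add_atTop_eq_nat 1, Filter.eventually_map]

theorem infWin_add {π : ℕ → G} (m : ℕ) : 𝒢.InfWin (fun i => π (m + i)) ↔ 𝒢.InfWin π := by
  induction m with
  | zero => simp
  | succ m ih =>
    rw [← ih, ← infWin_succ (π := fun i => π (m + i))]
    simp only [Nat.add_right_comm m 1, Nat.add_assoc]

/-- The residual of a winning strategy after one move is winning. -/
theorem IsWinning.residual {f : List G → G} {u v : G} (hf : 𝒢.IsWinning f u) (huv : 𝒢.E u v)
    (h : u ∈ 𝒢.eloise → v = f [u]) : 𝒢.IsWinning (fun π => f (u :: π)) v := by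
  refine ⟨fun π w hπ hw hwe => ?_, fun π hπ => ?_⟩
  · obtain ⟨h₁, h₂, h₃⟩ := hπ
    obtain ⟨r, rfl⟩ : ∃ r, π = v :: r := by
      cases π with
      | nil => simp at h₁
      | cons a r => simp at h₁; exact ⟨r, by rw [h₁]⟩
    refine hf.1 (u :: v :: r) w ⟨rfl, List.isChain_cons_cons.2 ⟨huv, h₂⟩, ?_⟩ (by simpa using hw) hwe
    rintro (_ | i) hi hu
    · simpa using h hu
    · exact h₃ i (by simpa using hi) hu
  · obtain ⟨h₁, h₂, h₃⟩ := hπ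
    let ρ : ℕ → G := fun i => Nat.casesOn i u π
    have hρ : 𝒢.InfWin ρ := by
      refine hf.2 ρ ⟨rfl, ?_, ?_⟩
      · rintro (_ | i)
        · simpa [ρ, h₁] using huv
        · exact h₂ i
      · rintro (_ | i) hi
        · simpa [ρ, h₁] using h hi
        · have := h₃ i hi
          rw [List.range_succ_eq_map]
          simpa [ρ, Function.comp_def] using this
    exact infWin_succ.2 hρ

theorem IsWinning.move {f : List G → G} {u : G} (hf : 𝒢.IsWinning f u) (hu : u ∈ 𝒢.eloise) :
    𝒢.E u (f [u]) :=
  hf.1 [u] u ⟨rfl, List.isChain_singleton u, fun i hi => by simp at hi⟩ rfl hu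

theorem EloiseWins.exists_move {u : G} (h : 𝒢.EloiseWins u) (hu : u ∈ 𝒢.eloise) :
    ∃ v, 𝒢.E u v ∧ 𝒢.EloiseWins v := by
  obtain ⟨f, hf⟩ := h
  exact ⟨f [u], hf.move hu, _, hf.residual (hf.move hu) fun _ => rfl⟩

theorem EloiseWins.of_move {u v : G} (h : 𝒢.EloiseWins u) (hu : u ∉ 𝒢.eloise) (huv : 𝒢.E u v) :
    𝒢.EloiseWins v := by
  obtain ⟨f, hf⟩ := h
  exact ⟨_, hf.residual huv fun h => absurd h hu⟩

/-- If Abelard can confine all matches from a winning position of Eloise to a set `B`, as long as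
Eloise stays in her winning region, then some infinite match in `B` is won by Eloise. -/
theorem EloiseWins.exists_infWin {u : G} (h : 𝒢.EloiseWins u) {B : Set G} (hu : u ∈ B)
    (hB₁ : ∀ u ∈ B, u ∈ 𝒢.eloise → ∀ v, 𝒢.E u v → 𝒢.EloiseWins v → v ∈ B)
    (hB₂ : ∀ u ∈ B, u ∉ 𝒢.eloise → 𝒢.EloiseWins u → ∃ v ∈ B, 𝒢.E u v) :
    ∃ π : ℕ → G, (∀ i, π i ∈ B) ∧ (∀ i, 𝒢.E (π i) (π (i + 1))) ∧ 𝒢.InfWin π := by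
  obtain ⟨f₀, hf₀⟩ := h
  have next : ∀ q : {q : (List G → G) × G // q.2 ∈ B ∧ 𝒢.IsWinning q.1 q.2},
      ∃ q' : {q : (List G → G) × G // q.2 ∈ B ∧ 𝒢.IsWinning q.1 q.2},
        q'.1.1 = (fun π => q.1.1 (q.1.2 :: π)) ∧ 𝒢.E q.1.2 q'.1.2 ∧
          (q.1.2 ∈ 𝒢.eloise → q'.1.2 = q.1.1 [q.1.2]) := by
    rintro ⟨⟨f, u⟩, hu, hf⟩
    by_cases hue : u ∈ 𝒢.eloise
    · have hr := hf.residual (hf.move hue) fun _ => rfl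
      exact ⟨⟨(_, f [u]), hB₁ u hu hue _ (hf.move hue) ⟨_, hr⟩, hr⟩, rfl, hf.move hue, fun _ => rfl⟩
    · obtain ⟨v, hv, huv⟩ := hB₂ u hu hue ⟨f, hf⟩
      exact ⟨⟨(_, v), hv, hf.residual huv fun h => absurd h hue⟩, rfl, huv, fun h => absurd h hue⟩
  choose F hF₁ hF₂ hF₃ using next
  let q : ℕ → {q : (List G → G) × G // q.2 ∈ B ∧ 𝒢.IsWinning q.1 q.2} :=
    fun i => F^[i] ⟨(f₀, u), hu, hf₀⟩
  have hq : ∀ i, q (i + 1) = F (q i) := fun i => Function.iterate_succ_apply' F i _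
  let π : ℕ → G := fun i => (q i).1.2
  have hstrat : ∀ i ρ, (q i).1.1 ρ = f₀ ((List.range i).map π ++ ρ) := by
    intro i
    induction i with
    | zero => intro ρ; rfl
    | succ i ih =>
      intro ρ
      rw [hq, hF₁]
      change (q i).1.1 _ = _
      rw [ih, List.range_succ]
      simp [π]
  refine ⟨π, fun i => (q i).2.1, fun i => ?_, hf₀.2 π ⟨rfl, fun i => ?_, fun i hi => ?_⟩⟩
  · simpa only [π, hq] using hF₂ (q i)
  · simpa only [π, hq] using hF₂ (q i)
  · have := hF₃ (q i) hi
    rw [hstrat, ← hq] at this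
    rw [List.range_succ]
    simpa using this

/-- Eloise wins from a set `P` of positions in which she can stay by the positional strategy `h`
until her winning region is reached, provided that she wins the infinite matches that avoid the
winning region forever. -/
theorem eloiseWins_of_mem {P : Set G} (h : G → G)
    (h₁ : ∀ u ∈ P, u ∈ 𝒢.eloise → 𝒢.E u (h u) ∧ (h u ∈ P ∨ 𝒢.EloiseWins (h u)))
    (h₂ : ∀ u ∈ P, u ∉ 𝒢.eloise → ∀ v, 𝒢.E u v → v ∈ P ∨ 𝒢.EloiseWins v)
    (h₃ : ∀ π : ℕ → G, (∀ i, π i ∈ P ∧ ¬ 𝒢.EloiseWins (π i)) →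
      (∀ i, 𝒢.E (π i) (π (i + 1))) → (∀ i, π i ∈ 𝒢.eloise → π (i + 1) = h (π i)) → 𝒢.InfWin π)
    {u : G} (hu : u ∈ P) : 𝒢.EloiseWins u := by
  classical
  have hex : ∀ v, ∃ f : List G → G, 𝒢.EloiseWins v → 𝒢.IsWinning f v := by
    intro v
    by_cases hv : 𝒢.EloiseWins v
    · exact ⟨hv.choose, fun _ => hv.choose_spec⟩
    · exact ⟨fun _ => v, fun h => absurd h hv⟩
  choose f hf using hex
  -- once the winning region is entered, play the strategy of the entry position on the rest
  let rest : List G → List G := List.dropWhile fun v => decide (¬ 𝒢.EloiseWins v)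
  let g : List G → G := fun π =>
    match rest π with
    | [] => h (π.getLastD u)
    | v :: r => f v (v :: r)
  have hrest : ∀ (l : List G) (v : G) (r : List G), (∀ w ∈ l, ¬ 𝒢.EloiseWins w) →
      𝒢.EloiseWins v → rest (l ++ v :: r) = v :: r := by
    intro l v r hl hv
    simp only [rest]
    rw [List.dropWhile_append_of_pos (by simpa using hl), List.dropWhile_cons_of_neg (by simpa using hv)]
  have hrest_nil : ∀ l : List G, (∀ w ∈ l, ¬ 𝒢.EloiseWins w) → rest l = [] := by
    intro l hl
    simpa [rest] using hl
  have hg₁ : ∀ (l : List G) (v : G) (r : List G), (∀ w ∈ l, ¬ 𝒢.EloiseWins w) →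
      𝒢.EloiseWins v → g (l ++ v :: r) = f v (v :: r) := by
    intro l v r hl hv
    simp only [g, hrest l v r hl hv]
  have hg₂ : ∀ (l : List G) (v : G), (∀ w ∈ l ++ [v], ¬ 𝒢.EloiseWins w) → g (l ++ [v]) = h v := by
    intro l v hl
    simp [g, hrest_nil _ hl]
  refine ⟨g, fun π w hπ hw hwe => ?_, fun π hπ => ?_⟩
  · obtain ⟨hπ₁, hπ₂, hπ₃⟩ := hπ
    by_cases hW : ∃ v ∈ π, 𝒢.EloiseWins v
    · obtain ⟨v, l, r, hv, hl, rfl⟩ : ∃ v l r, 𝒢.EloiseWins v ∧ (∀ w ∈ l, ¬ 𝒢.EloiseWins w) ∧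
          π = l ++ v :: r := by
        clear hπ₁ hπ₂ hπ₃ hw
        induction π with
        | nil => simp at hW
        | cons a π ih =>
          by_cases ha : 𝒢.EloiseWins a
          · exact ⟨a, [], π, ha, by simp, rfl⟩
          · obtain ⟨v, l, r, hv, hl, rfl⟩ := ih (by simpa [ha] using hW)
            exact ⟨v, a :: l, r, hv, by simpa [ha] using hl, rfl⟩
      rw [hg₁ l v r hl hv]
      refine (hf v hv).1 (v :: r) w ⟨rfl, (List.isChain_append.1 hπ₂).2.1, fun i hi hie => ?_⟩
        (by simpa using hw) hwe
      have := hπ₃ (l.length + i) (by simp at hi ⊢; omega)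
        (by rw [List.getElem_append_right (by omega)]; simpa using hie)
      rw [List.getElem_append_right (by omega)] at this
      have hsub : l.length + i + 1 - l.length = i + 1 := by omega
      simp only [hsub] at this
      rw [this, Nat.add_assoc, List.take_length_add_append, List.take_succ_cons,
        hg₁ l v _ hl hv]
    · push Not at hW
      have hP : ∀ i (hi : i < π.length), π[i] ∈ P := by
        intro i
        induction i with
        | zero =>
          intro hi
          cases π with
          | nil => simp at hi
          | cons a π => simp at hπ₁; simpa [hπ₁] using hu
        | succ i ih =>
          intro hi
          have hE := List.isChain_iff_getElem.1 hπ₂ i hi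
          have hi' := ih (by omega)
          have hW' := hW _ (List.getElem_mem hi)
          by_cases hie : π[i] ∈ 𝒢.eloise
          · have h₄ := hπ₃ i hi hie
            rw [List.take_succ_eq_append_getElem (by omega), hg₂] at h₄
            · rw [h₄] at hW' ⊢
              exact (h₁ _ hi' hie).2.resolve_right hW'
            · rw [← List.take_succ_eq_append_getElem (by omega)]
              exact fun w hw => hW w (List.mem_of_mem_take hw)
          · exact (h₂ _ hi' hie _ hE).resolve_right hW'
      obtain ⟨l, rfl⟩ := List.getLast?_eq_some_iff.1 hw
      rw [hg₂ l w hW]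
      exact (h₁ w (by simpa using hP l.length (by simp)) hwe).1
  · obtain ⟨hπ₁, hπ₂, hπ₃⟩ := hπ
    by_cases hW : ∃ i, 𝒢.EloiseWins (π i)
    · have hv := Nat.find_spec hW
      have hl : ∀ i < Nat.find hW, ¬ 𝒢.EloiseWins (π i) := fun i hi => Nat.find_min hW hi
      generalize Nat.find hW = m at hv hl
      rw [← infWin_add m]
      refine (hf _ hv).2 _ ⟨rfl, fun i => hπ₂ (m + i), fun i hi => ?_⟩
      have := hπ₃ (m + i) hi
      rw [Nat.add_assoc, List.range_add, List.map_append, List.range_succ_eq_map, List.map_cons,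
        List.map_cons] at this
      have hl' : ∀ w ∈ (List.range m).map π, ¬ 𝒢.EloiseWins w := by simpa using hl
      refine (this.trans (hg₁ _ (π m) _ hl' hv)).trans ?_
      rw [List.range_succ_eq_map]
      simp [Function.comp_def]
    · push Not at hW
      have hh : ∀ i, π i ∈ 𝒢.eloise → π (i + 1) = h (π i) := by
        intro i hi
        rw [hπ₃ i hi, List.range_succ, List.map_append]
        exact hg₂ _ _ (by
          intro w hw
          obtain ⟨j, -, rfl⟩ : ∃ j, j < i + 1 ∧ π j = w := by
            have : w ∈ (List.range (i + 1)).map π := by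
              rw [List.range_succ, List.map_append]
              exact hw
            simpa using this
          exact hW j)
      refine h₃ π (fun i => ⟨?_, hW i⟩) hπ₂ hh
      induction i with
      | zero => rwa [hπ₁]
      | succ i ih =>
        by_cases hie : π i ∈ 𝒢.eloise
        · have := (h₁ _ ih hie).2
          rw [← hh i hie] at this
          exact this.resolve_right (hW _)
        · exact (h₂ _ ih hie _ (hπ₂ i)).resolve_right (hW _)

end ParityGame

end ModalMu

/-! ### Winning regions of continuous-weak automata -/

namespace ModalMu

open Classical in
/-- The operator `Φ` with the components outside `U` fixed to `Z`. -/
noncomputable def overrideOn {A L : Type*} [CompleteLattice L] (Φ : (A → L) →o (A → L))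
    (U : Set A) (Z : A → L) : (A → L) →o (A → L) where
  toFun X a := if a ∈ U then Φ X a else Z a
  monotone' X Y h a := by
    dsimp only
    split_ifs
    · exact Φ.mono h a
    · exact le_rfl

/-- The least solution of the equations `X a = Φ X a` for `a ∈ U` and `X a = Z a` for `a ∉ U`. -/
noncomputable def lfpOn {A L : Type*} [CompleteLattice L] (Φ : (A → L) →o (A → L)) (U : Set A)
    (Z : A → L) : A → L :=
  OrderHom.lfp (overrideOn Φ U Z)

section

variable {A L : Type*} [CompleteLattice L] (Φ : (A → L) →o (A → L)) (U : Set A) (Z : A → L)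

theorem lfpOn_of_notMem {a : A} (ha : a ∉ U) : lfpOn Φ U Z a = Z a :=
  (congrFun (OrderHom.map_lfp (overrideOn Φ U Z)) a).symm.trans (if_neg ha)

theorem lfpOn_of_mem {a : A} (ha : a ∈ U) : Φ (lfpOn Φ U Z) a = lfpOn Φ U Z a :=
  ((congrFun (OrderHom.map_lfp (overrideOn Φ U Z)) a).symm.trans (if_pos ha)).symm

variable {Φ U Z}

theorem lfpOn_le {X : A → L} (h₁ : ∀ a ∈ U, Φ X a ≤ X a) (h₂ : ∀ a ∉ U, Z a ≤ X a) :
    lfpOn Φ U Z ≤ X := by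
  refine OrderHom.lfp_le _ fun a => ?_
  by_cases ha : a ∈ U
  · exact (if_pos ha).trans_le (h₁ a ha)
  · exact (if_neg ha).trans_le (h₂ a ha)

theorem lfpOn_congr {Z' : A → L} (h : ∀ a ∉ U, Z a = Z' a) : lfpOn Φ U Z = lfpOn Φ U Z' := by
  refine le_antisymm (lfpOn_le (fun a ha => (lfpOn_of_mem Φ U Z' ha).le) fun a ha => ?_)
    (lfpOn_le (fun a ha => (lfpOn_of_mem Φ U Z ha).le) fun a ha => ?_)
  · rw [lfpOn_of_notMem Φ U Z' ha, h a ha]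
  · rw [lfpOn_of_notMem Φ U Z ha, h a ha]

/-- Bekič's principle: a component of a simultaneous least fixpoint is a least fixpoint in one
variable, with the other components as parameterised least fixpoints. -/
theorem lfpOn_eq_sInf [DecidableEq A] {a : A} (ha : a ∈ U) :
    lfpOn Φ U Z a = sInf {S | Φ (lfpOn Φ (U \ {a}) (Function.update Z a S)) a ≤ S} := by
  apply le_antisymm
  · refine le_sInf fun S hS => ?_
    have hS' : lfpOn Φ (U \ {a}) (Function.update Z a S) a = S := by
      rw [lfpOn_of_notMem _ _ _ (by simp), Function.update_self]
    refine (lfpOn_le (X := lfpOn Φ (U \ {a}) (Function.update Z a S)) (fun b hb => ?_)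
      (fun b hb => ?_) a).trans hS'.le
    · by_cases hba : b = a
      · subst hba; rw [hS']; exact hS
      · exact (lfpOn_of_mem Φ (U \ {a}) _ (Set.mem_sdiff_singleton.2 ⟨hb, hba⟩)).le
    · have hba : b ≠ a := fun h => hb (h ▸ ha)
      rw [lfpOn_of_notMem _ _ _ (fun h => hb h.1), Function.update_of_ne hba]
  · refine sInf_le ?_
    refine (Φ.mono (lfpOn_le (fun b hb => (lfpOn_of_mem Φ U Z hb.1).le) fun b hb => ?_) a).trans
      (lfpOn_of_mem Φ U Z ha).le
    by_cases hba : b = a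
    · subst hba; simp
    · rw [Function.update_of_ne hba, lfpOn_of_notMem Φ U Z fun h => hb ⟨h, hba⟩]

end

/-- The greatest solution of the equations `X a = Φ X a` for `a ∈ U` and `X a = Z a` for
`a ∉ U`. -/
noncomputable def gfpOn {A L : Type*} [CompleteLattice L] (Φ : (A → L) →o (A → L)) (U : Set A)
    (Z : A → L) : A → L :=
  lfpOn (L := Lᵒᵈ) Φ.dual U Z

section

variable {A L : Type*} [CompleteLattice L] {Φ : (A → L) →o (A → L)} {U : Set A} {Z : A → L}

theorem gfpOn_of_notMem {a : A} (ha : a ∉ U) : gfpOn Φ U Z a = Z a :=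
  lfpOn_of_notMem (L := Lᵒᵈ) Φ.dual U Z ha

theorem gfpOn_of_mem {a : A} (ha : a ∈ U) : Φ (gfpOn Φ U Z) a = gfpOn Φ U Z a :=
  lfpOn_of_mem (L := Lᵒᵈ) Φ.dual U Z ha

theorem le_gfpOn {X : A → L} (h₁ : ∀ a ∈ U, X a ≤ Φ X a) (h₂ : ∀ a ∉ U, X a ≤ Z a) :
    X ≤ gfpOn Φ U Z :=
  lfpOn_le (L := Lᵒᵈ) (Φ := Φ.dual) h₁ h₂

theorem gfpOn_congr {Z' : A → L} (h : ∀ a ∉ U, Z a = Z' a) : gfpOn Φ U Z = gfpOn Φ U Z' :=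
  lfpOn_congr (L := Lᵒᵈ) (Φ := Φ.dual) h

theorem gfpOn_eq_sSup [DecidableEq A] {a : A} (ha : a ∈ U) :
    gfpOn Φ U Z a = sSup {S | S ≤ Φ (gfpOn Φ (U \ {a}) (Function.update Z a S)) a} :=
  lfpOn_eq_sInf (L := Lᵒᵈ) (Φ := Φ.dual) ha

end

namespace Automaton

variable {k : ℕ} {A : Type} (𝔸 : Automaton k A) {T : Type*} (S : LTS T)

/-- The monotone operator of one round of the acceptance game. -/
def step : (A → Set T) →o (A → Set T) where
  toFun X a := {s | FO1.Models (D := {t // S.R s t}) (fun b => {t | (t : T) ∈ X b})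
    (𝔸.Δ a (S.color k s))}
  monotone' _ _ h _ _ hs g :=
    FO1.Sat.mono (fun b (_ : {t // S.R _ t}) ht => h b ht) (𝔸.positive _ _) (hs g)

theorem mem_step {X : A → Set T} {a : A} {s : T} : s ∈ 𝔸.step S X a ↔
    FO1.Models (D := {t // S.R s t}) (fun b => {t | (t : T) ∈ X b}) (𝔸.Δ a (S.color k s)) :=
  Iff.rfl

theorem step_congr {X Y : A → Set T} {a : A} (h : ∀ b, 𝔸.Leads a b → X b = Y b) :
    𝔸.step S X a = 𝔸.step S Y a := by
  ext s
  refine forall_congr' fun g => FO1.Sat.congr _ (fun b hb => ?_) g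
  rw [h b ⟨_, hb⟩]

/-- The states `b` with `a ⪯ b ⪯ a`. -/
def cluster (a : A) : Set A := {b | 𝔸.Reach a b ∧ 𝔸.Reach b a}

variable {𝔸 S}

theorem mem_cluster_self (a : A) : a ∈ 𝔸.cluster a := ⟨.refl, .refl⟩

theorem cluster_eq {a b : A} (h : b ∈ 𝔸.cluster a) : 𝔸.cluster b = 𝔸.cluster a := by
  ext c
  exact ⟨fun hc => ⟨h.1.trans hc.1, hc.2.trans h.2⟩, fun hc => ⟨h.2.trans hc.1, hc.2.trans h.1⟩⟩

/-- Eloise only has to take care of the successors of the present node. -/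
theorem mem_step_inter {X : A → Set T} {a : A} {s : T} :
    s ∈ 𝔸.step S (fun b => X b ∩ {t | S.R s t}) a ↔ s ∈ 𝔸.step S X a := by
  rw [mem_step, mem_step]
  have : (fun b => {t : {t // S.R s t} | (t : T) ∈ X b ∩ {t | S.R s t}}) =
      fun b => {t : {t // S.R s t} | (t : T) ∈ X b} := by
    ext b t
    exact ⟨fun h => h.1, fun h => ⟨h, t.2⟩⟩
  rw [this]

variable [Fintype A]

variable (𝔸 S) in
/-- The positions of the acceptance game from which Eloise wins. -/
def winRegion (a : A) : Set T := {s | (𝔸.game S).EloiseWins (.inl (a, s))}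

theorem inl_mem_eloise (q : A × T) : (Sum.inl q : (A × T) ⊕ (A → Set T)) ∈ (𝔸.game S).eloise :=
  ⟨q, rfl⟩

theorem inr_notMem_eloise (V : A → Set T) :
    (Sum.inr V : (A × T) ⊕ (A → Set T)) ∉ (𝔸.game S).eloise := by
  rintro ⟨q, hq⟩
  cases hq

theorem edge_inl {a : A} {s : T} {v : (A × T) ⊕ (A → Set T)} :
    (𝔸.game S).E (.inl (a, s)) v ↔ ∃ V : A → Set T, v = .inr V ∧ (∀ b, V b ⊆ {t | S.R s t}) ∧
      s ∈ 𝔸.step S V a := by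
  rcases v with ⟨b, t⟩ | V
  · exact ⟨fun h => h.elim, by rintro ⟨V, hV, -⟩; cases hV⟩
  · exact ⟨fun h => ⟨V, rfl, h⟩, by rintro ⟨V, hV, h⟩; cases hV; exact h⟩

theorem edge_inr {V : A → Set T} {v : (A × T) ⊕ (A → Set T)} :
    (𝔸.game S).E (.inr V) v ↔ ∃ b t, v = .inl (b, t) ∧ t ∈ V b := by
  rcases v with ⟨b, t⟩ | W
  · exact ⟨fun h => ⟨b, t, rfl, h⟩, by rintro ⟨b, t, hV, h⟩; cases hV; exact h⟩
  · exact ⟨fun h => h.elim, by rintro ⟨b, t, hV, -⟩; cases hV⟩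

theorem exists_inl {π : ℕ → (A × T) ⊕ (A → Set T)}
    (hE : ∀ i, (𝔸.game S).E (π i) (π (i + 1))) (N : ℕ) : ∃ i ≥ N, ∃ q, π i = .inl q := by
  rcases h : π N with q | V
  · exact ⟨N, le_rfl, q, h⟩
  · have := hE N
    rw [h, edge_inr] at this
    obtain ⟨b, t, h, -⟩ := this
    exact ⟨N + 1, by omega, _, h⟩

theorem infWin_iff {π : ℕ → (A × T) ⊕ (A → Set T)} {m : ℕ} {a₀ : A}
    (hE : ∀ i, (𝔸.game S).E (π i) (π (i + 1))) (hm : 𝔸.Ω a₀ = m)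
    (hπ : ∀ i a s, π i = .inl (a, s) → 𝔸.Ω a = m) : (𝔸.game S).InfWin π ↔ Even m := by
  have hle : ∀ i, m ≤ (𝔸.game S).Ω (π i) := by
    intro i
    rcases h : π i with ⟨a, s⟩ | V
    · exact (hπ i a s h).ge
    · rw [← hm]
      exact Finset.le_sup (f := 𝔸.Ω) (Finset.mem_univ a₀)
  have hinl : ∀ N, ∃ i ≥ N, (𝔸.game S).Ω (π i) = m := by
    intro N
    obtain ⟨i, hi, ⟨a, s⟩, h⟩ := exists_inl hE N
    exact ⟨i, hi, by rw [h]; exact hπ i a s h⟩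
  constructor
  · rintro ⟨m', hm', hf, he⟩
    obtain ⟨N, hN⟩ := Filter.eventually_atTop.1 he
    obtain ⟨i, hi, h⟩ := hinl N
    obtain ⟨j, -, hj⟩ := (Filter.frequently_atTop.1 hf) 0
    have h₁ := hN i hi
    have h₂ := hle j
    have : m = m' := le_antisymm (hj ▸ h₂) (h ▸ h₁)
    rwa [this]
  · exact fun h => ⟨m, h, Filter.frequently_atTop.2 hinl, Filter.Eventually.of_forall hle⟩

theorem winRegion_le_step : 𝔸.winRegion S ≤ 𝔸.step S (𝔸.winRegion S) := by
  intro a s h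
  obtain ⟨v, hv, hw⟩ := ParityGame.EloiseWins.exists_move h (inl_mem_eloise _)
  obtain ⟨V, rfl, -, hs⟩ := edge_inl.1 hv
  refine (𝔸.step S).mono (fun b t ht => ?_) a hs
  exact hw.of_move (inr_notMem_eloise V) (edge_inr.2 ⟨b, t, rfl, ht⟩)

theorem step_winRegion_le : 𝔸.step S (𝔸.winRegion S) ≤ 𝔸.winRegion S := by
  intro a s h
  refine ParityGame.eloiseWins_of_mem
    (P := {.inl (a, s), .inr fun b => 𝔸.winRegion S b ∩ {t | S.R s t}})
    (fun _ => .inr fun b => 𝔸.winRegion S b ∩ {t | S.R s t}) ?_ ?_ ?_ (Set.mem_insert _ _)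
  · rintro _ (rfl | rfl) hu
    · exact ⟨edge_inl.2 ⟨_, rfl, fun b => Set.inter_subset_right, mem_step_inter.2 h⟩,
        .inl (.inr rfl)⟩
    · exact absurd hu (inr_notMem_eloise _)
  · rintro _ (rfl | rfl) hu v hv
    · exact absurd (inl_mem_eloise _) hu
    · obtain ⟨b, t, rfl, ht⟩ := edge_inr.1 hv
      exact .inr ht.1
  · intro π hπ hE hh
    -- after at most two moves the match is in the winning region
    exfalso
    obtain ⟨i, -, q, hi⟩ := exists_inl hE 0
    have h₁ := hh i (hi ▸ inl_mem_eloise q)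
    have h₂ := hE (i + 1)
    rw [h₁, edge_inr] at h₂
    obtain ⟨b, t, h₃, ht⟩ := h₂
    exact (hπ (i + 1 + 1)).2 (h₃ ▸ ht.1)

/-- On a cluster of odd priority, the winning region is a least fixpoint: otherwise Abelard could
keep a match in the cluster forever. -/
theorem winRegion_le_of_odd {a₀ : A} (hΩ : ∀ b ∈ 𝔸.cluster a₀, 𝔸.Ω b = 𝔸.Ω a₀)
    (hodd : Odd (𝔸.Ω a₀)) {X : A → Set T} (h₁ : ∀ b ∈ 𝔸.cluster a₀, 𝔸.step S X b ≤ X b)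
    (h₂ : ∀ b ∉ 𝔸.cluster a₀, 𝔸.winRegion S b ≤ X b) : 𝔸.winRegion S ≤ X := by
  intro a s hs
  by_contra hX
  have hmem : ∀ b t, t ∈ 𝔸.winRegion S b → t ∉ X b → b ∈ 𝔸.cluster a₀ := fun b t ht htX => by
    by_contra hb
    exact htX (h₂ b hb ht)
  let B : Set ((A × T) ⊕ (A → Set T)) := fun u => match u with
    | .inl (b, t) => b ∈ 𝔸.cluster a₀ ∧ t ∉ X b
    | .inr V => ∃ b ∈ 𝔸.cluster a₀, ∃ t ∈ V b, t ∉ X b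
  have hB₁ : ∀ u ∈ B, u ∈ (𝔸.game S).eloise → ∀ v, (𝔸.game S).E u v →
      (𝔸.game S).EloiseWins v → v ∈ B := by
    rintro (⟨b, t⟩ | V) hu hue v hv hw
    · obtain ⟨V, rfl, -, ht⟩ := edge_inl.1 hv
      by_contra hV
      refine hu.2 (h₁ b hu.1 ((𝔸.step S).mono (fun c r hr => ?_) b ht))
      by_contra hrX
      exact hV ⟨c, hmem c r (hw.of_move (inr_notMem_eloise V) (edge_inr.2 ⟨c, r, rfl, hr⟩)) hrX,
        r, hr, hrX⟩
    · exact absurd hue (inr_notMem_eloise V)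
  have hB₂ : ∀ u ∈ B, u ∉ (𝔸.game S).eloise → (𝔸.game S).EloiseWins u →
      ∃ v ∈ B, (𝔸.game S).E u v := by
    rintro (⟨b, t⟩ | V) hu hue -
    · exact absurd (inl_mem_eloise _) hue
    · obtain ⟨b, hb, t, ht, htX⟩ := hu
      exact ⟨.inl (b, t), ⟨hb, htX⟩, edge_inr.2 ⟨b, t, rfl, ht⟩⟩
  obtain ⟨π, hπ, hE, hw⟩ := ParityGame.EloiseWins.exists_infWin hs
    (show Sum.inl (a, s) ∈ B from ⟨hmem a s hs hX, hX⟩) hB₁ hB₂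
  refine Nat.not_even_iff_odd.2 hodd ((infWin_iff hE rfl fun i b t h => ?_).1 hw)
  have := hπ i
  rw [h] at this
  exact hΩ b this.1

/-- On a cluster of even priority, the winning region is a greatest fixpoint: Eloise wins by keeping
a match in the cluster forever. -/
theorem le_winRegion_of_even {a₀ : A} (hΩ : ∀ b ∈ 𝔸.cluster a₀, 𝔸.Ω b = 𝔸.Ω a₀)
    (heven : Even (𝔸.Ω a₀)) {X : A → Set T} (h₁ : ∀ b ∈ 𝔸.cluster a₀, X b ≤ 𝔸.step S X b)
    (h₂ : ∀ b ∉ 𝔸.cluster a₀, X b ≤ 𝔸.winRegion S b) : X ≤ 𝔸.winRegion S := by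
  intro a s hs
  by_cases ha : a ∈ 𝔸.cluster a₀
  swap
  · exact h₂ a ha hs
  let P : Set ((A × T) ⊕ (A → Set T)) := fun u => match u with
    | .inl (b, t) => b ∈ 𝔸.cluster a₀ ∧ t ∈ X b
    | .inr V => V ≤ X
  let h : (A × T) ⊕ (A → Set T) → (A × T) ⊕ (A → Set T) := fun u => match u with
    | .inl (_, t) => .inr fun c => X c ∩ {r | S.R t r}
    | .inr V => .inr V
  refine ParityGame.eloiseWins_of_mem (P := P) h ?_ ?_ ?_ (show Sum.inl (a, s) ∈ P from ⟨ha, hs⟩)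
  · rintro (⟨b, t⟩ | V) hu hue
    · exact ⟨edge_inl.2 ⟨_, rfl, fun c => Set.inter_subset_right,
        mem_step_inter.2 (h₁ b hu.1 hu.2)⟩, .inl fun c => Set.inter_subset_left⟩
    · exact absurd hue (inr_notMem_eloise V)
  · rintro (⟨b, t⟩ | V) hu hue v hv
    · exact absurd (inl_mem_eloise _) hue
    · obtain ⟨b, t, rfl, ht⟩ := edge_inr.1 hv
      by_cases hb : b ∈ 𝔸.cluster a₀
      · exact .inl ⟨hb, hu b ht⟩
      · exact .inr (h₂ b hb (hu b ht))
  · intro π hπ hE _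
    refine (infWin_iff hE rfl fun i b t h => ?_).2 heven
    have := (hπ i).1
    rw [h] at this
    exact hΩ b this.1

theorem lfpOn_cluster {a : A} (hΩ : ∀ b ∈ 𝔸.cluster a, 𝔸.Ω b = 𝔸.Ω a) (hodd : Odd (𝔸.Ω a)) :
    lfpOn (𝔸.step S) (𝔸.cluster a) (𝔸.winRegion S) = 𝔸.winRegion S := by
  refine le_antisymm (lfpOn_le (fun b _ => step_winRegion_le b) fun _ _ => le_rfl)
    (winRegion_le_of_odd hΩ hodd (fun b hb => (lfpOn_of_mem _ _ _ hb).le) fun b hb =>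
      (lfpOn_of_notMem _ _ _ hb).ge)

theorem gfpOn_cluster {a : A} (hΩ : ∀ b ∈ 𝔸.cluster a, 𝔸.Ω b = 𝔸.Ω a) (heven : Even (𝔸.Ω a)) :
    gfpOn (𝔸.step S) (𝔸.cluster a) (𝔸.winRegion S) = 𝔸.winRegion S := by
  refine le_antisymm (le_winRegion_of_even hΩ heven (fun b hb => (gfpOn_of_mem hb).ge) fun b hb =>
      (gfpOn_of_notMem hb).le)
    (le_gfpOn (fun b _ => winRegion_le_step b) fun _ _ => le_rfl)

end Automaton

end ModalMu

/-! ### The translation of automata into formulas -/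

namespace ModalMu

/-- The operations from which formulas are built. The translation is carried out over an arbitrary
carrier: formulas (for the correctness proof), or Gödel numbers (for the computability proof). -/
structure FormOps (X : Type) where
  var : ℕ → X
  nvar : ℕ → X
  and : X → X → X
  or : X → X → X
  dia : X → X
  box : X → X
  mu : ℕ → X → X
  nu : ℕ → X → X

namespace FormOps

variable {X : Type} (M : FormOps X)

/-- `μ p. φ` or `ν p. φ`. -/
def fix (e : Bool) (p : ℕ) (φ : X) : X := bif e then M.nu p φ else M.mu p φ

/-- Falsity, as `μ p. p`. -/
def bot : X := M.mu 0 (M.var 0)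

/-- Truth, as `ν p. p`. -/
def top : X := M.nu 0 (M.var 0)

def bigOr (l : List X) : X := l.foldr M.or M.bot

def bigAnd (l : List X) : X := l.foldr M.and M.top

/-- The characteristic formula of the colour `{p < k | j.testBit p}`. -/
def color (k j : ℕ) : X :=
  M.bigAnd ((List.range k).map fun p => bif j.testBit p then M.var p else M.nvar p)

/-- The modal counterpart of a literal, with `θ a` for the predicate `a`. The literals with a free
individual variable do not occur in normal forms of sentences. -/
def lit (θ : ℕ → X) : Lit → X
  | .inl _ => M.bot
  | .inr (true, S) => M.dia (M.bigAnd (S.map θ))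
  | .inr (false, S) => M.box (M.bigOr (S.map θ))

/-- The modal counterpart of a normal form. -/
def dnf (θ : ℕ → X) (d : DNF) : X :=
  M.bigOr (d.map fun c => M.bigAnd (c.map (M.lit θ)))

/-- The formula that says of a node of colour `j` that its successors satisfy `D j`. -/
def body (k : ℕ) (D : ℕ → DNF) (θ : ℕ → X) : X :=
  M.bigOr ((List.range (2 ^ k)).map fun j => M.and (M.color k j) (M.dnf θ (D j)))

end FormOps

/-- The predicates that occur in a literal. -/
def Lit.preds : Lit → List ℕ
  | .inl (a, _) => [a]
  | .inr (_, S) => S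

/-- The predicates that occur in a normal form. -/
def DNF.preds (d : DNF) : List ℕ := d.flatMap fun c => c.flatMap Lit.preds

theorem DNF.mem_preds {d : DNF} {a : ℕ} : a ∈ d.preds ↔ d.Mentions a := by
  simp only [DNF.preds, List.mem_flatMap, DNF.Mentions]
  refine exists_congr fun c => and_congr_right fun _ => exists_congr fun l =>
    and_congr_right fun _ => ?_
  rcases l with ⟨b, x⟩ | ⟨b, S⟩
  · simp [Lit.preds, eq_comm]
  · simp [Lit.preds]

theorem Lit.prune_eq_inl {e : Bool} {p : ℕ → Bool} {l : Lit} {q : ℕ × ℕ}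
    (h : l.prune e p = .inl q) : l = .inl q := by
  rcases l with q' | ⟨b, S⟩
  · exact h
  · cases h

/-- The translation of the state `a` of an automaton with `n` states and `k` letters, relative to the
set of states that are not yet bound, which is given by the ones in the binary expansion of `C`. A
bound state becomes the variable `k + a`; a state that is not bound becomes a fixpoint formula (a
greatest one if `even a`), in the body of which it is bound. The second component lists the bound
states whose variables may be free in the formula. `D a j` is the normal form of the transition
condition for `a` and the colour `j`. Under the modality of kind `even a` it is pruned to predicates
`b` whose formulas have no state variables: these are the boxes in a least and the diamonds in a
greatest fixpoint formula. -/
def trans {X : Type} (M : FormOps X) (k n : ℕ) (even : ℕ → Bool) (D : ℕ → ℕ → DNF) (C a : ℕ) :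
    X × List ℕ :=
  if h : a < n ∧ C.testBit a = true then
    have : C - 2 ^ a < C := by
      have := Nat.ge_two_pow_of_testBit h.2
      have := Nat.two_pow_pos a
      omega
    (M.fix (even a) (k + a) (M.body k
        (fun j => (D a j).prune (even a) fun b => (trans M k n even D (C - 2 ^ a) b).2.isEmpty)
        fun b => (trans M k n even D (C - 2 ^ a) b).1),
      ((List.range (2 ^ k)).flatMap fun j => (D a j).preds.flatMap fun b =>
        (trans M k n even D (C - 2 ^ a) b).2).filter (· ≠ a))
  else (M.var (k + a), [a])
termination_by C

theorem testBit_sub_two_pow {C a : ℕ} (h : C.testBit a = true) (b : ℕ) :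
    (C - 2 ^ a).testBit b = (C.testBit b && decide (b ≠ a)) := by
  have hr : C % 2 ^ a < 2 ^ a := Nat.mod_lt _ (Nat.two_pow_pos a)
  have hodd : C / 2 ^ a % 2 = 1 := by
    simpa [Nat.testBit_eq_decide_div_mod_eq] using h
  have hC : C = 2 ^ a * (C / 2 ^ a) + C % 2 ^ a := (Nat.div_add_mod C (2 ^ a)).symm
  have hq : C / 2 ^ a = 2 * (C / 2 ^ a / 2) + 1 := by omega
  generalize C / 2 ^ a / 2 = q at hq
  have hC' : C - 2 ^ a = 2 ^ a * (2 * q) + C % 2 ^ a := by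
    rw [hq, Nat.mul_add, Nat.mul_one] at hC
    omega
  rw [hq] at hC
  rw [hC']
  conv_rhs => rw [hC]
  generalize C % 2 ^ a = r at hr
  rw [Nat.testBit_two_pow_mul_add _ hr, Nat.testBit_two_pow_mul_add _ hr]
  split_ifs with hb
  · simp [hb.ne]
  · obtain ⟨i, rfl⟩ := Nat.exists_eq_add_of_le (Nat.le_of_not_lt hb)
    rw [Nat.add_sub_cancel_left]
    rcases i with _ | i
    · simp
    · rw [Nat.testBit_succ, Nat.testBit_succ]
      have h₁ : 2 * q / 2 = q := by omega
      have h₂ : (2 * q + 1) / 2 = q := by omega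
      simp [h₁, h₂]

/-- The operations on formulas. -/
def muOps : FormOps MuML where
  var := .var
  nvar := .nvar
  and := .and
  or := .or
  dia := .dia
  box := .box
  mu := .mu
  nu := .nu

namespace MuML

variable {T : Type*} {R : T → T → Prop} {V : ℕ → Set T} {s : T}

theorem notMem_sem_bot : s ∉ sem R V muOps.bot := by
  intro h
  exact Set.mem_sInter.1 h ∅ (by simp [muOps, sem])

theorem mem_sem_top : s ∈ sem R V muOps.top :=
  Set.mem_sUnion.2 ⟨Set.univ, by simp [muOps, sem], trivial⟩

theorem mem_sem_bigOr {l : List MuML} : s ∈ sem R V (muOps.bigOr l) ↔ ∃ φ ∈ l, s ∈ sem R V φ := by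
  induction l with
  | nil => simpa [FormOps.bigOr] using notMem_sem_bot
  | cons φ l ih =>
    rw [List.exists_mem_cons_iff, ← ih]
    rfl

theorem mem_sem_bigAnd {l : List MuML} :
    s ∈ sem R V (muOps.bigAnd l) ↔ ∀ φ ∈ l, s ∈ sem R V φ := by
  induction l with
  | nil => simpa [FormOps.bigAnd] using mem_sem_top
  | cons φ l ih =>
    rw [List.forall_mem_cons, ← ih]
    rfl

theorem mem_sem_color {k j : ℕ} :
    s ∈ sem R V (muOps.color k j) ↔ ∀ p < k, (j.testBit p = true ↔ s ∈ V p) := by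
  simp only [FormOps.color, mem_sem_bigAnd, List.forall_mem_map, List.mem_range]
  refine forall₂_congr fun p _ => ?_
  cases j.testBit p <;> simp [muOps, sem]

theorem mem_sem_lit (θ : ℕ → MuML) (q : Bool × List ℕ) (g : ℕ → {t // R s t}) :
    s ∈ sem R V (muOps.lit θ (.inr q)) ↔
      Lit.Sat (D := {t // R s t}) (fun b => {t | (t : T) ∈ sem R V (θ b)}) g (.inr q) := by
  obtain ⟨_ | _, S⟩ := q
  · change (∀ t, R s t → t ∈ sem R V (muOps.bigOr (S.map θ))) ↔ _
    simp [mem_sem_bigOr, Lit.Sat]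
  · change (∃ t, R s t ∧ t ∈ sem R V (muOps.bigAnd (S.map θ))) ↔ _
    simp [mem_sem_bigAnd, Lit.Sat]

theorem mem_sem_dnf (θ : ℕ → MuML) (d : DNF) (g : ℕ → {t // R s t})
    (hd : ∀ c ∈ d, ∀ q, Sum.inl q ∉ c) :
    s ∈ sem R V (muOps.dnf θ d) ↔
      DNF.Sat (D := {t // R s t}) (fun b => {t | (t : T) ∈ sem R V (θ b)}) g d := by
  simp only [FormOps.dnf, mem_sem_bigOr, List.mem_map, exists_exists_and_eq_and, mem_sem_bigAnd,
    forall_exists_index, and_imp, forall_apply_eq_imp_iff₂, DNF.Sat]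
  refine exists_congr fun c => and_congr_right fun hc => forall₂_congr fun l hl => ?_
  rcases l with q | q
  · exact absurd hl (hd c hc q)
  · exact mem_sem_lit θ q g

theorem mem_sem_body (k : ℕ) (D : ℕ → DNF) (θ : ℕ → MuML) :
    s ∈ sem R V (muOps.body k D θ) ↔ ∃ j < 2 ^ k,
      (∀ p < k, (j.testBit p = true ↔ s ∈ V p)) ∧ s ∈ sem R V (muOps.dnf θ (D j)) := by
  simp only [FormOps.body, mem_sem_bigOr, List.mem_map, exists_exists_and_eq_and, List.mem_range,
    ← mem_sem_color (R := R)]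
  rfl

end MuML

namespace Automaton

variable {k n : ℕ} (𝔸 : Automaton k (Fin n))

/-- The transition condition for the colour with number `j`. -/
def cond (a : Fin n) (j : ℕ) : FO1 (Fin n) := 𝔸.Δ a {p | j.testBit (p : ℕ) = true}

/-- The normal form of the transition condition for the colour with number `j`. -/
def normal (a j : ℕ) : DNF := if h : a < n then (𝔸.cond ⟨a, h⟩ j).normalForm.1 else []

/-- Whether the priority of the state is even. -/
def evenPriority (a : ℕ) : Bool := if h : a < n then decide (𝔸.Ω ⟨a, h⟩ % 2 = 0) else false

/-- The formula for the state `a` when the states outside `C` are bound. -/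
def formula (C a : ℕ) : MuML := (trans muOps k n 𝔸.evenPriority 𝔸.normal C a).1

/-- The states whose variables may be free in `𝔸.formula C a`. -/
def boundVars (C a : ℕ) : List ℕ := (trans muOps k n 𝔸.evenPriority 𝔸.normal C a).2

/-- The body of the fixpoint formula for the state `a`. -/
def formulaBody (C a : ℕ) : MuML :=
  muOps.body k (fun j => (𝔸.normal a j).prune (𝔸.evenPriority a) fun b =>
    (𝔸.boundVars (C - 2 ^ a) b).isEmpty) (𝔸.formula (C - 2 ^ a))

variable {𝔸}

theorem formula_of_testBit {C : ℕ} {a : Fin n} (h : C.testBit a = true) :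
    𝔸.formula C a = muOps.fix (𝔸.evenPriority a) (k + a) (𝔸.formulaBody C a) := by
  rw [formula, trans, dif_pos ⟨a.2, h⟩]
  rfl

theorem formula_of_not_testBit {C a : ℕ} (h : ¬ (a < n ∧ C.testBit a = true)) :
    𝔸.formula C a = .var (k + a) := by
  rw [formula, trans, dif_neg h]
  rfl

theorem boundVars_of_testBit {C : ℕ} {a : Fin n} (h : C.testBit a = true) :
    𝔸.boundVars C a = ((List.range (2 ^ k)).flatMap fun j => (𝔸.normal a j).preds.flatMap
      (𝔸.boundVars (C - 2 ^ (a : ℕ)))).filter (· ≠ (a : ℕ)) := by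
  rw [boundVars, trans, dif_pos ⟨a.2, h⟩]
  rfl

theorem boundVars_of_not_testBit {C a : ℕ} (h : ¬ (a < n ∧ C.testBit a = true)) :
    𝔸.boundVars C a = [a] := by
  rw [boundVars, trans, dif_neg h]

theorem sub_two_pow_lt {C a : ℕ} (h : C.testBit a = true) : C - 2 ^ a < C := by
  have := Nat.ge_two_pow_of_testBit h
  have := Nat.two_pow_pos a
  omega

theorem normal_coe (a : Fin n) (j : ℕ) : 𝔸.normal a j = (𝔸.cond a j).normalForm.1 := by
  simp [normal]

theorem evenPriority_eq_true {a : Fin n} : 𝔸.evenPriority a = true ↔ Even (𝔸.Ω a) := by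
  simp [evenPriority, Nat.even_iff]

theorem evenPriority_eq_false {a : Fin n} : 𝔸.evenPriority a = false ↔ Odd (𝔸.Ω a) := by
  simp [evenPriority, Nat.odd_iff]

theorem leads_of_mentions {a : Fin n} {j b : ℕ} (h : (𝔸.normal a j).Mentions b) :
    ∃ b' : Fin n, (b' : ℕ) = b ∧ 𝔸.Leads a b' := by
  rw [normal_coe] at h
  obtain ⟨b', hb, h⟩ := FO1.occurs_of_mentions h
  exact ⟨b', hb, _, h⟩

theorem reach_of_mem_boundVars {C : ℕ} {a : Fin n} {c : ℕ} (hc : c ∈ 𝔸.boundVars C a) :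
    ∃ c' : Fin n, (c' : ℕ) = c ∧ C.testBit c = false ∧ 𝔸.Reach a c' := by
  induction C using Nat.strong_induction_on generalizing a with
  | _ C ih =>
  by_cases h : C.testBit a = true
  · rw [boundVars_of_testBit h] at hc
    simp only [List.mem_filter, List.mem_flatMap, DNF.mem_preds, decide_eq_true_eq] at hc
    obtain ⟨⟨j, -, b, hb, hc⟩, hca⟩ := hc
    obtain ⟨b, rfl, hab⟩ := leads_of_mentions hb
    obtain ⟨c, rfl, hcC, hbc⟩ := ih _ (sub_two_pow_lt h) hc
    rw [testBit_sub_two_pow h] at hcC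
    exact ⟨c, rfl, by simpa [hca] using hcC, .head hab hbc⟩
  · rw [boundVars_of_not_testBit fun h' => h h'.2, List.mem_singleton] at hc
    subst hc
    exact ⟨a, rfl, by simpa using h, .refl⟩

/-- All bound states lead to `a`: the invariant of the translation. -/
def BoundReach (𝔸 : Automaton k (Fin n)) (C : ℕ) (a : Fin n) : Prop :=
  ∀ c : Fin n, C.testBit c = false → 𝔸.Reach c a

theorem BoundReach.reach {C : ℕ} {a b : Fin n} (H : 𝔸.BoundReach C a) (h : C.testBit a = true)
    (hab : 𝔸.Leads a b) : 𝔸.BoundReach (C - 2 ^ (a : ℕ)) b := by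
  intro c hc
  by_cases hca : c = a
  · subst hca
    exact .single hab
  · refine (H c ?_).tail hab
    rw [testBit_sub_two_pow h] at hc
    simpa [Fin.ext_iff.not.1 hca] using hc

/-- The variable of a bound state can only be free in the formulas for the states in its cluster. -/
theorem BoundReach.mem_cluster {C : ℕ} {a b : Fin n} (H : 𝔸.BoundReach C a)
    (h : C.testBit a = true) (hab : 𝔸.Leads a b)
    (hb : (𝔸.boundVars (C - 2 ^ (a : ℕ)) b).isEmpty = false) : b ∈ 𝔸.cluster a := by
  obtain ⟨c, hc⟩ := List.exists_mem_of_ne_nil _ (by simpa using hb)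
  obtain ⟨c, rfl, hcC, hbc⟩ := reach_of_mem_boundVars hc
  refine ⟨.single hab, hbc.trans ?_⟩
  by_cases hca : c = a
  · subst hca; exact .refl
  · refine H c ?_
    rw [testBit_sub_two_pow h] at hcC
    simpa [Fin.ext_iff.not.1 hca] using hcC

theorem exists_color (c : Set (Fin k)) : ∃ j < 2 ^ k, {p : Fin k | j.testBit p = true} = c := by
  classical
  refine ⟨Nat.ofBits fun p : Fin k => decide (p ∈ c), Nat.ofBits_lt_two_pow _, ?_⟩
  ext p
  simp

variable {T : Type*} {S : LTS T}

/-- Pruning the transition conditions does not matter, by continuity or co-continuity. -/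
theorem sat_prune_cond (h𝔸 : 𝔸.IsContinuousWeak) {a : Fin n} {j : ℕ} {p : ℕ → Bool}
    (hp : ∀ b : Fin n, 𝔸.Leads a b → p b = false → b ∈ 𝔸.cluster a)
    {D : Type*} (V : ℕ → Set D) (g : ℕ → D) :
    DNF.Sat V g ((𝔸.normal a j).prune (𝔸.evenPriority a) p) ↔
      FO1.Models (fun b : Fin n => V b) (𝔸.cond a j) := by
  have hs : (𝔸.cond a j).IsSentence := 𝔸.sentence _ _
  have hpos : (𝔸.cond a j).IsPositive := 𝔸.positive _ _
  rw [FO1.models_iff V g hs hpos, normal_coe]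
  have hcl : ∀ b : Fin n, (𝔸.cond a j).normalForm.1.Mentions b → p b = false →
      b ∈ 𝔸.cluster a := by
    intro b hb
    rw [← normal_coe] at hb
    obtain ⟨b', hb', hab⟩ := leads_of_mentions hb
    rw [Fin.ext hb'] at hab
    exact hp b hab
  cases he : 𝔸.evenPriority a
  · refine FO1.sat_prune_of_continuousIn hs hpos p (fun b hb hpb => ?_) V g
    have hb' := hcl b hb hpb
    exact (h𝔸 a b hb'.1 hb'.2).2.1 (evenPriority_eq_false.1 he) _
  · refine FO1.sat_prune_of_cocontinuousIn hs hpos p (fun b hb hpb => ?_) V g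
    have hb' := hcl b hb hpb
    exact (h𝔸 a b hb'.1 hb'.2).2.2 (evenPriority_eq_true.1 he) _

theorem sem_formulaBody (h𝔸 : 𝔸.IsContinuousWeak) {C : ℕ} {a : Fin n} (H : 𝔸.BoundReach C a)
    (h : C.testBit a = true) {V : ℕ → Set T} (hV : ∀ p < k, V p = {s | p ∈ S.σ s}) :
    MuML.sem S.R V (𝔸.formulaBody C a) =
      𝔸.step S (fun b => MuML.sem S.R V (𝔸.formula (C - 2 ^ (a : ℕ)) b)) a := by
  ext s
  have : Nonempty {t // S.R s t} := ⟨⟨_, (S.serial s).choose_spec⟩⟩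
  let g : ℕ → {t // S.R s t} := fun _ => Classical.arbitrary _
  have hcol : ∀ j : ℕ, (∀ p < k, (j.testBit p = true ↔ s ∈ V p)) ↔
      {p : Fin k | j.testBit p = true} = S.color k s := by
    intro j
    rw [Set.ext_iff]
    constructor
    · intro hj p
      rw [Set.mem_ofPred_eq, hj p p.2, hV p p.2]
      rfl
    · intro hj p hp
      rw [hV p hp]
      exact hj ⟨p, hp⟩
  rw [formulaBody, MuML.mem_sem_body, mem_step]
  have key : ∀ j, s ∈ MuML.sem S.R V (muOps.dnf (𝔸.formula (C - 2 ^ (a : ℕ)))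
      ((𝔸.normal a j).prune (𝔸.evenPriority a) fun b =>
        (𝔸.boundVars (C - 2 ^ (a : ℕ)) b).isEmpty)) ↔
      FO1.Models (D := {t // S.R s t}) (fun b : Fin n =>
        {t | (t : T) ∈ MuML.sem S.R V (𝔸.formula (C - 2 ^ (a : ℕ)) b)}) (𝔸.cond a j) := by
    intro j
    rw [MuML.mem_sem_dnf _ _ g, sat_prune_cond h𝔸 fun b hab hb => H.mem_cluster h hab hb]
    intro c hc q hq
    obtain ⟨c, hc', rfl⟩ := List.mem_map.1 hc
    obtain ⟨l, hl, hlq⟩ := List.mem_map.1 hq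
    rw [Lit.prune_eq_inl hlq] at hl
    rw [normal_coe] at hc'
    exact FO1.inl_notMem_normalForm (𝔸.sentence _ _) hc' q hl
  simp only [hcol, key]
  constructor
  · rintro ⟨j, -, hj, h⟩
    rwa [cond, hj] at h
  · intro h
    obtain ⟨j, hj, hjc⟩ := exists_color (S.color k s)
    exact ⟨j, hj, hjc, by rwa [cond, hjc]⟩

/-- The greatest solution if `e`, otherwise the least one. -/
noncomputable def extOn {A L : Type*} [CompleteLattice L] (e : Bool) (Φ : (A → L) →o (A → L))
    (U : Set A) (Z : A → L) : A → L :=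
  bif e then gfpOn Φ U Z else lfpOn Φ U Z

theorem extOn_of_notMem {A L : Type*} [CompleteLattice L] {e : Bool} {Φ : (A → L) →o (A → L)}
    {U : Set A} {Z : A → L} {a : A} (ha : a ∉ U) : extOn e Φ U Z a = Z a := by
  cases e
  · exact lfpOn_of_notMem Φ U Z ha
  · exact gfpOn_of_notMem ha

theorem extOn_congr {A L : Type*} [CompleteLattice L] {e : Bool} {Φ : (A → L) →o (A → L)}
    {U : Set A} {Z Z' : A → L} (h : ∀ a ∉ U, Z a = Z' a) : extOn e Φ U Z = extOn e Φ U Z' := by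
  cases e
  · exact lfpOn_congr h
  · exact gfpOn_congr h

theorem extOn_cluster (h𝔸 : 𝔸.IsContinuousWeak) (a : Fin n) :
    extOn (𝔸.evenPriority a) (𝔸.step S) (𝔸.cluster a) (𝔸.winRegion S) = 𝔸.winRegion S := by
  have hΩ : ∀ b ∈ 𝔸.cluster a, 𝔸.Ω b = 𝔸.Ω a := fun b hb => (h𝔸 a b hb.1 hb.2).1.symm
  cases he : 𝔸.evenPriority a
  · exact lfpOn_cluster hΩ (evenPriority_eq_false.1 he)
  · exact gfpOn_cluster hΩ (evenPriority_eq_true.1 he)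

open Classical in
/-- Values for the states that are not to be computed by a fixpoint: bound states of the cluster
of `a` are read off from the valuation, states of other clusters have their winning region. -/
noncomputable def outer (𝔸 : Automaton k (Fin n)) (S : LTS T) (V : ℕ → Set T) (a : Fin n) :
    Fin n → Set T :=
  fun b => if b ∈ 𝔸.cluster a then V (k + b) else 𝔸.winRegion S b

/-- The formula for `a` defines the `a`-component of the simultaneous fixpoint over the unbound
states in the cluster of `a`. -/
theorem sem_formula (h𝔸 : 𝔸.IsContinuousWeak) {C : ℕ} {a : Fin n} (H : 𝔸.BoundReach C a)
    {V : ℕ → Set T} (hV : ∀ p < k, V p = {s | p ∈ S.σ s}) :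
    MuML.sem S.R V (𝔸.formula C a) = extOn (𝔸.evenPriority a) (𝔸.step S)
      (𝔸.cluster a ∩ {b : Fin n | C.testBit b = true}) (𝔸.outer S V a) a := by
  induction C using Nat.strong_induction_on generalizing a V with
  | _ C ih =>
  by_cases h : C.testBit a = true
  swap
  · rw [formula_of_not_testBit fun h' => h h'.2, extOn_of_notMem fun h' => h h'.2]
    simp [MuML.sem, outer, mem_cluster_self]
  have hbody : ∀ X : Set T, MuML.sem S.R (Function.update V (k + a) X) (𝔸.formulaBody C a) =
      𝔸.step S (extOn (𝔸.evenPriority a) (𝔸.step S)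
        ((𝔸.cluster a ∩ {b : Fin n | C.testBit b = true}) \ {a})
        (Function.update (𝔸.outer S V a) a X)) a := by
    intro X
    have hV' : ∀ p < k, Function.update V (k + a) X p = {s | p ∈ S.σ s} := fun p hp => by
      rw [Function.update_of_ne (by omega), hV p hp]
    rw [sem_formulaBody h𝔸 H h hV']
    refine 𝔸.step_congr S fun b hab => ?_
    rw [ih _ (sub_two_pow_lt h) (H.reach h hab) hV']
    have hbit : ∀ c : Fin n, (C - 2 ^ (a : ℕ)).testBit c = true ↔ C.testBit c = true ∧ c ≠ a := by
      intro c
      rw [testBit_sub_two_pow h]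
      simp [Fin.ext_iff]
    by_cases hb : b ∈ 𝔸.cluster a
    · have he : 𝔸.evenPriority b = 𝔸.evenPriority a := by
        simp [evenPriority, (h𝔸 a b hb.1 hb.2).1]
      have hU : 𝔸.cluster b ∩ {c : Fin n | (C - 2 ^ (a : ℕ)).testBit c = true} =
          (𝔸.cluster a ∩ {b : Fin n | C.testBit b = true}) \ {a} := by
        ext c
        simp only [cluster_eq hb, Set.mem_inter_iff, Set.mem_ofPred_eq, hbit, Set.mem_sdiff,
          Set.mem_singleton_iff, and_assoc]
      have hZ : 𝔸.outer S (Function.update V (k + a) X) b =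
          Function.update (𝔸.outer S V a) a X := by
        ext1 c
        by_cases hca : c = a
        · subst hca
          simp [outer, show c ∈ 𝔸.cluster b from ⟨hb.2, hb.1⟩]
        · have : k + (c : ℕ) ≠ k + a := by
            have := Fin.ext_iff.not.1 hca
            omega
          have hc : c ∈ 𝔸.cluster b ↔ c ∈ 𝔸.cluster a := by rw [cluster_eq hb]
          rw [Function.update_of_ne hca]
          simp only [outer, Function.update_of_ne this]
          by_cases hc' : c ∈ 𝔸.cluster a
          · rw [if_pos hc', if_pos (hc.2 hc')]
          · rw [if_neg hc', if_neg (mt hc.1 hc')]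
      rw [he, hU, hZ]
    · have hba : b ≠ a := by
        rintro rfl
        exact hb (mem_cluster_self b)
      have hU : 𝔸.cluster b ∩ {c : Fin n | (C - 2 ^ (a : ℕ)).testBit c = true} =
          𝔸.cluster b := by
        refine Set.inter_eq_left.2 fun c hc => ?_
        by_contra hcC
        rw [Set.mem_ofPred_eq, hbit, not_and_or, not_not] at hcC
        refine hb ⟨.single hab, hc.1.trans ?_⟩
        rcases hcC with hcC | rfl
        · exact H c (by simpa using hcC)
        · exact .refl
      have hZ : extOn (𝔸.evenPriority b) (𝔸.step S) (𝔸.cluster b)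
          (𝔸.outer S (Function.update V (k + a) X) b) = 𝔸.winRegion S := by
        rw [← extOn_cluster h𝔸 b]
        refine extOn_congr fun c hc => ?_
        simp [outer, hc]
      rw [hU, hZ, extOn_of_notMem fun h' => hb h'.1.1, Function.update_of_ne hba]
      simp [outer, hb]
  have ha : a ∈ 𝔸.cluster a ∩ {b : Fin n | C.testBit b = true} := ⟨mem_cluster_self a, h⟩
  rw [formula_of_testBit h]
  cases he : 𝔸.evenPriority a
  · rw [he] at hbody
    change ⋂₀ {X | MuML.sem S.R (Function.update V (k + a) X) (𝔸.formulaBody C a) ⊆ X} = _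
    simp only [hbody]
    exact (lfpOn_eq_sInf ha).symm
  · rw [he] at hbody
    change ⋃₀ {X | X ⊆ MuML.sem S.R (Function.update V (k + a) X) (𝔸.formulaBody C a)} = _
    simp only [hbody]
    exact (gfpOn_eq_sSup ha).symm

theorem accepts_iff_holds (h𝔸 : 𝔸.IsContinuousWeak) :
    𝔸.Accepts S ↔ (𝔸.formula (2 ^ n - 1) 𝔸.init).Holds S := by
  have hbit : ∀ c : Fin n, (2 ^ n - 1).testBit c = true := fun c => by
    rw [Nat.testBit_two_pow_sub_one]
    simp
  rw [MuML.Holds, sem_formula h𝔸 (fun c hc => by simp [hbit] at hc) fun _ _ => rfl]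
  have hU : 𝔸.cluster 𝔸.init ∩ {b : Fin n | (2 ^ n - 1).testBit b = true} =
      𝔸.cluster 𝔸.init := Set.inter_eq_left.2 fun c _ => hbit c
  rw [hU, extOn_congr (Z' := 𝔸.winRegion S) fun c hc => by simp [outer, hc], extOn_cluster h𝔸]
  rfl

end Automaton

end ModalMu

/-! ### The fragment `μ_c ML` in negation normal form -/

namespace ModalMu

namespace MuML

/-- Negates the free occurrences of the letters in `B`. -/
def flip : Finset ℕ → MuML → MuML
  | B, var q => if q ∈ B then nvar q else var q
  | B, nvar q => if q ∈ B then var q else nvar q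
  | B, and φ ψ => and (flip B φ) (flip B ψ)
  | B, or φ ψ => or (flip B φ) (flip B ψ)
  | B, dia φ => dia (flip B φ)
  | B, box φ => box (flip B φ)
  | B, mu p φ => mu p (flip (B.erase p) φ)
  | B, nu p φ => nu p (flip (B.erase p) φ)

theorem flip_empty (φ : MuML) : flip ∅ φ = φ := by
  induction φ <;> simp_all [flip]

theorem complAux_complAux (B : Finset ℕ) (φ : MuML) : complAux B (complAux B φ) = φ := by
  induction φ generalizing B with
  | var q => by_cases h : q ∈ B <;> simp [complAux, h]
  | nvar q => by_cases h : q ∈ B <;> simp [complAux, h]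
  | _ => simp_all [complAux]

theorem compl_compl (φ : MuML) : φ.compl.compl = φ := complAux_complAux ∅ φ

theorem insert_union_erase (p : ℕ) (A B : Finset ℕ) :
    insert p A ∪ B.erase p = insert p (A ∪ B) := by
  ext q
  by_cases h : q = p <;> simp [h]

theorem disjoint_insert_erase {p : ℕ} {A B : Finset ℕ} (h : Disjoint A B) :
    Disjoint (insert p A) (B.erase p) := by
  rw [Finset.disjoint_left] at h ⊢
  intro q hq hqB
  rw [Finset.mem_erase] at hqB
  exact h ((Finset.mem_insert.1 hq).resolve_left hqB.1) hqB.2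

theorem complAux_flip {A B : Finset ℕ} (h : Disjoint A B) (φ : MuML) :
    complAux A (flip B φ) = complAux (A ∪ B) φ := by
  induction φ generalizing A B with
  | var q =>
    by_cases hB : q ∈ B
    · simp [flip, complAux, hB, Finset.disjoint_right.1 h hB]
    · simp [flip, complAux, hB]
  | nvar q =>
    by_cases hB : q ∈ B
    · simp [flip, complAux, hB, Finset.disjoint_right.1 h hB]
    · simp [flip, complAux, hB]
  | and φ ψ ih₁ ih₂ => simp [flip, complAux, ih₁ h, ih₂ h]
  | or φ ψ ih₁ ih₂ => simp [flip, complAux, ih₁ h, ih₂ h]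
  | dia φ ih => simp [flip, complAux, ih h]
  | box φ ih => simp [flip, complAux, ih h]
  | mu p φ ih =>
    simp only [flip, complAux, ih (disjoint_insert_erase h), insert_union_erase]
  | nu p φ ih =>
    simp only [flip, complAux, ih (disjoint_insert_erase h), insert_union_erase]

theorem flip_complAux {A B : Finset ℕ} (h : Disjoint A B) (φ : MuML) :
    flip B (complAux A φ) = complAux (A ∪ B) φ := by
  induction φ generalizing A B with
  | var q =>
    by_cases hB : q ∈ B
    · simp [flip, complAux, hB, Finset.disjoint_right.1 h hB]
    · by_cases hA : q ∈ A <;> simp [flip, complAux, hA, hB]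
  | nvar q =>
    by_cases hB : q ∈ B
    · simp [flip, complAux, hB, Finset.disjoint_right.1 h hB]
    · by_cases hA : q ∈ A <;> simp [flip, complAux, hA, hB]
  | and φ ψ ih₁ ih₂ => simp [flip, complAux, ih₁ h, ih₂ h]
  | or φ ψ ih₁ ih₂ => simp [flip, complAux, ih₁ h, ih₂ h]
  | dia φ ih => simp [flip, complAux, ih h]
  | box φ ih => simp [flip, complAux, ih h]
  | mu p φ ih =>
    simp only [flip, complAux, ih (disjoint_insert_erase h), insert_union_erase]
  | nu p φ ih =>
    simp only [flip, complAux, ih (disjoint_insert_erase h), insert_union_erase]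

theorem free_flip (B : Finset ℕ) (φ : MuML) : (flip B φ).free = φ.free := by
  induction φ generalizing B with
  | var q => by_cases h : q ∈ B <;> simp [flip, free, h]
  | nvar q => by_cases h : q ∈ B <;> simp [flip, free, h]
  | _ => simp_all [flip, free]

theorem free_complAux (B : Finset ℕ) (φ : MuML) : (complAux B φ).free = φ.free := by
  induction φ generalizing B with
  | var q => by_cases h : q ∈ B <;> simp [complAux, free, h]
  | nvar q => by_cases h : q ∈ B <;> simp [complAux, free, h]
  | _ => simp_all [complAux, free]

theorem PosIn.flip {p : ℕ} {φ : MuML} (h : PosIn p φ) {B : Finset ℕ} (hp : p ∉ B) :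
    PosIn p (flip B φ) := by
  induction φ generalizing B with
  | var q =>
    by_cases hq : q ∈ B
    · simpa [MuML.flip, hq, PosIn] using fun h : q = p => hp (h ▸ hq)
    · simp [MuML.flip, hq, PosIn]
  | nvar q => by_cases hq : q ∈ B <;> simp_all [MuML.flip, PosIn]
  | and φ ψ ih₁ ih₂ => exact ⟨ih₁ h.1 hp, ih₂ h.2 hp⟩
  | or φ ψ ih₁ ih₂ => exact ⟨ih₁ h.1 hp, ih₂ h.2 hp⟩
  | dia φ ih => exact ih h hp
  | box φ ih => exact ih h hp
  | mu q φ ih => exact h.imp_right fun h => ih h (by simp [hp])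
  | nu q φ ih => exact h.imp_right fun h => ih h (by simp [hp])

theorem PosIn.complAux {p : ℕ} {φ : MuML} (h : PosIn p φ) {B : Finset ℕ} (hp : p ∈ B) :
    PosIn p (complAux B φ) := by
  induction φ generalizing B with
  | var q =>
    by_cases hq : q ∈ B
    · simp [MuML.complAux, hq, PosIn]
    · simpa [MuML.complAux, hq, PosIn] using fun h : q = p => hq (h ▸ hp)
  | nvar q => by_cases hq : q ∈ B <;> simp_all [MuML.complAux, PosIn]
  | and φ ψ ih₁ ih₂ => exact ⟨ih₁ h.1 hp, ih₂ h.2 hp⟩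
  | or φ ψ ih₁ ih₂ => exact ⟨ih₁ h.1 hp, ih₂ h.2 hp⟩
  | dia φ ih => exact ih h hp
  | box φ ih => exact ih h hp
  | mu q φ ih => exact h.imp_right fun h => ih h (by simp [hp])
  | nu q φ ih => exact h.imp_right fun h => ih h (by simp [hp])

theorem WF.flip {φ : MuML} (h : φ.WF) (B : Finset ℕ) : (flip B φ).WF := by
  induction φ generalizing B with
  | var q => by_cases hq : q ∈ B <;> simp [MuML.flip, hq, WF]
  | nvar q => by_cases hq : q ∈ B <;> simp [MuML.flip, hq, WF]
  | and φ ψ ih₁ ih₂ => exact ⟨ih₁ h.1 B, ih₂ h.2 B⟩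
  | or φ ψ ih₁ ih₂ => exact ⟨ih₁ h.1 B, ih₂ h.2 B⟩
  | dia φ ih => exact ih h B
  | box φ ih => exact ih h B
  | mu q φ ih => exact ⟨h.1.flip (by simp), ih h.2 _⟩
  | nu q φ ih => exact ⟨h.1.flip (by simp), ih h.2 _⟩

theorem WF.complAux {φ : MuML} (h : φ.WF) (B : Finset ℕ) : (complAux B φ).WF := by
  induction φ generalizing B with
  | var q => by_cases hq : q ∈ B <;> simp [MuML.complAux, hq, WF]
  | nvar q => by_cases hq : q ∈ B <;> simp [MuML.complAux, hq, WF]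
  | and φ ψ ih₁ ih₂ => exact ⟨ih₁ h.1 B, ih₂ h.2 B⟩
  | or φ ψ ih₁ ih₂ => exact ⟨ih₁ h.1 B, ih₂ h.2 B⟩
  | dia φ ih => exact ih h B
  | box φ ih => exact ih h B
  | mu q φ ih => exact ⟨h.1.complAux (by simp), ih h.2 _⟩
  | nu q φ ih => exact ⟨h.1.complAux (by simp), ih h.2 _⟩

theorem Cont.flip {Q : Set ℕ} {φ : MuML} (h : Cont Q φ) {B : Finset ℕ}
    (hB : Disjoint (B : Set ℕ) Q) : Cont Q (flip B φ) := by
  induction h generalizing B with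
  | @var Q q hq =>
    have : q ∉ B := fun h => Set.disjoint_left.1 hB h hq
    simpa [MuML.flip, this] using Cont.var hq
  | free hwf hfree => exact .free (hwf.flip B) (by rwa [free_flip])
  | or _ _ ih₁ ih₂ => exact .or (ih₁ hB) (ih₂ hB)
  | and _ _ ih₁ ih₂ => exact .and (ih₁ hB) (ih₂ hB)
  | dia _ ih => exact .dia (ih hB)
  | @mu Q p α hp _ ih =>
    refine .mu hp (ih ?_)
    rw [Set.disjoint_left] at hB ⊢
    intro q hq hq'
    rw [Finset.mem_coe, Finset.mem_erase] at hq
    exact hB hq.2 (hq'.resolve_left hq.1)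

/-- The formulas of `μ_c ML` in negation normal form: the least fixpoint operators are applied to
continuous formulas, the greatest ones to their duals. -/
inductive IsNormal : MuML → Prop
  | var (q : ℕ) : IsNormal (var q)
  | nvar (q : ℕ) : IsNormal (nvar q)
  | and {φ ψ : MuML} : IsNormal φ → IsNormal ψ → IsNormal (and φ ψ)
  | or {φ ψ : MuML} : IsNormal φ → IsNormal ψ → IsNormal (or φ ψ)
  | dia {φ : MuML} : IsNormal φ → IsNormal (dia φ)
  | box {φ : MuML} : IsNormal φ → IsNormal (box φ)
  | mu {p : ℕ} {α : MuML} : IsNormal α → Cont {p} α → IsNormal (mu p α)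
  | nu {p : ℕ} {α : MuML} : IsNormal α → Cont {p} (complAux {p} α) → IsNormal (nu p α)

/-- The statement is made for all `flip B φ` since the dual of the body of a greatest fixpoint
formula in `p` is its negation with `p` negated. -/
theorem IsNormal.muC_flip {φ : MuML} (h : IsNormal φ) (B : Finset ℕ) : MuC (MuML.flip B φ) := by
  induction h generalizing B with
  | var q =>
    by_cases hq : q ∈ B
    · simpa [MuML.flip, hq, compl, complAux] using MuC.neg (MuC.var q)
    · simpa [MuML.flip, hq] using MuC.var q
  | nvar q =>
    by_cases hq : q ∈ B
    · simpa [MuML.flip, hq] using MuC.var q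
    · simpa [MuML.flip, hq, compl, complAux] using MuC.neg (MuC.var q)
  | @and φ ψ _ _ ih₁ ih₂ =>
    have := MuC.neg (.or (MuC.neg (ih₁ B)) (MuC.neg (ih₂ B)))
    change MuC (.and (MuML.flip B φ).compl.compl (MuML.flip B ψ).compl.compl) at this
    rwa [compl_compl, compl_compl] at this
  | or _ _ ih₁ ih₂ => exact .or (ih₁ B) (ih₂ B)
  | dia _ ih => exact .dia (ih B)
  | @box φ _ ih =>
    have := MuC.neg (.dia (MuC.neg (ih B)))
    change MuC (.box (MuML.flip B φ).compl.compl) at this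
    rwa [compl_compl] at this
  | @mu p α _ hc ih => exact .mu (ih _) (hc.flip (by simp))
  | @nu p α _ hc ih =>
    have hd : Disjoint ({p} : Finset ℕ) (B.erase p) := by simp
    have h₁ : MuC (complAux {p} (MuML.flip (B.erase p) α)) := by
      have := MuC.neg (ih ({p} ∪ B.erase p))
      rw [compl, complAux_flip (Finset.disjoint_empty_left _), Finset.empty_union] at this
      rwa [complAux_flip hd]
    have h₂ : Cont {p} (complAux {p} (MuML.flip (B.erase p) α)) := by
      rw [complAux_flip hd, ← flip_complAux hd]
      exact hc.flip (by simp)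
    have := MuC.neg (.mu h₁ h₂)
    change MuC (.nu p (complAux {p} (complAux {p} (MuML.flip (B.erase p) α)))) at this
    rwa [complAux_complAux] at this

theorem IsNormal.muC {φ : MuML} (h : IsNormal φ) : MuC φ :=
  flip_empty φ ▸ h.muC_flip ∅

/-- Continuity in `Q` (for `e = false`), respectively the dual property (for `e = true`). -/
def ContIn (e : Bool) (Q : Finset ℕ) (φ : MuML) : Prop :=
  Cont Q (bif e then complAux Q φ else φ)

namespace ContIn

variable {e : Bool} {Q : Finset ℕ} {φ ψ : MuML}

theorem of_free (hwf : φ.WF) (h : Disjoint (Q : Set ℕ) φ.free) : ContIn e Q φ := by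
  cases e
  · exact .free hwf h
  · exact .free (hwf.complAux Q) (by simpa [free_complAux] using h)

theorem var {q : ℕ} (h : q ∈ Q) : ContIn e Q (.var q) := by
  cases e
  · exact .var h
  · simpa [ContIn, complAux, h] using Cont.var (Finset.mem_coe.2 h)

theorem and (h₁ : ContIn e Q φ) (h₂ : ContIn e Q ψ) : ContIn e Q (.and φ ψ) := by
  cases e
  · exact Cont.and h₁ h₂
  · exact Cont.or h₁ h₂

theorem or (h₁ : ContIn e Q φ) (h₂ : ContIn e Q ψ) : ContIn e Q (.or φ ψ) := by
  cases e
  · exact Cont.or h₁ h₂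
  · exact Cont.and h₁ h₂

theorem dia (h : ContIn false Q φ) : ContIn false Q (.dia φ) := Cont.dia h

theorem box (h : ContIn true Q φ) : ContIn true Q (.box φ) := Cont.dia h

theorem fix {p : ℕ} (hp : p ∉ Q) (h : ContIn e (insert p Q) φ) : ContIn e Q (muOps.fix e p φ) := by
  cases e
  · exact Cont.mu (by simpa using hp) (by simpa [ContIn] using h)
  · exact Cont.mu (by simpa using hp) (by simpa [ContIn] using h)

end ContIn

/-! ### Syntactic properties of the translation -/

theorem bigOr_induction {P : MuML → Prop} (hor : ∀ φ ψ, P φ → P ψ → P (.or φ ψ))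
    (hbot : P muOps.bot) {l : List MuML} (h : ∀ φ ∈ l, P φ) : P (muOps.bigOr l) := by
  induction l with
  | nil => exact hbot
  | cons φ l ih => exact hor _ _ (h φ (by simp)) (ih fun ψ hψ => h ψ (by simp [hψ]))

theorem bigAnd_induction {P : MuML → Prop} (hand : ∀ φ ψ, P φ → P ψ → P (.and φ ψ))
    (htop : P muOps.top) {l : List MuML} (h : ∀ φ ∈ l, P φ) : P (muOps.bigAnd l) := by
  induction l with
  | nil => exact htop
  | cons φ l ih => exact hand _ _ (h φ (by simp)) (ih fun ψ hψ => h ψ (by simp [hψ]))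

/-- A property of formulas that is preserved by the Boolean connectives and holds for the literals
and the modal subformulas holds for the body of a fixpoint formula of the translation. -/
theorem body_induction {P : MuML → Prop} (hor : ∀ φ ψ, P φ → P ψ → P (.or φ ψ))
    (hand : ∀ φ ψ, P φ → P ψ → P (.and φ ψ)) (hbot : P muOps.bot) (htop : P muOps.top)
    {k : ℕ} (hvar : ∀ p < k, P (.var p)) (hnvar : ∀ p < k, P (.nvar p))
    {D : ℕ → DNF} {θ : ℕ → MuML}
    (hlit : ∀ j < 2 ^ k, ∀ c ∈ D j, ∀ q, Sum.inr q ∈ c → P (muOps.lit θ (.inr q))) :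
    P (muOps.body k D θ) := by
  refine bigOr_induction hor hbot fun φ hφ => ?_
  obtain ⟨j, hj, rfl⟩ := List.mem_map.1 hφ
  rw [List.mem_range] at hj
  refine hand _ _ (bigAnd_induction hand htop fun φ hφ => ?_)
    (bigOr_induction hor hbot fun φ hφ => ?_)
  · obtain ⟨p, hp, rfl⟩ := List.mem_map.1 hφ
    rw [List.mem_range] at hp
    cases j.testBit p
    · exact hnvar p hp
    · exact hvar p hp
  · obtain ⟨c, hc, rfl⟩ := List.mem_map.1 hφ
    refine bigAnd_induction hand htop fun φ hφ => ?_
    obtain ⟨q | q, hl, rfl⟩ := List.mem_map.1 hφ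
    · exact hbot
    · exact hlit j hj c hc q hl

/-- A property that is preserved by all operations on formulas carries over to the modal
subformulas. -/
theorem lit_induction {P : MuML → Prop} (hor : ∀ φ ψ, P φ → P ψ → P (.or φ ψ))
    (hand : ∀ φ ψ, P φ → P ψ → P (.and φ ψ)) (hbot : P muOps.bot) (htop : P muOps.top)
    (hdia : ∀ φ, P φ → P (.dia φ)) (hbox : ∀ φ, P φ → P (.box φ)) {θ : ℕ → MuML}
    {q : Bool × List ℕ} (h : ∀ b ∈ q.2, P (θ b)) : P (muOps.lit θ (.inr q)) := by
  obtain ⟨_ | _, S⟩ := q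
  · refine hbox _ (bigOr_induction hor hbot fun φ hφ => ?_)
    obtain ⟨b, hb, rfl⟩ := List.mem_map.1 hφ
    exact h b hb
  · refine hdia _ (bigAnd_induction hand htop fun φ hφ => ?_)
    obtain ⟨b, hb, rfl⟩ := List.mem_map.1 hφ
    exact h b hb

theorem free_bot : muOps.bot.free = ∅ := by simp [FormOps.bot, muOps, free]

theorem free_top : muOps.top.free = ∅ := by simp [FormOps.top, muOps, free]

theorem wf_bot : muOps.bot.WF := ⟨trivial, trivial⟩

theorem wf_top : muOps.top.WF := ⟨trivial, trivial⟩

theorem isNormal_bot : IsNormal muOps.bot := .mu (.var 0) (.var rfl)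

theorem isNormal_top : IsNormal muOps.top :=
  .nu (.var 0) (by simpa [muOps, complAux] using Cont.var (Q := {0}) (q := 0) rfl)

theorem ContIn.bot {e : Bool} {Q : Finset ℕ} : ContIn e Q muOps.bot :=
  .of_free wf_bot (by simp [free_bot])

theorem ContIn.top {e : Bool} {Q : Finset ℕ} : ContIn e Q muOps.top :=
  .of_free wf_top (by simp [free_top])

end MuML

theorem DNF.mem_of_mem_prune {d : DNF} {e : Bool} {p : ℕ → Bool} {c : List Lit}
    {q : Bool × List ℕ} (hc : c ∈ d.prune e p) (hq : Sum.inr q ∈ c) {b : ℕ} (hb : b ∈ q.2) :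
    d.Mentions b ∧ (q.1 = e → p b = true) := by
  obtain ⟨c, hc', rfl⟩ := List.mem_map.1 hc
  obtain ⟨q' | ⟨t, S⟩, hl, hlq⟩ := List.mem_map.1 hq
  · cases hlq
  · simp only [Lit.prune, Sum.inr.injEq] at hlq
    subst hlq
    dsimp only at hb ⊢
    split_ifs at hb with h
    · rw [List.mem_filter] at hb
      exact ⟨FO1.mentions_of_mem hc' hl hb.1, fun _ => hb.2⟩
    · exact ⟨FO1.mentions_of_mem hc' hl hb, fun h' => absurd h' h⟩

namespace Automaton

open MuML

variable {k n : ℕ} {𝔸 : Automaton k (Fin n)}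

/-- The translation yields well-formed formulas in which the variables for the states are
positive. -/
theorem formula_wf (C a : ℕ) : (𝔸.formula C a).WF ∧ ∀ c, PosIn (k + c) (𝔸.formula C a) := by
  induction C using Nat.strong_induction_on generalizing a with
  | _ C ih =>
  by_cases h : a < n ∧ C.testBit a = true
  swap
  · rw [formula_of_not_testBit h]
    exact ⟨trivial, fun _ => trivial⟩
  have hb : (𝔸.formulaBody C a).WF ∧ ∀ c, PosIn (k + c) (𝔸.formulaBody C a) := by
    have hor : ∀ φ ψ : MuML, (φ.WF ∧ ∀ c, PosIn (k + c) φ) → (ψ.WF ∧ ∀ c, PosIn (k + c) ψ) →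
        ((φ.or ψ).WF ∧ ∀ c, PosIn (k + c) (φ.or ψ)) :=
      fun φ ψ h₁ h₂ => ⟨⟨h₁.1, h₂.1⟩, fun c => ⟨h₁.2 c, h₂.2 c⟩⟩
    have hbot : muOps.bot.WF ∧ ∀ c, PosIn (k + c) muOps.bot := ⟨wf_bot, fun _ => .inr trivial⟩
    have htop : muOps.top.WF ∧ ∀ c, PosIn (k + c) muOps.top := ⟨wf_top, fun _ => .inr trivial⟩
    refine body_induction (P := fun φ => φ.WF ∧ ∀ c, PosIn (k + c) φ) hor hor hbot htop
      (fun p _ => ⟨trivial, fun _ => trivial⟩)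
      (fun p hp => ⟨trivial, fun c => show p ≠ k + c by omega⟩) fun j _ c hc q hq => ?_
    exact lit_induction (P := fun φ => φ.WF ∧ ∀ c, PosIn (k + c) φ) hor hor hbot htop
      (fun φ h => h) (fun φ h => h) fun b _ => ih _ (sub_two_pow_lt h.2) b
  rw [formula_of_testBit (a := ⟨a, h.1⟩) h.2]
  cases 𝔸.evenPriority (⟨a, h.1⟩ : Fin n)
  · exact ⟨⟨hb.2 a, hb.1⟩, fun c => .inr (hb.2 c)⟩
  · exact ⟨⟨hb.2 a, hb.1⟩, fun c => .inr (hb.2 c)⟩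

theorem free_formula_subset (C a : ℕ) :
    (𝔸.formula C a).free ⊆ {q | q < k ∨ ∃ c ∈ 𝔸.boundVars C a, q = k + c} := by
  induction C using Nat.strong_induction_on generalizing a with
  | _ C ih =>
  by_cases h : a < n ∧ C.testBit a = true
  swap
  · rw [formula_of_not_testBit h, boundVars_of_not_testBit h]
    rintro q rfl
    exact .inr ⟨a, by simp, rfl⟩
  let F : Set ℕ := {q | q < k ∨ ∃ j < 2 ^ k, ∃ b, (𝔸.normal a j).Mentions b ∧
    ∃ c ∈ 𝔸.boundVars (C - 2 ^ a) b, q = k + c}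
  have hb : (𝔸.formulaBody C a).free ⊆ F := by
    have hor : ∀ φ ψ : MuML, φ.free ⊆ F → ψ.free ⊆ F → (φ.or ψ).free ⊆ F :=
      fun φ ψ => Set.union_subset
    have hbot : muOps.bot.free ⊆ F := by simp [free_bot]
    have htop : muOps.top.free ⊆ F := by simp [free_top]
    refine body_induction (P := fun φ => φ.free ⊆ F) hor hor hbot htop
      (fun p hp => Set.singleton_subset_iff.2 (.inl hp))
      (fun p hp => Set.singleton_subset_iff.2 (.inl hp)) fun j hj c hc q hq => ?_
    refine lit_induction (P := fun φ => φ.free ⊆ F) hor hor hbot htop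
      (fun φ h => h) (fun φ h => h) fun b hb => (ih _ (sub_two_pow_lt h.2) b).trans ?_
    rintro q (hq' | hq')
    · exact .inl hq'
    · exact .inr ⟨j, hj, b, (DNF.mem_of_mem_prune hc hq hb).1, hq'⟩
  have hfree : (𝔸.formula C a).free = (𝔸.formulaBody C a).free \ {k + a} := by
    rw [formula_of_testBit (a := ⟨a, h.1⟩) h.2]
    cases 𝔸.evenPriority (⟨a, h.1⟩ : Fin n) <;> rfl
  rw [hfree, boundVars_of_testBit (a := ⟨a, h.1⟩) h.2]
  rintro q ⟨hq, hqa⟩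
  rcases hb hq with hq | ⟨j, hj, b, hb, c, hc, rfl⟩
  · exact .inl hq
  · refine .inr ⟨c, ?_, rfl⟩
    simp only [List.mem_filter, List.mem_flatMap, DNF.mem_preds, List.mem_range,
      decide_eq_true_eq]
    exact ⟨⟨j, hj, b, hb, hc⟩, fun h => hqa (by rw [h]; rfl)⟩

theorem contIn_of_boundVars_eq_nil {e : Bool} {Q : Finset ℕ} {C b : ℕ}
    (hQ : ∀ q ∈ Q, k ≤ q) (hb : (𝔸.boundVars C b).isEmpty = true) :
    ContIn e Q (𝔸.formula C b) := by
  refine .of_free (formula_wf C b).1 (Set.disjoint_left.2 fun q hq hqf => ?_)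
  rcases free_formula_subset C b hqf with h | ⟨c, hc, -⟩
  · exact absurd (hQ q hq) (by omega)
  · rw [List.isEmpty_iff.1 hb] at hc
    simp at hc

/-- If the formulas for the states in the cluster of `a` have the right kind of continuity, then so
does the body for `a`: the other states contribute formulas without state variables, and pruning
has left only such states under the modality that breaks continuity. -/
theorem contIn_formulaBody {C : ℕ} {a : Fin n} {Q : Finset ℕ} (H : 𝔸.BoundReach C a)
    (h : C.testBit a = true) (hQ : ∀ q ∈ Q, k ≤ q)
    (ih : ∀ b : Fin n, 𝔸.Leads a b → b ∈ 𝔸.cluster a →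
      ContIn (𝔸.evenPriority a) Q (𝔸.formula (C - 2 ^ (a : ℕ)) b)) :
    ContIn (𝔸.evenPriority a) Q (𝔸.formulaBody C a) := by
  have hletter : ∀ p < k, Disjoint (Q : Set ℕ) {p} := fun p hp =>
    Set.disjoint_singleton_right.2 fun hpQ => absurd (hQ p hpQ) (by omega)
  refine body_induction (P := ContIn (𝔸.evenPriority a) Q) (fun _ _ => .or) (fun _ _ => .and)
    .bot .top (fun p hp => .of_free trivial (hletter p hp))
    (fun p hp => .of_free trivial (hletter p hp)) fun j _ c hc q hq => ?_
  by_cases hqe : q.1 = 𝔸.evenPriority a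
  · -- the literal has been pruned, so that no state variable is free in it
    let P : MuML → Prop := fun φ => φ.WF ∧ Disjoint (Q : Set ℕ) φ.free
    have hor : ∀ φ ψ : MuML, P φ → P ψ → P (φ.or ψ) := fun φ ψ h₁ h₂ =>
      ⟨⟨h₁.1, h₂.1⟩, Set.disjoint_union_right.2 ⟨h₁.2, h₂.2⟩⟩
    have hP : P (muOps.lit (𝔸.formula (C - 2 ^ (a : ℕ))) (.inr q)) := by
      refine lit_induction (P := P) hor hor ⟨wf_bot, by simp [free_bot]⟩
        ⟨wf_top, by simp [free_top]⟩ (fun φ h => h) (fun φ h => h) fun b hb =>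
          ⟨(formula_wf _ b).1, Set.disjoint_left.2 fun p hp hpf => ?_⟩
      have hemp := (DNF.mem_of_mem_prune hc hq hb).2 hqe
      rcases free_formula_subset _ b hpf with h | ⟨c, hc, -⟩
      · exact absurd (hQ p hp) (by omega)
      · rw [List.isEmpty_iff.1 hemp] at hc
        simp at hc
    exact .of_free hP.1 hP.2
  · have hθ : ∀ b ∈ q.2, ContIn (𝔸.evenPriority a) Q (𝔸.formula (C - 2 ^ (a : ℕ)) b) := by
      intro b hb
      by_cases hemp : (𝔸.boundVars (C - 2 ^ (a : ℕ)) b).isEmpty = true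
      · exact contIn_of_boundVars_eq_nil hQ hemp
      · obtain ⟨b, rfl, hab⟩ := leads_of_mentions (DNF.mem_of_mem_prune hc hq hb).1
        exact ih b hab (H.mem_cluster h hab (by simpa using hemp))
    obtain ⟨_ | _, S⟩ := q
    · have he : 𝔸.evenPriority a = true := by
        cases h' : 𝔸.evenPriority a with
        | true => rfl
        | false => exact absurd h'.symm hqe
      rw [he] at hθ ⊢
      refine ContIn.box (bigOr_induction (fun _ _ => .or) .bot fun φ hφ => ?_)
      obtain ⟨b, hb, rfl⟩ := List.mem_map.1 hφ
      exact hθ b hb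
    · have he : 𝔸.evenPriority a = false := by
        cases h' : 𝔸.evenPriority a with
        | false => rfl
        | true => exact absurd h'.symm hqe
      rw [he] at hθ ⊢
      refine ContIn.dia (bigAnd_induction (fun _ _ => .and) .top fun φ hφ => ?_)
      obtain ⟨b, hb, rfl⟩ := List.mem_map.1 hφ
      exact hθ b hb

theorem contIn_formula (h𝔸 : 𝔸.IsContinuousWeak) {C : ℕ} {a : Fin n} {Q : Finset ℕ}
    (H : 𝔸.BoundReach C a) (hQ : ∀ q ∈ Q, ∃ c : Fin n, q = k + c ∧ C.testBit c = false) :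
    ContIn (𝔸.evenPriority a) Q (𝔸.formula C a) := by
  induction C using Nat.strong_induction_on generalizing a Q with
  | _ C ih =>
  by_cases h : C.testBit a = true
  swap
  · rw [formula_of_not_testBit fun h' => h h'.2]
    by_cases ha : k + (a : ℕ) ∈ Q
    · exact .var ha
    · exact .of_free trivial (Set.disjoint_singleton_right.2 ha)
  rw [formula_of_testBit h]
  have hQ' : ∀ q ∈ insert (k + (a : ℕ)) Q,
      ∃ c : Fin n, q = k + c ∧ (C - 2 ^ (a : ℕ)).testBit c = false := by
    intro q hq
    rcases Finset.mem_insert.1 hq with rfl | hq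
    · exact ⟨a, rfl, by rw [testBit_sub_two_pow h]; simp⟩
    · obtain ⟨c, rfl, hc⟩ := hQ q hq
      exact ⟨c, rfl, by rw [testBit_sub_two_pow h, hc]; rfl⟩
  refine ContIn.fix (fun ha => ?_) (contIn_formulaBody H h (fun q hq => ?_) fun b hab hb => ?_)
  · obtain ⟨c, hc, hcC⟩ := hQ _ ha
    rw [Fin.ext (Nat.add_left_cancel hc), hcC] at h
    exact Bool.false_ne_true h
  · obtain ⟨c, rfl, -⟩ := hQ' q hq
    exact Nat.le_add_right k c
  · have he : 𝔸.evenPriority b = 𝔸.evenPriority a := by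
      simp [evenPriority, (h𝔸 a b hb.1 hb.2).1]
    rw [← he]
    exact ih _ (sub_two_pow_lt h) (H.reach h hab) hQ'

theorem isNormal_formula (h𝔸 : 𝔸.IsContinuousWeak) {C : ℕ} {a : Fin n}
    (H : 𝔸.BoundReach C a) : IsNormal (𝔸.formula C a) := by
  induction C using Nat.strong_induction_on generalizing a with
  | _ C ih =>
  by_cases h : C.testBit a = true
  swap
  · rw [formula_of_not_testBit fun h' => h h'.2]
    exact .var _
  have hb : IsNormal (𝔸.formulaBody C a) := by
    refine body_induction (fun _ _ => .or) (fun _ _ => .and) isNormal_bot isNormal_top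
      (fun p _ => .var p) (fun p _ => .nvar p) fun j _ c hc q hq => ?_
    refine lit_induction (fun _ _ => .or) (fun _ _ => .and) isNormal_bot isNormal_top
      (fun _ => .dia) (fun _ => .box) fun b hb => ?_
    obtain ⟨b, rfl, hab⟩ := leads_of_mentions (DNF.mem_of_mem_prune hc hq hb).1
    exact ih _ (sub_two_pow_lt h) (H.reach h hab)
  have hc : ContIn (𝔸.evenPriority a) {k + (a : ℕ)} (𝔸.formulaBody C a) := by
    refine contIn_formulaBody H h (by simp) fun b hab hb => ?_
    have he : 𝔸.evenPriority b = 𝔸.evenPriority a := by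
      simp [evenPriority, (h𝔸 a b hb.1 hb.2).1]
    rw [← he]
    refine contIn_formula h𝔸 (H.reach h hab) fun q hq => ⟨a, by simpa using hq, ?_⟩
    rw [testBit_sub_two_pow h]
    simp
  rw [formula_of_testBit h]
  cases he : 𝔸.evenPriority a
  · rw [he] at hc
    exact .mu hb (by simpa [ContIn] using hc)
  · rw [he] at hc
    exact .nu hb (by simpa [ContIn] using hc)

theorem testBit_all (c : Fin n) : (2 ^ n - 1).testBit c = true := by
  rw [Nat.testBit_two_pow_sub_one]
  simp

theorem free_formula_init : (𝔸.formula (2 ^ n - 1) 𝔸.init).free ⊆ {p | p < k} := by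
  intro q hq
  rcases free_formula_subset _ _ hq with h | ⟨c, hc, -⟩
  · exact h
  · obtain ⟨c, rfl, hcC, -⟩ := reach_of_mem_boundVars hc
    rw [testBit_all] at hcC
    cases hcC

theorem muC_formula_init (h𝔸 : 𝔸.IsContinuousWeak) : (𝔸.formula (2 ^ n - 1) 𝔸.init).MuC :=
  (isNormal_formula h𝔸 fun c hc => by simp at hc).muC

end Automaton

end ModalMu

/-! ### Computability of the translation -/

namespace ModalMu

/-- The list of the first `m` values of the function that is defined by course-of-values recursion
with `g`. -/
def valueTable {σ : Type*} (g : List σ → σ) : ℕ → List σ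
  | 0 => []
  | m + 1 => valueTable g m ++ [g (valueTable g m)]

section

variable {σ : Type*} {g : List σ → σ}

theorem length_valueTable (m : ℕ) : (valueTable g m).length = m := by
  induction m with
  | zero => rfl
  | succ m ih => simp [valueTable, ih]

theorem valueTable_getElem? {m i : ℕ} (h : i < m) :
    (valueTable g m)[i]? = some (g (valueTable g i)) := by
  induction m with
  | zero => omega
  | succ m ih =>
    rw [valueTable]
    by_cases hi : i < m
    · rw [List.getElem?_append_left (by rwa [length_valueTable]), ih hi]
    · have : i = m := by omega
      subst this
      rw [List.getElem?_append_right (by rw [length_valueTable])]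
      simp [length_valueTable]

end

/-- One step of the computation of normal forms from Gödel numbers, given the normal forms for
smaller numbers. -/
def normalStep (l : List (DNF × DNF)) : DNF × DNF :=
  let t := (l.length - 1).unpair.1
  let m := (l.length - 1).unpair.2
  let get i := l.getD i ([], [])
  if l.length = 0 then ([], [])
  else if t = 0 then ([[.inl m.unpair]], [])
  else if t = 1 then ([[]], [])
  else if t = 2 then ([], [[]])
  else if t = 3 then ((get m).2, (get m).1)
  else if t = 4 then
    ((get m.unpair.1).1.and (get m.unpair.2).1, (get m.unpair.1).2 ++ (get m.unpair.2).2)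
  else if t = 5 then
    ((get m.unpair.1).1 ++ (get m.unpair.2).1, (get m.unpair.1).2.and (get m.unpair.2).2)
  else if t = 6 then
    ((get m.unpair.2).1.ex m.unpair.1, (get m.unpair.2).2.all m.unpair.1)
  else ((get m.unpair.2).1.all m.unpair.1, (get m.unpair.2).2.ex m.unpair.1)

/-- The normal forms for a Gödel number. -/
def normalOfCode (c : ℕ) : DNF × DNF := normalStep (valueTable normalStep c)

theorem valueTable_normalStep_getD {m i : ℕ} (h : i < m) :
    (valueTable normalStep m).getD i ([], []) = normalOfCode i := by
  rw [List.getD_eq_getElem?_getD, valueTable_getElem? h]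
  rfl

theorem normalOfCode_code {n : ℕ} (φ : FO1 (Fin n)) : normalOfCode φ.code = φ.normalForm := by
  have lt₂ : ∀ t m, m < Nat.pair t m + 1 := fun t m => Nat.lt_succ_of_le (Nat.right_le_pair t m)
  have ltl : ∀ t i j, i < Nat.pair t (Nat.pair i j) + 1 := fun t i j =>
    (Nat.left_le_pair i j).trans_lt (lt₂ t _)
  have ltr : ∀ t i j, j < Nat.pair t (Nat.pair i j) + 1 := fun t i j =>
    (Nat.right_le_pair i j).trans_lt (lt₂ t _)
  induction φ with
  | atom a x =>
    simp [FO1.code, normalOfCode, normalStep, length_valueTable, FO1.normalForm]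
  | top => simp [FO1.code, normalOfCode, normalStep, length_valueTable, FO1.normalForm]
  | bot => simp [FO1.code, normalOfCode, normalStep, length_valueTable, FO1.normalForm]
  | neg φ ih =>
    rw [FO1.normalForm, ← ih, FO1.code, normalOfCode, normalStep]
    simp only [length_valueTable, Nat.add_sub_cancel, Nat.unpair_pair]
    rw [valueTable_normalStep_getD (lt₂ _ _)]
    simp
  | and φ ψ ih₁ ih₂ =>
    rw [FO1.normalForm, ← ih₁, ← ih₂, FO1.code, normalOfCode, normalStep]
    simp only [length_valueTable, Nat.add_sub_cancel, Nat.unpair_pair]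
    rw [valueTable_normalStep_getD (ltl _ _ _), valueTable_normalStep_getD (ltr _ _ _)]
    simp
  | or φ ψ ih₁ ih₂ =>
    rw [FO1.normalForm, ← ih₁, ← ih₂, FO1.code, normalOfCode, normalStep]
    simp only [length_valueTable, Nat.add_sub_cancel, Nat.unpair_pair]
    rw [valueTable_normalStep_getD (ltl _ _ _), valueTable_normalStep_getD (ltr _ _ _)]
    simp
  | ex x φ ih =>
    rw [FO1.normalForm, ← ih, FO1.code, normalOfCode, normalStep]
    simp only [length_valueTable, Nat.add_sub_cancel, Nat.unpair_pair]
    rw [valueTable_normalStep_getD (ltr _ _ _)]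
    simp
  | all x φ ih =>
    rw [FO1.normalForm, ← ih, FO1.code, normalOfCode, normalStep]
    simp only [length_valueTable, Nat.add_sub_cancel, Nat.unpair_pair]
    rw [valueTable_normalStep_getD (ltr _ _ _)]
    simp

/-- The operations on Gödel numbers of formulas. -/
def natOps : FormOps ℕ where
  var q := Nat.pair 0 q + 1
  nvar q := Nat.pair 1 q + 1
  and x y := Nat.pair 2 (Nat.pair x y) + 1
  or x y := Nat.pair 3 (Nat.pair x y) + 1
  dia x := Nat.pair 4 x + 1
  box x := Nat.pair 5 x + 1
  mu p x := Nat.pair 6 (Nat.pair p x) + 1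
  nu p x := Nat.pair 7 (Nat.pair p x) + 1

theorem code_bigOr (l : List MuML) : (muOps.bigOr l).code = natOps.bigOr (l.map MuML.code) := by
  induction l with
  | nil => rfl
  | cons φ l ih => exact congrArg (natOps.or φ.code) ih

theorem code_bigAnd (l : List MuML) :
    (muOps.bigAnd l).code = natOps.bigAnd (l.map MuML.code) := by
  induction l with
  | nil => rfl
  | cons φ l ih => exact congrArg (natOps.and φ.code) ih

theorem code_lit (θ : ℕ → MuML) (l : Lit) :
    (muOps.lit θ l).code = natOps.lit (fun b => (θ b).code) l := by
  rcases l with q | ⟨_ | _, S⟩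
  · rfl
  · have := congrArg natOps.box (code_bigOr (S.map θ))
    rwa [List.map_map] at this
  · have := congrArg natOps.dia (code_bigAnd (S.map θ))
    rwa [List.map_map] at this

theorem code_body (k : ℕ) (D : ℕ → DNF) (θ : ℕ → MuML) :
    (muOps.body k D θ).code = natOps.body k D fun b => (θ b).code := by
  have hcol : ∀ j, (muOps.color k j).code = natOps.color k j := by
    intro j
    rw [FormOps.color, code_bigAnd, List.map_map, FormOps.color]
    congr 1
    refine List.map_congr_left fun p _ => ?_
    dsimp only [Function.comp]
    cases j.testBit p <;> rfl
  have hdnf : ∀ d, (muOps.dnf θ d).code = natOps.dnf (fun b => (θ b).code) d := by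
    intro d
    rw [FormOps.dnf, code_bigOr, List.map_map, FormOps.dnf]
    congr 1
    refine List.map_congr_left fun c _ => ?_
    rw [Function.comp, code_bigAnd, List.map_map]
    congr 1
    exact List.map_congr_left fun l _ => code_lit θ l
  rw [FormOps.body, code_bigOr, List.map_map, FormOps.body]
  congr 1
  refine List.map_congr_left fun j _ => ?_
  rw [← hcol, ← hdnf]
  rfl

theorem FormOps.body_congr {X : Type} (M : FormOps X) {k : ℕ} {D D' : ℕ → DNF}
    (h : ∀ j < 2 ^ k, D j = D' j) (θ : ℕ → X) : M.body k D θ = M.body k D' θ := by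
  unfold FormOps.body
  congr 1
  refine List.map_congr_left fun j hj => ?_
  rw [h j (List.mem_range.1 hj)]

/-- The translation commutes with coding. -/
theorem trans_natOps {k n : ℕ} {even even' : ℕ → Bool} {D D' : ℕ → ℕ → DNF}
    (he : ∀ a < n, even a = even' a) (hD : ∀ a < n, ∀ j < 2 ^ k, D a j = D' a j) (C a : ℕ) :
    trans natOps k n even D C a =
      ((trans muOps k n even' D' C a).1.code, (trans muOps k n even' D' C a).2) := by
  induction C using Nat.strong_induction_on generalizing a with
  | _ C ih =>
  rw [trans, trans.eq_1 muOps]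
  split_ifs with h
  · have ih' := ih _ (Automaton.sub_two_pow_lt h.2)
    simp only [ih', he a h.1]
    refine Prod.ext ?_ ?_
    · have hbody := natOps.body_congr (k := k)
        (D := fun j => (D a j).prune (even' a) fun b =>
          (trans muOps k n even' D' (C - 2 ^ a) b).2.isEmpty)
        (D' := fun j => (D' a j).prune (even' a) fun b =>
          (trans muOps k n even' D' (C - 2 ^ a) b).2.isEmpty)
        (fun j hj => by rw [hD a h.1 j hj])
        (fun b => (trans muOps k n even' D' (C - 2 ^ a) b).1.code)
      dsimp only
      rw [hbody, ← code_body]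
      cases even' a <;> rfl
    · dsimp only
      congr 1
      refine List.flatMap_congr fun j hj => ?_
      rw [hD a h.1 j (List.mem_range.1 hj)]
  · rfl

/-- The type of the finite presentations of automata. -/
abbrev AutData : Type := ℕ × ℕ × ℕ × List ℕ × List (List ℕ)

namespace AutData

/-- Whether the priority of the state `a` is even. -/
def even (d : AutData) (a : ℕ) : Bool := decide (d.2.2.2.1.getD a 0 % 2 = 0)

/-- The normal form of the transition condition for the state `a` and the colour `j`. -/
def normal (d : AutData) (a j : ℕ) : DNF := (normalOfCode ((d.2.2.2.2.getD a []).getD j 0)).1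

/-- The entry for the state `b` in a row of the table of formulas. -/
def entry (d : AutData) (r : List (ℕ × List ℕ)) (b : ℕ) : ℕ × List ℕ :=
  r.getD b (natOps.var (d.1 + b), [b])

/-- The entry for an unbound state `a`, given the row `r` in which `a` is bound. -/
def unboundEntry (d : AutData) (r : List (ℕ × List ℕ)) (a : ℕ) : ℕ × List ℕ :=
  (natOps.fix (d.even a) (d.1 + a) (natOps.body d.1
      (fun j => (d.normal a j).prune (d.even a) fun b => (d.entry r b).2.isEmpty)
      fun b => (d.entry r b).1),
    ((List.range (2 ^ d.1)).flatMap fun j => (d.normal a j).preds.flatMap fun b =>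
      (d.entry r b).2).filter (· ≠ a))

/-- One step of the computation of the table of formulas, which has a row for each set `C` of unbound
states: the row number `l.length`, given the list `l` of the earlier rows. -/
def tableStep (d : AutData) (l : List (List (ℕ × List ℕ))) : List (ℕ × List ℕ) :=
  (List.range d.2.1).map fun a =>
    bif l.length.testBit a then d.unboundEntry (l.getD (l.length - 2 ^ a) []) a
    else (natOps.var (d.1 + a), [a])

theorem entry_map_range (d : AutData) (even : ℕ → Bool) (D : ℕ → ℕ → DNF) (C b : ℕ) :
    d.entry ((List.range d.2.1).map (trans natOps d.1 d.2.1 even D C)) b =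
      trans natOps d.1 d.2.1 even D C b := by
  rw [entry, List.getD_eq_getElem?_getD, List.getElem?_map]
  by_cases hb : b < d.2.1
  · simp [hb]
  · rw [List.getElem?_eq_none (by simpa using hb), trans, dif_neg fun h => hb h.1]
    rfl

theorem tableStep_valueTable (d : AutData) (C : ℕ) : d.tableStep (valueTable d.tableStep C) =
    (List.range d.2.1).map (trans natOps d.1 d.2.1 d.even d.normal C) := by
  induction C using Nat.strong_induction_on with
  | _ C ih =>
  rw [tableStep]
  refine List.map_congr_left fun a ha => ?_
  rw [List.mem_range] at ha
  rw [trans, length_valueTable]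
  by_cases h : C.testBit a = true
  · have hlt := Automaton.sub_two_pow_lt h
    rw [dif_pos ⟨ha, h⟩, List.getD_eq_getElem?_getD, valueTable_getElem? hlt, ih _ hlt]
    simp only [h, Option.getD_some, unboundEntry, entry_map_range, cond_true]
  · rw [dif_neg fun h' => h h'.2]
    simp only [Bool.not_eq_true] at h
    rw [h, cond_false]

/-- The Gödel number of the formula for the automaton. -/
def translate (d : AutData) : ℕ :=
  (d.entry (d.tableStep (valueTable d.tableStep (2 ^ d.2.1 - 1))) d.2.2.1).1

theorem translate_data {k n : ℕ} (𝔸 : Automaton k (Fin n)) :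
    translate 𝔸.data = (𝔸.formula (2 ^ n - 1) 𝔸.init).code := by
  have he : ∀ a < n, even 𝔸.data a = 𝔸.evenPriority a := by
    intro a ha
    simp [even, Automaton.data, Automaton.evenPriority, List.getD_eq_getElem?_getD, ha]
  have hD : ∀ a < n, ∀ j < 2 ^ k, normal 𝔸.data a j = 𝔸.normal a j := by
    intro a ha j hj
    simp only [normal, Automaton.data, List.getD_eq_getElem?_getD, List.getElem?_ofFn, ha, hj,
      dif_pos, Option.getD_some]
    rw [normalOfCode_code, Automaton.normal, dif_pos ha]
    rfl
  rw [translate, tableStep_valueTable, entry_map_range]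
  exact congrArg Prod.fst (trans_natOps he hD _ _)

end AutData

end ModalMu

namespace ModalMu

section Primrec

variable {α β γ σ : Type*} [Primcodable α] [Primcodable β] [Primcodable γ] [Primcodable σ]

theorem primrec_valueTable {g : α → List σ → σ} (hg : Primrec₂ g) {f : α → ℕ} (hf : Primrec f) :
    Primrec fun x => valueTable (g x) (f x) := by
  refine (Primrec.nat_rec' (h := fun x p => p.2 ++ [g x p.2]) hf (Primrec.const [])
    (Primrec.list_concat.comp (Primrec.snd.comp Primrec.snd)
      (hg.comp Primrec.fst (Primrec.snd.comp Primrec.snd)))).of_eq fun x => ?_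
  induction f x with
  | zero => rfl
  | succ m ih => rw [ModalMu.valueTable, ← ih]

theorem primrec_listFilterBool {f : α → List β} {p : α → β → Bool} (hf : Primrec f)
    (hp : Primrec₂ p) : Primrec fun x => (f x).filter (p x) := by
  have : Primrec₂ fun (x : α) (b : β) => bif p x b then [b] else [] :=
    Primrec.cond hp (Primrec.list_cons.comp Primrec.snd (Primrec.const [])) (Primrec.const [])
  refine (Primrec.list_flatMap hf this).of_eq fun x => ?_
  induction f x with
  | nil => rfl
  | cons b l ih =>
    rw [List.flatMap_cons, ih, List.filter_cons]
    cases p x b <;> rfl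

theorem primrec_choices : Primrec (choices : List (List α) → List (List α)) := by
  have h₁ : Primrec₂ fun (p : (List (List α) × List α × List (List α)) × α) (r : List α) =>
      p.2 :: r :=
    Primrec.list_cons.comp (Primrec.snd.comp Primrec.fst) Primrec.snd
  have h₂ : Primrec₂ fun (p : List (List α) × List α × List (List α)) (x : α) =>
      p.2.2.map (x :: ·) :=
    Primrec.list_map (Primrec.snd.comp (Primrec.snd.comp Primrec.fst)) h₁
  exact Primrec.list_foldr Primrec.id (Primrec.const [[]])
    (Primrec.list_flatMap (Primrec.fst.comp (Primrec.snd (α := List (List α)))) h₂).to₂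

theorem primrec_quantify (b : Bool) : Primrec₂ (quantify b) := by
  have hx : Primrec fun p : (ℕ × List Lit) × Lit => p.1.1 := Primrec.fst.comp Primrec.fst
  have heq : PrimrecPred fun q : ((ℕ × List Lit) × Lit) × (ℕ × ℕ) => q.2.2 = q.1.1.1 :=
    Primrec.eq.comp (Primrec.snd.comp Primrec.snd) (hx.comp Primrec.fst)
  have h₁ : Primrec fun p : ℕ × List Lit => atomsAt p.1 p.2 := by
    have : Primrec₂ fun (p : ℕ × List Lit) (l : Lit) =>
        (Sum.casesOn l (fun q => if q.2 = p.1 then [q.1] else []) fun _ => [] : List ℕ) :=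
      Primrec.sumCasesOn Primrec.snd
        (Primrec.ite heq (Primrec.list_cons.comp (Primrec.fst.comp Primrec.snd) (Primrec.const []))
          (Primrec.const []))
        (Primrec.const [])
    refine (Primrec.list_flatMap Primrec.snd this).of_eq fun p => ?_
    unfold atomsAt
    congr 1
    ext l : 1
    rcases l with q | q <;> rfl
  have h₂ : Primrec fun p : ℕ × List Lit => litsOff p.1 p.2 := by
    have : Primrec₂ fun (p : ℕ × List Lit) (l : Lit) =>
        (Sum.casesOn l (fun q => if q.2 = p.1 then [] else [.inl q]) fun q => [.inr q] :
          List Lit) :=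
      Primrec.sumCasesOn Primrec.snd
        (Primrec.ite heq (Primrec.const [])
          (Primrec.list_cons.comp (Primrec.sumInl.comp Primrec.snd) (Primrec.const [])))
        (Primrec.list_cons.comp (Primrec.sumInr.comp Primrec.snd) (Primrec.const []))
    refine (Primrec.list_flatMap Primrec.snd this).of_eq fun p => ?_
    unfold litsOff
    congr 1
    ext l : 1
    rcases l with q | q <;> rfl
  exact Primrec.list_cons.comp (Primrec.sumInr.comp (Primrec.pair (Primrec.const b) h₁)) h₂

theorem primrec_dnfAnd : Primrec₂ DNF.and := by
  have h₁ : Primrec₂ fun (p : (DNF × DNF) × List Lit) (c : List Lit) => p.2 ++ c :=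
    Primrec.list_append.comp (Primrec.snd.comp Primrec.fst) Primrec.snd
  exact Primrec.list_flatMap Primrec.fst
    (Primrec.list_map (Primrec.snd.comp Primrec.fst) h₁)

theorem primrec_dnfEx : Primrec₂ DNF.ex :=
  Primrec.list_map Primrec.snd
    ((primrec_quantify true).comp (Primrec.fst.comp Primrec.fst) Primrec.snd)

theorem primrec_dnfAll : Primrec₂ DNF.all :=
  primrec_choices.comp (Primrec.list_map (primrec_choices.comp Primrec.snd)
    ((primrec_quantify false).comp (Primrec.fst.comp Primrec.fst) Primrec.snd))

theorem primrec_normalStep : Primrec normalStep := by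
  have hl : Primrec fun l : List (DNF × DNF) => l.length := Primrec.list_length
  have hu : Primrec fun l : List (DNF × DNF) => (l.length - 1).unpair :=
    Primrec.unpair.comp (Primrec.nat_sub.comp hl (Primrec.const 1))
  have ht := Primrec.fst.comp hu
  have hm := Primrec.snd.comp hu
  have hm' := Primrec.unpair.comp hm
  have hget : ∀ {f : List (DNF × DNF) → ℕ}, Primrec f →
      Primrec fun l : List (DNF × DNF) => l.getD (f l) (([], []) : DNF × DNF) := fun hf =>
    (Primrec.list_getD _).comp Primrec.id hf
  have hm₁ := Primrec.fst.comp hm'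
  have hm₂ := Primrec.snd.comp hm'
  have g := hget hm
  have g₁ := hget hm₁
  have g₂ := hget hm₂
  have ht' : ∀ i : ℕ, PrimrecPred fun l : List (DNF × DNF) => (l.length - 1).unpair.1 = i :=
    fun i => Primrec.eq.comp ht (Primrec.const i)
  have hatom : Primrec fun l : List (DNF × DNF) =>
      (([[.inl (l.length - 1).unpair.2.unpair]], []) : DNF × DNF) :=
    Primrec.pair (Primrec.list_cons.comp
      (Primrec.list_cons.comp (Primrec.sumInl.comp hm') (Primrec.const [])) (Primrec.const []))
      (Primrec.const [])
  unfold ModalMu.normalStep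
  refine Primrec.ite (Primrec.eq.comp hl (Primrec.const 0)) (Primrec.const _) ?_
  refine Primrec.ite (ht' 0) hatom ?_
  refine Primrec.ite (ht' 1) (Primrec.const _) ?_
  refine Primrec.ite (ht' 2) (Primrec.const _) ?_
  refine Primrec.ite (ht' 3) (Primrec.pair (Primrec.snd.comp g) (Primrec.fst.comp g)) ?_
  refine Primrec.ite (ht' 4) (Primrec.pair
    (primrec_dnfAnd.comp (Primrec.fst.comp g₁) (Primrec.fst.comp g₂))
    (Primrec.list_append.comp (Primrec.snd.comp g₁) (Primrec.snd.comp g₂))) ?_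
  refine Primrec.ite (ht' 5) (Primrec.pair
    (Primrec.list_append.comp (Primrec.fst.comp g₁) (Primrec.fst.comp g₂))
    (primrec_dnfAnd.comp (Primrec.snd.comp g₁) (Primrec.snd.comp g₂))) ?_
  exact Primrec.ite (ht' 6)
    (Primrec.pair (primrec_dnfEx.comp hm₁ (Primrec.fst.comp g₂))
      (primrec_dnfAll.comp hm₁ (Primrec.snd.comp g₂)))
    (Primrec.pair (primrec_dnfAll.comp hm₁ (Primrec.fst.comp g₂))
      (primrec_dnfEx.comp hm₁ (Primrec.snd.comp g₂)))

theorem primrec_normalOfCode : Primrec normalOfCode :=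
  primrec_normalStep.comp
    (primrec_valueTable (primrec_normalStep.comp Primrec.snd).to₂ Primrec.id)

theorem primrec_natPairTag (t : ℕ) {f : α → ℕ} (hf : Primrec f) :
    Primrec fun x => Nat.pair t (f x) + 1 :=
  Primrec.succ.comp (Primrec₂.natPair.comp (Primrec.const t) hf)

theorem primrec_natBigOr {f : α → List ℕ} (hf : Primrec f) :
    Primrec fun x => natOps.bigOr (f x) :=
  Primrec.list_foldr hf (Primrec.const natOps.bot)
    (primrec_natPairTag 3 (Primrec₂.natPair.comp (Primrec.fst.comp Primrec.snd)
      (Primrec.snd.comp Primrec.snd))).to₂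

theorem primrec_natBigAnd {f : α → List ℕ} (hf : Primrec f) :
    Primrec fun x => natOps.bigAnd (f x) :=
  Primrec.list_foldr hf (Primrec.const natOps.top)
    (primrec_natPairTag 2 (Primrec₂.natPair.comp (Primrec.fst.comp Primrec.snd)
      (Primrec.snd.comp Primrec.snd))).to₂

theorem primrec_nat_pow : Primrec₂ ((· ^ ·) : ℕ → ℕ → ℕ) :=
  Primrec₂.unpaired'.1 Nat.Primrec.pow

theorem primrec_testBit : Primrec₂ Nat.testBit := by
  have : PrimrecPred fun p : ℕ × ℕ => p.1 / 2 ^ p.2 % 2 = 1 :=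
    Primrec.eq.comp (Primrec.nat_mod.comp (Primrec.nat_div.comp Primrec.fst
      (primrec_nat_pow.comp (Primrec.const 2) Primrec.snd)) (Primrec.const 2)) (Primrec.const 1)
  exact this.decide.of_eq fun p => Nat.testBit_eq_decide_div_mod_eq.symm

theorem primrec_natColor : Primrec₂ natOps.color := by
  have : Primrec₂ fun (q : ℕ × ℕ) (p : ℕ) =>
      bif q.2.testBit p then natOps.var p else natOps.nvar p :=
    Primrec.cond (primrec_testBit.comp (Primrec.snd.comp Primrec.fst) Primrec.snd)
      (primrec_natPairTag 0 Primrec.snd) (primrec_natPairTag 1 Primrec.snd)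
  exact primrec_natBigAnd (Primrec.list_map (Primrec.list_range.comp Primrec.fst) this)

theorem primrec_natLit {θ : α → ℕ → ℕ} (hθ : Primrec₂ θ) {l : α → Lit} (hl : Primrec l) :
    Primrec fun x => natOps.lit (θ x) (l x) := by
  have hmap : Primrec fun p : α × Bool × List ℕ => p.2.2.map (θ p.1) :=
    Primrec.list_map (Primrec.snd.comp Primrec.snd)
      (hθ.comp (Primrec.fst.comp Primrec.fst) Primrec.snd)
  have : Primrec fun x => (Sum.casesOn (l x) (fun _ => natOps.bot) fun q =>
      bif q.1 then natOps.dia (natOps.bigAnd (q.2.map (θ x)))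
      else natOps.box (natOps.bigOr (q.2.map (θ x))) : ℕ) :=
    Primrec.sumCasesOn hl (Primrec.const _) (Primrec.cond (Primrec.fst.comp Primrec.snd)
      (primrec_natPairTag 4 (primrec_natBigAnd hmap)) (primrec_natPairTag 5 (primrec_natBigOr hmap)))
  refine this.of_eq fun x => ?_
  rcases l x with q | ⟨_ | _, S⟩ <;> rfl

theorem primrec_natDnf {θ : α → ℕ → ℕ} (hθ : Primrec₂ θ) {d : α → DNF} (hd : Primrec d) :
    Primrec fun x => natOps.dnf (θ x) (d x) := by
  have h₁ : Primrec₂ fun (p : α × List Lit) (l : Lit) => natOps.lit (θ p.1) l :=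
    primrec_natLit (θ := fun (q : (α × List Lit) × Lit) b => θ q.1.1 b)
      (hθ.comp (Primrec.fst.comp (Primrec.fst.comp Primrec.fst)) Primrec.snd) Primrec.snd
  exact primrec_natBigOr (Primrec.list_map hd
    (primrec_natBigAnd (Primrec.list_map Primrec.snd h₁)).to₂)

theorem primrec_dnfPrune {e : α → Bool} (he : Primrec e) {p : α → ℕ → Bool} (hp : Primrec₂ p)
    {d : α → DNF} (hd : Primrec d) : Primrec fun x => (d x).prune (e x) (p x) := by
  have hlit : Primrec₂ fun (x : α) (l : Lit) => l.prune (e x) (p x) := by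
    have hfilter : Primrec fun q : (α × Lit) × Bool × List ℕ => q.2.2.filter (p q.1.1) :=
      primrec_listFilterBool (Primrec.snd.comp Primrec.snd)
        (hp.comp (Primrec.fst.comp (Primrec.fst.comp Primrec.fst)) Primrec.snd)
    have heq : PrimrecPred fun q : (α × Lit) × Bool × List ℕ => q.2.1 = e q.1.1 :=
      Primrec.eq.comp (Primrec.fst.comp Primrec.snd) (he.comp (Primrec.fst.comp Primrec.fst))
    have : Primrec₂ fun (x : α) (l : Lit) => (Sum.casesOn l (fun q => .inl q) fun q =>
        .inr (q.1, if q.1 = e x then q.2.filter (p x) else q.2) : Lit) :=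
      Primrec.sumCasesOn Primrec.snd (Primrec.sumInl.comp Primrec.snd)
        (Primrec.sumInr.comp (Primrec.pair (Primrec.fst.comp Primrec.snd)
          (Primrec.ite heq hfilter (Primrec.snd.comp Primrec.snd))))
    refine this.of_eq fun x l => ?_
    rcases l with q | q <;> rfl
  exact Primrec.list_map hd (Primrec.list_map Primrec.snd
    (hlit.comp (Primrec.fst.comp Primrec.fst) Primrec.snd).to₂).to₂

theorem primrec_natBody {k : α → ℕ} (hk : Primrec k) {D : α → ℕ → DNF} (hD : Primrec₂ D)
    {θ : α → ℕ → ℕ} (hθ : Primrec₂ θ) : Primrec fun x => natOps.body (k x) (D x) (θ x) := by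
  have h₁ : Primrec fun p : α × ℕ => natOps.dnf (θ p.1) (D p.1 p.2) :=
    primrec_natDnf (θ := fun (p : α × ℕ) b => θ p.1 b)
      (hθ.comp (Primrec.fst.comp Primrec.fst) Primrec.snd) hD
  have h₂ : Primrec₂ fun (x : α) (j : ℕ) =>
      natOps.and (natOps.color (k x) j) (natOps.dnf (θ x) (D x j)) :=
    primrec_natPairTag 2 (Primrec₂.natPair.comp
      (primrec_natColor.comp (hk.comp Primrec.fst) Primrec.snd) h₁)
  exact primrec_natBigOr (Primrec.list_map
    (Primrec.list_range.comp (primrec_nat_pow.comp (Primrec.const 2) hk)) h₂)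

theorem primrec_dnfPreds : Primrec DNF.preds := by
  have : Primrec Lit.preds := by
    have : Primrec fun l : Lit => (Sum.casesOn l (fun q => [q.1]) fun q => q.2 : List ℕ) :=
      Primrec.sumCasesOn Primrec.id
        (Primrec.list_cons.comp (Primrec.fst.comp Primrec.snd) (Primrec.const []))
        (Primrec.snd.comp Primrec.snd)
    exact this.of_eq fun l => by rcases l with q | q <;> rfl
  exact Primrec.list_flatMap Primrec.id
    (Primrec.list_flatMap Primrec.snd (this.comp Primrec.snd).to₂).to₂

theorem primrec_listIsEmpty : Primrec (List.isEmpty : List β → Bool) := by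
  have : PrimrecPred fun l : List β => l.length = 0 :=
    Primrec.eq.comp Primrec.list_length (Primrec.const 0)
  exact this.decide.of_eq fun l => by cases l <;> rfl

namespace AutData

theorem primrec_even : Primrec₂ even := by
  have : PrimrecPred fun p : AutData × ℕ => p.1.2.2.2.1.getD p.2 0 % 2 = 0 :=
    Primrec.eq.comp (Primrec.nat_mod.comp ((Primrec.list_getD 0).comp
      (Primrec.fst.comp (Primrec.snd.comp (Primrec.snd.comp (Primrec.snd.comp Primrec.fst))))
      Primrec.snd) (Primrec.const 2)) (Primrec.const 0)
  exact this.decide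

theorem primrec_normal {d : α → AutData} (hd : Primrec d) {a j : α → ℕ} (ha : Primrec a)
    (hj : Primrec j) : Primrec fun x => normal (d x) (a x) (j x) := by
  have ht : Primrec fun x => (d x).2.2.2.2 :=
    Primrec.snd.comp (Primrec.snd.comp (Primrec.snd.comp (Primrec.snd.comp hd)))
  have hc : Primrec fun x => ((d x).2.2.2.2.getD (a x) []).getD (j x) 0 :=
    (Primrec.list_getD 0).comp ((Primrec.list_getD []).comp ht ha) hj
  exact Primrec.fst.comp (primrec_normalOfCode.comp hc)

theorem primrec_var {d : α → AutData} (hd : Primrec d) {b : α → ℕ} (hb : Primrec b) :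
    Primrec fun x => (natOps.var ((d x).1 + b x), [b x]) :=
  Primrec.pair (primrec_natPairTag 0 (Primrec.nat_add.comp (Primrec.fst.comp hd) hb))
    (Primrec.list_cons.comp hb (Primrec.const []))

theorem primrec_entry {d : α → AutData} (hd : Primrec d) {r : α → List (ℕ × List ℕ)}
    (hr : Primrec r) {b : α → ℕ} (hb : Primrec b) :
    Primrec fun x => entry (d x) (r x) (b x) := by
  refine (Primrec.option_getD.comp (Primrec.list_getElem?.comp hr hb)
    (primrec_var hd hb)).of_eq fun x => ?_
  rw [entry, List.getD_eq_getElem?_getD]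

theorem primrec_fix {e : α → Bool} (he : Primrec e) {p φ : α → ℕ} (hp : Primrec p)
    (hφ : Primrec φ) : Primrec fun x => natOps.fix (e x) (p x) (φ x) :=
  Primrec.cond he (primrec_natPairTag 7 (Primrec₂.natPair.comp hp hφ))
    (primrec_natPairTag 6 (Primrec₂.natPair.comp hp hφ))

theorem primrec_unboundEntry {d : α → AutData} (hd : Primrec d) {r : α → List (ℕ × List ℕ)}
    (hr : Primrec r) {a : α → ℕ} (ha : Primrec a) :
    Primrec fun x => unboundEntry (d x) (r x) (a x) := by
  have hk : Primrec fun x => (d x).1 := Primrec.fst.comp hd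
  have he : Primrec fun x => even (d x) (a x) := primrec_even.comp hd ha
  have hent : Primrec₂ fun x b => entry (d x) (r x) b :=
    primrec_entry (hd.comp Primrec.fst) (hr.comp Primrec.fst) Primrec.snd
  have hnorm : Primrec₂ fun x j => normal (d x) (a x) j :=
    primrec_normal (hd.comp Primrec.fst) (ha.comp Primrec.fst) Primrec.snd
  have hfv : Primrec₂ fun x b => (entry (d x) (r x) b).2 := Primrec.snd.comp hent
  have hfv' : Primrec₂ fun (p : α × ℕ) b => (entry (d p.1) (r p.1) b).2 :=
    hfv.comp (Primrec.fst.comp Primrec.fst) Primrec.snd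
  have hprune : Primrec₂ fun x j => (normal (d x) (a x) j).prune (even (d x) (a x))
      fun b => (entry (d x) (r x) b).2.isEmpty :=
    primrec_dnfPrune (he.comp Primrec.fst) (primrec_listIsEmpty.comp hfv').to₂ hnorm
  have hvars : Primrec fun x => (List.range (2 ^ (d x).1)).flatMap fun j =>
      (normal (d x) (a x) j).preds.flatMap fun b => (entry (d x) (r x) b).2 :=
    Primrec.list_flatMap (Primrec.list_range.comp (primrec_nat_pow.comp (Primrec.const 2) hk))
      (Primrec.list_flatMap (primrec_dnfPreds.comp hnorm) hfv').to₂
  have hne : Primrec₂ fun x (c : ℕ) => decide (c ≠ a x) :=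
    (Primrec.eq.comp (Primrec.snd (α := α)) (ha.comp Primrec.fst)).not.decide
  exact Primrec.pair (primrec_fix he (Primrec.nat_add.comp hk ha)
    (primrec_natBody hk hprune (Primrec.fst.comp hent))) (primrec_listFilterBool hvars hne)

theorem primrec_tableStep : Primrec₂ tableStep := by
  have hd : Primrec fun x : (AutData × List (List (ℕ × List ℕ))) × ℕ => x.1.1 :=
    Primrec.fst.comp Primrec.fst
  have hl : Primrec fun x : (AutData × List (List (ℕ × List ℕ))) × ℕ => x.1.2 :=
    Primrec.snd.comp Primrec.fst
  have hlen := Primrec.list_length.comp hl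
  have hr := (Primrec.list_getD []).comp hl
    (Primrec.nat_sub.comp hlen (primrec_nat_pow.comp (Primrec.const 2) Primrec.snd))
  have : Primrec₂ fun (x : AutData × List (List (ℕ × List ℕ))) (a : ℕ) =>
      bif x.2.length.testBit a then
        unboundEntry x.1 (x.2.getD (x.2.length - 2 ^ a) []) a
      else (natOps.var (x.1.1 + a), [a]) :=
    Primrec.cond (primrec_testBit.comp hlen Primrec.snd)
      (primrec_unboundEntry hd hr Primrec.snd) (primrec_var hd Primrec.snd)
  exact Primrec.list_map (Primrec.list_range.comp
    (Primrec.fst.comp (Primrec.snd.comp Primrec.fst))) this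

theorem primrec_translate : Primrec translate :=
  Primrec.fst.comp (primrec_entry Primrec.id
    (primrec_tableStep.comp Primrec.id (primrec_valueTable primrec_tableStep
      (Primrec.nat_sub.comp (primrec_nat_pow.comp (Primrec.const 2)
        (Primrec.fst.comp Primrec.snd)) (Primrec.const 1))))
    (Primrec.fst.comp (Primrec.snd.comp Primrec.snd)))

end AutData

end Primrec

end ModalMu

theorem theoremt :
    ∃ f : ℕ × ℕ × ℕ × List ℕ × List (List ℕ) → ℕ, Computable f ∧
      ∀ (k n : ℕ) (𝔸 : ModalMu.Automaton k (Fin n)), 𝔸.IsContinuousWeak →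
        ∃ ξ : ModalMu.MuML, f 𝔸.data = ξ.code ∧ ξ.MuC ∧ ξ.free ⊆ {p | p < k} ∧
          ∀ (T : Type*) (S : ModalMu.LTS T), 𝔸.Accepts S ↔ ξ.Holds S :=
  ⟨ModalMu.AutData.translate, ModalMu.AutData.primrec_translate.to_comp, fun _ n 𝔸 h𝔸 =>
    ⟨𝔸.formula (2 ^ n - 1) 𝔸.init, ModalMu.AutData.translate_data 𝔸,
      ModalMu.Automaton.muC_formula_init h𝔸, ModalMu.Automaton.free_formula_init,
      fun _ _ => ModalMu.Automaton.accepts_iff_holds h𝔸⟩⟩
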